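/- Let $Vir=\bigoplus_{n\in\mathbb Z}\mathbb C L(n)\oplus\mathbb C c$ be the Virasoro Lie algebra, with $c$ central and $[L(m),L(n)]=(m-n)L(m+n)+\delta_{m+n,0}\frac{m^3-m}{12}c$. Let $\ell\in\mathbb C$ be any complex number, let $\mathbb C_\ell$ be the one-dimensional module of the Lie subalgebra $Vir_{(\ge 0)}=\bigoplus_{n\ge -1}\mathbb C L(n)\oplus\mathbb C c$ on which $c$ acts as $\ell$ and every $L(n)$ with $n\ge -1$ acts as zero, and let $$V_{Vir}(\ell,0)=U(Vir)\otimes_{U(Vir_{(\ge 0)})}\mathbb C_\ell,\qquad \mathbf 1=1\otimes 1,\qquad \omega=L(-2)\mathbf 1 .$$ Then there is exactly one vertex algebra structure $Y(\cdot,x)$ on $V_{Vir}(\ell,0)$ with vacuum vector $\mathbf 1$ and $Y(\omega,x)=\sum_{n\in\mathbb Z}L(n)x^{-n-2}$; with the conformal vector $\omega$ it is a vertex operator algebra of central charge $\ell$; and this vertex operator algebra $V=V_{Vir}(\ell,0)$ is nondegenerate, that is, for every integer $n\ge 1$ the linear map $$Z_n: V^{\otimes n}\otimes\mathbb C((x_1))\cdots((x_n))\to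 V((x_1))\cdots((x_n)),$$ $$Z_n(u_1\otimes\cdots\otimes u_n\otimes f)=f\,Y(u_1,x_1)\cdots Y(u_n,x_n)\mathbf 1,$$ is injective. -/

import Mathlib

universe u

open scoped TensorProduct

/-! ### The Virasoro Lie algebra -/

/-- The underlying space `⨁ ℂ L(n) ⊕ ℂ c` of the Virasoro Lie algebra: the first component
holds the coefficients of the `L(n)`, the second one the coefficient of `c`. -/
structure Virasoro : Type where
  wittPart : ℤ →₀ ℂ
  central : ℂ

namespace Virasoro

noncomputable section

/-- The obvious bijection with a product of vector spaces. -/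
def toProd : Virasoro ≃ (ℤ →₀ ℂ) × ℂ where
  toFun x := (x.wittPart, x.central)
  invFun p := ⟨p.1, p.2⟩
  left_inv _ := rfl
  right_inv _ := rfl

instance : AddCommGroup Virasoro := toProd.addCommGroup

instance : Module ℂ Virasoro := toProd.module ℂ

@[ext] theorem ext {x y : Virasoro} (h : x.wittPart = y.wittPart) (h' : x.central = y.central) :
    x = y := by
  cases x; cases y; simp_all

@[simp] theorem wittPart_add (x y : Virasoro) :
    (x + y).wittPart = x.wittPart + y.wittPart := rfl
@[simp] theorem central_add (x y : Virasoro) : (x + y).central = x.central + y.central := rfl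
@[simp] theorem wittPart_zero : (0 : Virasoro).wittPart = 0 := rfl
@[simp] theorem central_zero : (0 : Virasoro).central = 0 := rfl
@[simp] theorem wittPart_smul (a : ℂ) (x : Virasoro) : (a • x).wittPart = a • x.wittPart := rfl
@[simp] theorem central_smul (a : ℂ) (x : Virasoro) : (a • x).central = a • x.central := rfl

/-- The basis element `L(n)`. -/
def L (n : ℤ) : Virasoro := ⟨Finsupp.single n 1, 0⟩

/-- The central element `c`. -/
def c : Virasoro := ⟨0, 1⟩

/-- The bilinear map with `(L(m), L(n)) ↦ (m - n) L(m + n)`. -/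
def wittBracket : (ℤ →₀ ℂ) →ₗ[ℂ] (ℤ →₀ ℂ) →ₗ[ℂ] (ℤ →₀ ℂ) :=
  Finsupp.lift _ ℂ ℤ fun m => Finsupp.lift _ ℂ ℤ fun n =>
    Finsupp.single (m + n) ((m : ℂ) - n)

/-- The bilinear form with `(L(m), L(n)) ↦ δ_{m+n,0} (m³ - m) / 12`. -/
def cocycle : (ℤ →₀ ℂ) →ₗ[ℂ] (ℤ →₀ ℂ) →ₗ[ℂ] ℂ :=
  Finsupp.lift _ ℂ ℤ fun m => Finsupp.lift _ ℂ ℤ fun n =>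
    if m + n = 0 then ((m : ℂ) ^ 3 - m) / 12 else 0

@[simp] theorem wittBracket_single (m n : ℤ) (a b : ℂ) :
    wittBracket (Finsupp.single m a) (Finsupp.single n b)
      = Finsupp.single (m + n) (a * b * ((m : ℂ) - n)) := by
  simp [wittBracket, mul_assoc, -Finsupp.single_sub, -Finsupp.single_mul]

@[simp] theorem cocycle_single (m n : ℤ) (a b : ℂ) :
    cocycle (Finsupp.single m a) (Finsupp.single n b)
      = if m + n = 0 then a * b * (((m : ℂ) ^ 3 - m) / 12) else 0 := by
  simp [cocycle, mul_assoc]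

theorem wittBracket_skew (x y : ℤ →₀ ℂ) : wittBracket x y = - wittBracket y x := by
  have h : wittBracket = (-1 : ℂ) • wittBracket.flip := by
    refine Finsupp.lhom_ext' fun m => LinearMap.ext_ring ?_
    refine Finsupp.lhom_ext' fun n => LinearMap.ext_ring ?_
    simp only [LinearMap.coe_comp, Function.comp_apply, Finsupp.lsingle_apply, wittBracket_single,
      LinearMap.smul_apply, LinearMap.flip_apply, add_comm n m, Finsupp.smul_single]
    congr 1
    simp
  rw [← neg_one_smul ℂ (wittBracket y x)]
  exact congrArg (fun f => f x y) h

theorem cocycle_skew (x y : ℤ →₀ ℂ) : cocycle x y = - cocycle y x := by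
  have h : cocycle = (-1 : ℂ) • cocycle.flip := by
    refine Finsupp.lhom_ext' fun m => LinearMap.ext_ring ?_
    refine Finsupp.lhom_ext' fun n => LinearMap.ext_ring ?_
    simp only [LinearMap.coe_comp, Function.comp_apply, Finsupp.lsingle_apply, cocycle_single,
      LinearMap.smul_apply, LinearMap.flip_apply, add_comm n m]
    split_ifs with hmn
    · have : (m : ℂ) = -n := by exact_mod_cast eq_neg_of_add_eq_zero_left hmn
      rw [this, smul_eq_mul]; ring
    · simp
  rw [← neg_one_smul ℂ (cocycle y x)]
  exact congrArg (fun f => f x y) h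

/-- The Lie bracket: `[L(m), L(n)] = (m - n) L(m + n) + δ_{m+n,0} (m³ - m) / 12 c`, with `c`
central. -/
instance : Bracket Virasoro Virasoro where
  bracket x y := ⟨wittBracket x.wittPart y.wittPart, cocycle x.wittPart y.wittPart⟩

@[simp] theorem wittPart_lie (x y : Virasoro) :
    ⁅x, y⁆.wittPart = wittBracket x.wittPart y.wittPart := rfl
@[simp] theorem central_lie (x y : Virasoro) :
    ⁅x, y⁆.central = cocycle x.wittPart y.wittPart := rfl

/-- Two trilinear maps that agree on the basis agree. -/
theorem trilinear_ext {M : Type*} [AddCommGroup M] [Module ℂ M]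
    {f g : (ℤ →₀ ℂ) →ₗ[ℂ] (ℤ →₀ ℂ) →ₗ[ℂ] (ℤ →₀ ℂ) →ₗ[ℂ] M}
    (h : ∀ i j k : ℤ, f (Finsupp.single i 1) (Finsupp.single j 1) (Finsupp.single k 1)
      = g (Finsupp.single i 1) (Finsupp.single j 1) (Finsupp.single k 1)) : f = g := by
  refine Finsupp.lhom_ext' fun i => LinearMap.ext_ring ?_
  refine Finsupp.lhom_ext' fun j => LinearMap.ext_ring ?_
  refine Finsupp.lhom_ext' fun k => LinearMap.ext_ring ?_
  exact h i j k

/-- The trilinear map `(x, y, z) ↦ D x (wittBracket y z)`. -/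
def inRight {M : Type*} [AddCommGroup M] [Module ℂ M]
    (D : (ℤ →₀ ℂ) →ₗ[ℂ] (ℤ →₀ ℂ) →ₗ[ℂ] M) :
    (ℤ →₀ ℂ) →ₗ[ℂ] (ℤ →₀ ℂ) →ₗ[ℂ] (ℤ →₀ ℂ) →ₗ[ℂ] M :=
  (LinearMap.llcomp ℂ _ _ _).flip wittBracket ∘ₗ
    (LinearMap.llcomp ℂ (ℤ →₀ ℂ) (ℤ →₀ ℂ) M) ∘ₗ D

/-- The trilinear map `(x, y, z) ↦ D (wittBracket x y) z`. -/
def inLeft {M : Type*} [AddCommGroup M] [Module ℂ M]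
    (D : (ℤ →₀ ℂ) →ₗ[ℂ] (ℤ →₀ ℂ) →ₗ[ℂ] M) :
    (ℤ →₀ ℂ) →ₗ[ℂ] (ℤ →₀ ℂ) →ₗ[ℂ] (ℤ →₀ ℂ) →ₗ[ℂ] M :=
  (LinearMap.llcomp ℂ _ _ _ D) ∘ₗ wittBracket

theorem inRight_apply {M : Type*} [AddCommGroup M] [Module ℂ M]
    (D : (ℤ →₀ ℂ) →ₗ[ℂ] (ℤ →₀ ℂ) →ₗ[ℂ] M) (x y z : ℤ →₀ ℂ) :
    inRight D x y z = D x (wittBracket y z) := rfl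

theorem inLeft_apply {M : Type*} [AddCommGroup M] [Module ℂ M]
    (D : (ℤ →₀ ℂ) →ₗ[ℂ] (ℤ →₀ ℂ) →ₗ[ℂ] M) (x y z : ℤ →₀ ℂ) :
    inLeft D x y z = D (wittBracket x y) z := rfl

/-- An identity of Leibniz type holds as soon as it holds on the basis. -/
theorem leibniz_of_basis {M : Type*} [AddCommGroup M] [Module ℂ M]
    (D : (ℤ →₀ ℂ) →ₗ[ℂ] (ℤ →₀ ℂ) →ₗ[ℂ] M)
    (h : ∀ i j k : ℤ, D (Finsupp.single i 1) (wittBracket (Finsupp.single j 1)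
        (Finsupp.single k 1))
      = D (wittBracket (Finsupp.single i 1) (Finsupp.single j 1)) (Finsupp.single k 1)
        + D (Finsupp.single j 1) (wittBracket (Finsupp.single i 1) (Finsupp.single k 1)))
    (x y z : ℤ →₀ ℂ) :
    D x (wittBracket y z) = D (wittBracket x y) z + D y (wittBracket x z) := by
  have key : inRight D = inLeft D + (inRight D).flip :=
    trilinear_ext fun i j k => h i j k
  exact congrArg (fun f => f x y z) key

theorem wittBracket_leibniz (x y z : ℤ →₀ ℂ) :
    wittBracket x (wittBracket y z)
      = wittBracket (wittBracket x y) z + wittBracket y (wittBracket x z) := by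
  refine leibniz_of_basis wittBracket (fun i j k => ?_) x y z
  simp only [wittBracket_single, one_mul, mul_one]
  rw [show i + j + k = i + (j + k) by ring, show j + (i + k) = i + (j + k) by ring,
    ← Finsupp.single_add]
  congr 1
  push_cast
  ring

theorem cocycle_leibniz (x y z : ℤ →₀ ℂ) :
    cocycle x (wittBracket y z)
      = cocycle (wittBracket x y) z + cocycle y (wittBracket x z) := by
  refine leibniz_of_basis cocycle (fun i j k => ?_) x y z
  simp only [wittBracket_single, cocycle_single, one_mul, mul_one]
  rw [show i + j + k = i + (j + k) by ring, show j + (i + k) = i + (j + k) by ring]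
  split_ifs with h
  · have hi : (i : ℂ) = -j - k := by
      have : i = -j - k := by omega
      rw [this]; push_cast; ring
    push_cast
    rw [hi]
    ring
  · simp

instance : LieRing Virasoro where
  add_lie x y z := by ext1 <;> simp
  lie_add x y z := by ext1 <;> simp
  lie_self x := by
    ext1
    · exact self_eq_neg.mp (wittBracket_skew x.wittPart x.wittPart)
    · exact self_eq_neg.mp (cocycle_skew x.wittPart x.wittPart)
  leibniz_lie x y z := by
    ext1
    · exact wittBracket_leibniz _ _ _
    · exact cocycle_leibniz _ _ _

instance : LieAlgebra ℂ Virasoro where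
  lie_smul t x y := by ext1 <;> simp

theorem lie_L_L (m n : ℤ) :
    ⁅L m, L n⁆ = ((m : ℂ) - n) • L (m + n)
      + (if m + n = 0 then ((m : ℂ) ^ 3 - m) / 12 else 0) • c := by
  split_ifs with h <;> ext1 <;> simp [L, c, h, -Finsupp.single_sub]

theorem lie_c (x : Virasoro) : ⁅x, c⁆ = 0 := by
  ext1 <;> simp [c]

/-- The universal enveloping algebra `U(Vir)`. -/
abbrev Env : Type := UniversalEnvelopingAlgebra ℂ Virasoro

/-- An element of the Virasoro algebra, viewed in `U(Vir)`. -/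
abbrev toEnv (x : Virasoro) : Env := UniversalEnvelopingAlgebra.ι ℂ x

/-- The left ideal of `U(Vir)` generated by the `L(n)`, `n ≥ -1`, and by `c - ℓ`. -/
def vacuumIdeal (ℓ : ℂ) : Submodule Env Env :=
  Submodule.span Env
    ({x | ∃ n : ℤ, -1 ≤ n ∧ x = toEnv (L n)} ∪ {toEnv c - algebraMap ℂ Env ℓ})

/-- The induced module `V_Vir(ℓ,0) = U(Vir) ⊗_{U(Vir_{(≥0)})} ℂ_ℓ`, where `Vir_{(≥0)}` is spanned
by `c` and the `L(n)` with `n ≥ -1`, and where on `ℂ_ℓ` the element `c` acts as `ℓ` and these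
`L(n)` act as zero. Since `ℂ_ℓ` is the quotient of `U(Vir_{(≥0)})` by the left ideal generated by
`c - ℓ` and these `L(n)`, the induced module is the quotient of `U(Vir)` by the left ideal generated
by the same elements; its universal property is `existsUnique_lift` below. -/
abbrev VacuumModule (ℓ : ℂ) : Type := Env ⧸ vacuumIdeal ℓ

namespace VacuumModule

variable (ℓ : ℂ)

/-- The vacuum vector `𝟏 = 1 ⊗ 1`. -/
def vac : VacuumModule ℓ := Submodule.Quotient.mk (1 : Env)

/-- The operator on `V_Vir(ℓ,0)` by which `L(n)` acts. -/
def opL (n : ℤ) : Module.End ℂ (VacuumModule ℓ) :=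
  Module.toModuleEnd ℂ (VacuumModule ℓ) (toEnv (L n))

/-- The conformal vector `ω = L(-2) 𝟏`. -/
def conformal : VacuumModule ℓ := opL ℓ (-2) (vac ℓ)

/-- A `U(Vir)`-module map from `V_Vir(ℓ,0)` is the same as a vector killed by all `L(n)` with
`n ≥ -1` on which `c` acts as `ℓ`. -/
theorem existsUnique_lift {W : Type u} [AddCommGroup W] [Module Env W] (w : W)
    (hL : ∀ n : ℤ, -1 ≤ n → toEnv (L n) • w = 0)
    (hc : toEnv c • w = algebraMap ℂ Env ℓ • w) :
    ∃! f : VacuumModule ℓ →ₗ[Env] W, f (vac ℓ) = w := by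
  refine ⟨(vacuumIdeal ℓ).liftQ (LinearMap.toSpanSingleton Env W w) ?_, ?_, ?_⟩
  · rw [vacuumIdeal, Submodule.span_le]
    rintro x (⟨n, hn, rfl⟩ | rfl)
    · simpa using hL n hn
    · simp only [SetLike.mem_coe, LinearMap.mem_ker, LinearMap.toSpanSingleton_apply, sub_smul, hc,
        sub_self]
  · exact ((vacuumIdeal ℓ).liftQ_apply _ _).trans (by simp)
  · intro g hg
    refine Submodule.linearMap_qext _ (LinearMap.ext_ring ?_)
    simpa [vac] using hg

end VacuumModule

end

end Virasoro

/-! ### Vertex algebras and vertex operator algebras -/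

noncomputable section

open VertexOperator

/-- A vertex algebra structure on the complex vector space `V`. Here `Y u` is a linear map
`V → V((x))` and `(Y u)[[n]]` is the coefficient `u_n` of `x^{-n-1}` in it. -/
structure VertexAlgebraStructure (V : Type u) [AddCommGroup V] [Module ℂ V] where
  /-- the vertex operator map `u ↦ Y(u, x) = ∑ u_n x^{-n-1}` -/
  Y : V →ₗ[ℂ] VertexOperator ℂ V
  /-- the vacuum vector `𝟏` -/
  vac : V
  /-- `Y(𝟏, x) = 1` -/
  vacuum : ∀ (n : ℤ) (v : V), ((Y vac)[[n]]) v = if n = -1 then v else 0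
  /-- `Y(v, x) 𝟏 ∈ V[[x]]` -/
  creation : ∀ (v : V) (n : ℤ), 0 ≤ n → ((Y v)[[n]]) vac = 0
  /-- the constant term of `Y(v, x) 𝟏` is `v` -/
  creation_const : ∀ v : V, ((Y v)[[-1]]) vac = v
  /-- The Jacobi identity, written out in coefficients (the Borcherds identity). As `Y(u, x)v`,
  `Y(u, x)w` and `Y(v, x)w` are Laurent series, all but finitely many terms of each of the two sums
  vanish. -/
  jacobi : ∀ (u v w : V) (p q r : ℤ),
    ∑ᶠ i : ℕ, ((Ring.choose p i : ℤ) : ℂ) • ((Y (((Y u)[[r + i]]) v))[[p + q - i]]) w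
      = ∑ᶠ i : ℕ, ((-1 : ℂ) ^ i * ((Ring.choose r i : ℤ) : ℂ)) •
          (((Y u)[[p + r - i]]) (((Y v)[[q + i]]) w)
            - (-1 : ℂ) ^ r • ((Y v)[[q + r - i]]) (((Y u)[[p + i]]) w))

/-- The vertex algebra `A`, with the conformal vector `ω`, is a vertex operator algebra of central
charge `ℓ`. Here `L(n) = ω_{n+1}`. -/
structure VertexAlgebraStructure.IsVertexOperatorAlgebra {V : Type u} [AddCommGroup V]
    [Module ℂ V] (A : VertexAlgebraStructure V) (ω : V) (ℓ : ℂ) : Prop where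
  /-- the Virasoro relations -/
  virasoro : ∀ (m n : ℤ) (v : V),
    ((A.Y ω)[[m + 1]]) (((A.Y ω)[[n + 1]]) v) - ((A.Y ω)[[n + 1]]) (((A.Y ω)[[m + 1]]) v)
      = ((m : ℂ) - n) • ((A.Y ω)[[m + n + 1]]) v
        + (if m + n = 0 then ((m : ℂ) ^ 3 - m) / 12 * ℓ else 0) • v
  /-- `Y(L(-1) v, x) = d/dx Y(v, x)` -/
  derivative : ∀ (v : V) (n : ℤ),
    (A.Y (((A.Y ω)[[0]]) v))[[n]] = (-n : ℂ) • (A.Y v)[[n - 1]]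
  /-- `V` is the direct sum of the spaces `V_(n)`, `n ∈ ℤ`, on which `L(0)` acts as `n` -/
  grading : DirectSum.IsInternal
    fun n : ℤ => Module.End.eigenspace ((A.Y ω)[[1]]) (n : ℂ)
  /-- each `V_(n)` is finite-dimensional -/
  finiteDimensional : ∀ n : ℤ,
    FiniteDimensional ℂ (Module.End.eigenspace ((A.Y ω)[[1]]) (n : ℂ))
  /-- `V_(n) = 0` for `n` sufficiently small -/
  lowerTruncated : ∃ N : ℤ, ∀ n < N, Module.End.eigenspace ((A.Y ω)[[1]]) (n : ℂ) = ⊥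

/-! ### Iterated Laurent series -/

namespace IteratedLaurent

/-- A field extension of `ℂ`, bundled. -/
structure FieldExt where
  carrier : Type
  [field : Field carrier]
  [algebra : Algebra ℂ carrier]

attribute [instance] FieldExt.field FieldExt.algebra

/-- The fields `ℂ`, `ℂ((x₁))`, `ℂ((x₁))((x₂))`, … -/
def fieldTower : ℕ → FieldExt
  | 0 => ⟨ℂ⟩
  | n + 1 =>
    { carrier := HahnSeries ℤ (fieldTower n).carrier
      algebra := HahnSeries.instAlgebra }

/-- The field `ℂ((x₁))((x₂))⋯((x_n))`. -/
abbrev Scalars (n : ℕ) : Type := (fieldTower n).carrier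

/-- A vector space over `ℂ((x₁))⋯((x_n))`, bundled. -/
structure VectorSpaceOver (n : ℕ) where
  carrier : Type u
  [addCommGroup : AddCommGroup carrier]
  [module : Module (Scalars n) carrier]

attribute [instance] VectorSpaceOver.addCommGroup VectorSpaceOver.module

variable (V : Type u) [AddCommGroup V] [Module ℂ V]

/-- `V` as a vector space over the field `ℂ`, the bottom of the tower. -/
def VectorSpaceOver.base : VectorSpaceOver.{u} 0 :=
  letI : Module (Scalars 0) V := inferInstanceAs (Module ℂ V)
  ⟨V⟩

/-- The space `M((x_{n+1}))`, on which the field `F((x_{n+1}))`, where `F = ℂ((x₁))⋯((x_n))`, acts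
by multiplication of series. -/
def VectorSpaceOver.next {n : ℕ} (M : VectorSpaceOver.{u} n) : VectorSpaceOver.{u} (n + 1) :=
  letI : Module (Scalars (n + 1)) (HahnModule ℤ (Scalars n) M.carrier) :=
    inferInstanceAs (Module (HahnSeries ℤ (Scalars n)) (HahnModule ℤ (Scalars n) M.carrier))
  ⟨HahnModule ℤ (Scalars n) M.carrier⟩

/-- The spaces `V`, `V((x₁))`, `V((x₁))((x₂))`, …, each over the corresponding field. -/
def vectorTower : (n : ℕ) → VectorSpaceOver.{u} n
  | 0 => VectorSpaceOver.base V
  | n + 1 => (vectorTower n).next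

/-- The space `V((x₁))((x₂))⋯((x_n))`. -/
abbrev Vectors (n : ℕ) : Type u := (vectorTower V n).carrier

/-- The complex scalars act through `ℂ ⊆ ℂ((x₁))⋯((x_n))`. -/
instance (n : ℕ) : Module ℂ (Vectors V n) := Module.compHom _ (algebraMap ℂ (Scalars n))

instance (n : ℕ) : IsScalarTower ℂ (Scalars n) (Vectors V n) :=
  ⟨fun a f v => by
    rw [Algebra.smul_def, mul_smul]
    rfl⟩

variable {V}

/-- An element of `V((x₁))⋯((x_{n+1}))`, as a Laurent series in `x_{n+1}`. -/
def toSeries {n : ℕ} (s : Vectors V (n + 1)) : HahnSeries ℤ (Vectors V n) :=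
  (HahnModule.of (Scalars n)).symm s

/-- A Laurent series in `x_{n+1}` over `V((x₁))⋯((x_n))`, as an element of
`V((x₁))⋯((x_{n+1}))`. -/
def ofSeries {n : ℕ} (s : HahnSeries ℤ (Vectors V n)) : Vectors V (n + 1) :=
  HahnModule.of (Scalars n) s

theorem toSeries_ofSeries {n : ℕ} (s : HahnSeries ℤ (Vectors V n)) :
    toSeries (ofSeries s) = s := rfl

theorem toSeries_injective {n : ℕ} :
    Function.Injective (toSeries : Vectors V (n + 1) → HahnSeries ℤ (Vectors V n)) :=
  (HahnModule.of (Scalars n)).symm.injective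

theorem toSeries_add {n : ℕ} (s t : Vectors V (n + 1)) :
    toSeries (s + t) = toSeries s + toSeries t := rfl

theorem toSeries_smul_coeff {n : ℕ} (a : ℂ) (s : Vectors V (n + 1)) (k : ℤ) :
    (toSeries (a • s)).coeff k = a • (toSeries s).coeff k := by
  have h : algebraMap ℂ (Scalars (n + 1)) a
      = (HahnSeries.single (0 : ℤ) (algebraMap ℂ (Scalars n) a) : HahnSeries ℤ (Scalars n)) :=
    (HahnSeries.algebraMap_apply (Γ := ℤ) (R := ℂ) (A := Scalars n) (r := a)).trans rfl
  have h' : a • s = algebraMap ℂ (Scalars (n + 1)) a • s := rfl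
  rw [h', h]
  exact HahnModule.coeff_single_zero_smul

/-- For `g : V → V((x₁))⋯((x_n))` and `T : V → V((x_{n+1}))`, the composition of `T` with the
coefficientwise application of `g`, a map `V → V((x₁))⋯((x_n))((x_{n+1}))`. -/
def extend {n : ℕ} (g : V →ₗ[ℂ] Vectors V n) (T : VertexOperator ℂ V) :
    V →ₗ[ℂ] Vectors V (n + 1) where
  toFun v := ofSeries (((HahnModule.of ℂ).symm (T v)).map g)
  map_add' v w := by
    apply toSeries_injective
    ext k
    simp [toSeries_add, toSeries_ofSeries]
  map_smul' a v := by
    apply toSeries_injective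
    ext k
    rw [RingHom.id_apply, toSeries_smul_coeff]
    rw [map_smul, toSeries_ofSeries, toSeries_ofSeries, HahnSeries.map_coeff, HahnSeries.map_coeff]
    exact map_smul g a _

theorem toSeries_extend_coeff {n : ℕ} (g : V →ₗ[ℂ] Vectors V n) (T : VertexOperator ℂ V) (v : V)
    (k : ℤ) : (toSeries (extend g T v)).coeff k = g (HVertexOperator.coeff T k v) := rfl

/-- `extend` as a bilinear map. -/
def extendBilinear (n : ℕ) :
    (V →ₗ[ℂ] Vectors V n) →ₗ[ℂ] VertexOperator ℂ V →ₗ[ℂ] (V →ₗ[ℂ] Vectors V (n + 1)) :=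
  LinearMap.mk₂ ℂ extend
    (fun g g' T => by
      ext v
      apply toSeries_injective
      ext k
      simp [toSeries_add, toSeries_extend_coeff])
    (fun a g T => by
      ext v
      apply toSeries_injective
      ext k
      simp [toSeries_smul_coeff, toSeries_extend_coeff])
    (fun g T T' => by
      ext v
      apply toSeries_injective
      ext k
      simp [toSeries_add, toSeries_extend_coeff])
    (fun a g T => by
      ext v
      apply toSeries_injective
      ext k
      simp [toSeries_smul_coeff, toSeries_extend_coeff])

/-- `V` is the bottom of the tower of iterated Laurent series. -/
def ofVector : V →ₗ[ℂ] Vectors V 0 where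
  toFun v := v
  map_add' _ _ := rfl
  map_smul' _ _ := rfl

end IteratedLaurent

namespace VertexAlgebraStructure

open IteratedLaurent

variable {V : Type u} [AddCommGroup V] [Module ℂ V] (A : VertexAlgebraStructure V)

/-- The map `(u₁, …, u_n) ↦ Y(u₁, x₁) ⋯ Y(u_n, x_n)`, multilinear in the `u_i`, with values in the
linear maps from `V` to `V((x₁))⋯((x_n))`. As
`Y(u_{n+1}, x_{n+1})v = ∑ₖ vₖ x_{n+1}^k` is a Laurent series over `V`, the series
`Y(u₁, x₁) ⋯ Y(u_{n+1}, x_{n+1})v = ∑ₖ Y(u₁, x₁) ⋯ Y(u_n, x_n)vₖ x_{n+1}^k` is one over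
`V((x₁))⋯((x_n))`. -/
def product : (n : ℕ) → MultilinearMap ℂ (fun _ : Fin n => V) (V →ₗ[ℂ] Vectors V n)
  | 0 => MultilinearMap.constOfIsEmpty ℂ _ ofVector
  | n + 1 => MultilinearMap.uncurryRight (M := fun _ : Fin (n + 1) => V)
      (((LinearMap.lcomp ℂ (V →ₗ[ℂ] Vectors V (n + 1)) A.Y) ∘ₗ extendBilinear n).compMultilinearMap
        (product n))

theorem product_zero (u : Fin 0 → V) (v : V) : A.product 0 u v = ofVector v := rfl

theorem product_succ {n : ℕ} (u : Fin (n + 1) → V) (v : V) :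
    A.product (n + 1) u v = extend (A.product n (Fin.init u)) (A.Y (u (Fin.last n))) v := rfl

/-- The linear map `u₁ ⊗ ⋯ ⊗ u_n ↦ Y(u₁, x₁) ⋯ Y(u_n, x_n) 𝟏`. -/
def productVacuum (n : ℕ) : (⨂[ℂ] _ : Fin n, V) →ₗ[ℂ] Vectors V n :=
  LinearMap.applyₗ A.vac ∘ₗ PiTensorProduct.lift (A.product n)

/-- The linear map `Z_n : V^{⊗n} ⊗ ℂ((x₁))⋯((x_n)) → V((x₁))⋯((x_n))` with
`Z_n(u₁ ⊗ ⋯ ⊗ u_n ⊗ f) = f Y(u₁, x₁) ⋯ Y(u_n, x_n) 𝟏`. -/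
def Z (n : ℕ) : (⨂[ℂ] _ : Fin n, V) ⊗[ℂ] Scalars n →ₗ[ℂ] Vectors V n :=
  TensorProduct.lift
    ((Algebra.lsmul ℂ ℂ (Vectors V n)).toLinearMap.flip ∘ₗ A.productVacuum n)

theorem Z_apply (n : ℕ) (u : Fin n → V) (f : Scalars n) :
    A.Z n (PiTensorProduct.tprod ℂ u ⊗ₜ f) = f • A.product n u A.vac := by
  simp [Z, productVacuum]

/-- Nondegeneracy: all the maps `Z_n`, `n ≥ 1`, are injective. -/
def IsNondegenerate : Prop := ∀ n : ℕ, 0 < n → Function.Injective (A.Z n)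

end VertexAlgebraStructure

/-- `A` is the vertex algebra structure of `V_Vir(ℓ,0)`: the vacuum vector is `𝟏 = 1 ⊗ 1`, and
`Y(ω, x) = ∑ L(n) x^{-n-2}` for `ω = L(-2) 𝟏`. -/
structure Virasoro.IsVacuumVertexAlgebra (ℓ : ℂ)
    (A : VertexAlgebraStructure (Virasoro.VacuumModule ℓ)) : Prop where
  vac_eq : A.vac = Virasoro.VacuumModule.vac ℓ
  Y_conformal : ∀ n : ℤ,
    (A.Y (Virasoro.VacuumModule.conformal ℓ))[[n + 1]] = Virasoro.VacuumModule.opL ℓ n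

end

/-!
Write `V` for the vacuum module of central charge `ℓ`.

*The vertex algebra.* The field `L(x) = ∑ L(n) x^{-n-2}` on `V` is local with respect to itself, by
the commutation relations. For fields `A`, `B` and `r ∈ ℤ` there is an `r`-th product `nthProd A B r`,
and Dong's lemma (`VertexField.IsLocal.nthProd`) says that it preserves locality. Hence the fields
obtained from the identity by iterating the products with `L(x)` are mutually local, create vectors
from the vacuum and are covariant under `L(-1)`. By Goddard's uniqueness theorem
(`VertexField.IsLocal.ncoeff_eq_zero`) such a field is determined by the vector that it creates, and
every vector occurs, because the vacuum generates `V`. This gives `Y`. Mutual locality yields the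
Borcherds identity for two fields (`VertexField.IsLocal.borcherds_identity`), and uniqueness
identifies the products of fields with the fields of products. Conversely, the Borcherds identity
forces `Y(L(n)v, x)` to be a product of `L(x)` and `Y(v, x)`, which proves uniqueness of `Y`.

*The vertex operator algebra.* The sorted monomials `L(-k₁-2) ⋯ L(-k_m-2) 𝟏` span `V`
(`Virasoro.VacuumModule.span_monomial`), and they are eigenvectors of `L(0)` with finitely many for
each eigenvalue.

*Nondegeneracy.* Filter `V` by the length of monomials. For a polynomial `p = ∑ p_k x^k` there are
linear forms `σ_m` on `V` that vanish on shorter monomials and take a monomial of length `m` to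
`p_{k₁} ⋯ p_{k_m}` (`Virasoro.VacuumModule.exists_isSymbol`). Such forms exist because `V` maps to a
Fock space of two free bosons, on which `L(-k-2)` is, up to terms of lower degree, multiplication by
the coefficient of `x^k` in the product of the bosons; a background charge makes every central
charge possible. This replaces the Poincaré-Birkhoff-Witt theorem.

On top degree, `Y(u, x)` for a monomial `u` acts as multiplication by `∏ p^{(k_j)}(x) / k_j!`, so
that a relation `∑ f_s Y(u_{s 1}, x₁) ⋯ Y(u_{s n}, x_n) 𝟏 = 0` between monomials turns into
`∑ f_s ∏ᵢ ∏_{k ∈ s i} p^{(k)}(x_i) / k! = 0` for all `p`, where the sum is over the terms of highest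
length. As the `x_i` are distinct elements of a field extension of `ℂ`, the values `p^{(k)}(x_i)`
satisfy no polynomial relation that holds for all `p` (`eq_zero_of_forall_eval_hasseDeriv`), and all
these `f_s` vanish.
-/

noncomputable section

open VertexOperator

/-! ### Residue sums -/

namespace VertexField

section ResidueSum

variable {W : Type u} [AddCommGroup W] [Module ℂ W]

/-- The coefficient `(-1)^i (r choose i)` of `x^{r-i} y^i` in `(x - y)^r`. -/
def binomCoeff (r : ℤ) (i : ℕ) : ℂ := (-1 : ℂ) ^ i * ((Ring.choose r i : ℤ) : ℂ)

@[simp] theorem binomCoeff_zero_right (r : ℤ) : binomCoeff r 0 = 1 := by simp [binomCoeff]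

theorem binomCoeff_zero_succ (i : ℕ) : binomCoeff 0 (i + 1) = 0 := by
  simp [binomCoeff, Ring.choose_zero_succ]

theorem binomCoeff_succ_succ (r : ℤ) (i : ℕ) :
    binomCoeff (r + 1) (i + 1) = binomCoeff r (i + 1) - binomCoeff r i := by
  simp only [binomCoeff, Ring.choose_succ_succ]
  push_cast
  ring

/-- The coefficient of `x^{-p-1} y^{-q-1}` in `(x - y)^r g(x, y)`, with `(x - y)^r` expanded in
nonnegative powers of `y` and `g(x, y) = ∑ g(m, n) x^{-m-1} y^{-n-1}`. -/
def residueSum (r : ℤ) (g : ℤ → ℤ → W) (p q : ℤ) : W :=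
  ∑ᶠ i : ℕ, binomCoeff r i • g (p + r - i) (q + i)

theorem residueSum_eq_sum (r : ℤ) {g : ℤ → ℤ → W} {N : ℤ} (hg : ∀ m n, N ≤ n → g m n = 0)
    (p q : ℤ) (K : ℕ) (hK : N ≤ q + K) :
    residueSum r g p q = ∑ i ∈ Finset.range K, binomCoeff r i • g (p + r - i) (q + i) := by
  refine finsum_eq_sum_of_support_subset _ fun i hi => ?_
  by_contra h
  refine hi ?_
  have : K ≤ i := by simpa using h
  beta_reduce
  rw [hg _ _ (by omega), smul_zero]

theorem residueSum_succ (r : ℤ) {g : ℤ → ℤ → W} {N : ℤ} (hg : ∀ m n, N ≤ n → g m n = 0)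
    (p q : ℤ) :
    residueSum (r + 1) g p q = residueSum r g (p + 1) q - residueSum r g p (q + 1) := by
  set K := (N - q).toNat
  have hK : N ≤ q + K := by have := Int.self_le_toNat (N - q); omega
  rw [residueSum_eq_sum _ hg p q (K + 1) (by push_cast; omega),
    residueSum_eq_sum _ hg (p + 1) q (K + 1) (by push_cast; omega),
    residueSum_eq_sum _ hg p (q + 1) K (by omega), Finset.sum_range_succ' _ K, Finset.sum_range_succ' _ K,
    show ∀ a b c : W, a + b - c = (a - c) + b from fun a b c => by abel, ← Finset.sum_sub_distrib]
  congr 1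
  · refine Finset.sum_congr rfl fun i _ => ?_
    rw [binomCoeff_succ_succ, sub_smul]
    push_cast
    congr 3 <;> ring
  · simp only [binomCoeff_zero_right]
    congr 2
    ring

theorem residueSum_zero {g : ℤ → ℤ → W} (p q : ℤ) : residueSum 0 g p q = g p q := by
  rw [residueSum, finsum_eq_single _ 0]
  · simp
  · rintro (_ | i) hi
    · exact absurd rfl hi
    · rw [binomCoeff_zero_succ, zero_smul]

theorem residueSum_support_finite (r : ℤ) {g : ℤ → ℤ → W} {N : ℤ}
    (hg : ∀ m n, N ≤ n → g m n = 0) (p q : ℤ) :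
    (Function.support fun i : ℕ => binomCoeff r i • g (p + r - i) (q + i)).Finite := by
  refine (Finset.range (N - q).toNat).finite_toSet.subset fun i hi => ?_
  by_contra h
  have : (N - q).toNat ≤ i := by simpa using h
  exact hi (by beta_reduce; rw [hg _ _ (by omega), smul_zero])

theorem residueSum_add (r : ℤ) {g h : ℤ → ℤ → W} {N N' : ℤ} (hg : ∀ m n, N ≤ n → g m n = 0)
    (hh : ∀ m n, N' ≤ n → h m n = 0) (p q : ℤ) :
    residueSum r (g + h) p q = residueSum r g p q + residueSum r h p q := by
  rw [residueSum, residueSum, residueSum, ← finsum_add_distrib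
    (residueSum_support_finite r hg p q) (residueSum_support_finite r hh p q)]
  simp

theorem residueSum_map (r : ℤ) {W' : Type u} [AddCommGroup W'] [Module ℂ W'] (f : W →ₗ[ℂ] W')
    {g : ℤ → ℤ → W} {N : ℤ} (hg : ∀ m n, N ≤ n → g m n = 0) (p q : ℤ) :
    residueSum r (fun m n => f (g m n)) p q = f (residueSum r g p q) := by
  have hK : N ≤ q + (N - q).toNat := by have := Int.self_le_toNat (N - q); omega
  rw [residueSum_eq_sum r hg p q _ hK,
    residueSum_eq_sum r (g := fun m n => f (g m n)) (N := N)
      (fun m n h => by rw [hg m n h, map_zero]) p q _ hK, map_sum]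
  simp

end ResidueSum

/-! ### Products of fields and the Borcherds identity -/

variable {V : Type u} [AddCommGroup V] [Module ℂ V]

theorem exists_ncoeff_eq_zero (A : VertexOperator ℂ V) (w : V) :
    ∃ N : ℤ, ∀ n, N ≤ n → (A[[n]]) w = 0 :=
  ⟨-HahnSeries.order ((HahnModule.of ℂ).symm (A w)), fun n hn =>
    ncoeff_eq_zero_of_lt_order A n w (by omega)⟩

theorem ncoeff_injective {A B : VertexOperator ℂ V} (h : ∀ n w, (A[[n]]) w = (B[[n]]) w) : A = B := by
  refine HVertexOperator.coeff_inj (funext fun n => LinearMap.ext fun w => ?_)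
  rw [coeff_eq_ncoeff, coeff_eq_ncoeff]
  exact h _ _

theorem exists_comp_eq_zero (A B : VertexOperator ℂ V) (w : V) :
    ∃ N : ℤ, ∀ m n, N ≤ n → (A[[m]]) ((B[[n]]) w) = 0 := by
  obtain ⟨N, hN⟩ := exists_ncoeff_eq_zero B w
  exact ⟨N, fun m n h => by rw [hN n h, map_zero]⟩

/-- The coefficient of `x^{-p-1} y^{-q-1}` in `(x - y)^r A(x) B(y)`, expanded in nonnegative powers
of `y`. -/
def orderedProd (A B : VertexOperator ℂ V) (p q r : ℤ) : Module.End ℂ V where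
  toFun w := residueSum r (fun m n => (A[[m]]) ((B[[n]]) w)) p q
  map_add' v w := by
    obtain ⟨N, hN⟩ := exists_comp_eq_zero A B v
    obtain ⟨N', hN'⟩ := exists_comp_eq_zero A B w
    rw [← residueSum_add r hN hN']
    simp [residueSum]
  map_smul' a w := by
    obtain ⟨N, hN⟩ := exists_comp_eq_zero A B w
    have := residueSum_map r (LinearMap.lsmul ℂ V a) hN p q
    simp only [LinearMap.lsmul_apply] at this
    simp only [map_smul, RingHom.id_apply, this]

theorem orderedProd_apply (A B : VertexOperator ℂ V) (p q r : ℤ) (w : V) :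
    orderedProd A B p q r w = residueSum r (fun m n => (A[[m]]) ((B[[n]]) w)) p q := rfl

theorem orderedProd_succ (A B : VertexOperator ℂ V) (p q r : ℤ) :
    orderedProd A B p q (r + 1) = orderedProd A B (p + 1) q r - orderedProd A B p (q + 1) r := by
  ext w
  obtain ⟨N, hN⟩ := exists_comp_eq_zero A B w
  exact residueSum_succ r hN p q

theorem orderedProd_zero (A B : VertexOperator ℂ V) (p q : ℤ) :
    orderedProd A B p q 0 = (A[[p]]) * (B[[q]]) := by
  ext w
  exact residueSum_zero (g := fun m n => (A[[m]]) ((B[[n]]) w)) p q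

/-- The coefficient of `x^{-p-1} y^{-q-1}` in
`(x - y)^r A(x) B(y) - (-y + x)^r B(y) A(x)`, each power expanded in nonnegative powers of the
second variable: the right-hand side of the Borcherds identity. -/
def borcherds (A B : VertexOperator ℂ V) (p q r : ℤ) : Module.End ℂ V :=
  orderedProd A B p q r - (-1 : ℂ) ^ r • orderedProd B A q p r

theorem borcherds_succ (A B : VertexOperator ℂ V) (p q r : ℤ) :
    borcherds A B p q (r + 1) = borcherds A B (p + 1) q r - borcherds A B p (q + 1) r := by
  rw [borcherds, borcherds, borcherds, orderedProd_succ, orderedProd_succ,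
    zpow_add_one₀ (by norm_num)]
  module

theorem borcherds_zero (A B : VertexOperator ℂ V) (p q : ℤ) :
    borcherds A B p q 0 = (A[[p]]) * (B[[q]]) - (B[[q]]) * (A[[p]]) := by
  simp [borcherds, orderedProd_zero]

theorem borcherds_zero_apply (A B : VertexOperator ℂ V) (p q : ℤ) (w : V) :
    borcherds A B p q 0 w = (A[[p]]) ((B[[q]]) w) - (B[[q]]) ((A[[p]]) w) := by
  rw [borcherds_zero]; rfl

theorem borcherds_swap (A B : VertexOperator ℂ V) (p q r : ℤ) :
    borcherds B A q p r = -((-1 : ℂ) ^ r • borcherds A B p q r) := by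
  have h : (-1 : ℂ) ^ r * (-1 : ℂ) ^ r = 1 := by rw [← mul_zpow]; norm_num
  rw [borcherds, borcherds, smul_sub, smul_smul, h]
  module

theorem borcherds_apply (A B : VertexOperator ℂ V) (p q r : ℤ) (w : V) :
    borcherds A B p q r w =
      ∑ᶠ i : ℕ, ((-1 : ℂ) ^ i * ((Ring.choose r i : ℤ) : ℂ)) •
          ((A[[p + r - i]]) ((B[[q + i]]) w)
            - (-1 : ℂ) ^ r • (B[[q + r - i]]) ((A[[p + i]]) w)) := by
  obtain ⟨N, hN⟩ := exists_comp_eq_zero A B w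
  obtain ⟨N', hN'⟩ := exists_comp_eq_zero B A w
  have h2 := residueSum_support_finite r hN' q p
  rw [borcherds, LinearMap.sub_apply, LinearMap.smul_apply, orderedProd_apply, orderedProd_apply,
    residueSum, residueSum, smul_finsum' _ h2, ← finsum_sub_distrib
      (residueSum_support_finite r hN p q)
      (h2.subset fun i hi hi' => hi (by beta_reduce at hi' ⊢; rw [hi', smul_zero]))]
  simp only [smul_sub, smul_comm ((-1 : ℂ) ^ r)]
  rfl

theorem exists_borcherds_eq_zero (A B : VertexOperator ℂ V) (p r : ℤ) (w : V) :
    ∃ N : ℤ, ∀ q, N ≤ q → borcherds A B p q r w = 0 := by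
  obtain ⟨N₁, h₁⟩ := exists_ncoeff_eq_zero B w
  obtain ⟨N₂, h₂⟩ := exists_ncoeff_eq_zero A w
  choose N₃ h₃ using exists_ncoeff_eq_zero B
  set K := (N₂ - p).toNat
  obtain ⟨M, hM⟩ := ((Finset.range K).image fun i : ℕ => N₃ ((A[[p + i]]) w) - r + i).bddAbove
  refine ⟨max N₁ M, fun q hq => ?_⟩
  rw [borcherds_apply, finsum_eq_zero_of_forall_eq_zero]
  intro i
  rw [h₁ (q + i) (by have := le_of_max_le_left hq; omega), map_zero]
  by_cases hi : i < K
  · have := hM (Finset.mem_coe.2 (Finset.mem_image_of_mem _ (Finset.mem_range.2 hi)))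
    rw [h₃ ((A[[p + i]]) w) (q + r - i) (by have := le_of_max_le_right hq; omega)]
    simp
  · rw [h₂ (p + i) (by omega)]
    simp

/-- The `r`-th product `A_(r) B` of two fields. -/
def nthProd (A B : VertexOperator ℂ V) (r : ℤ) : VertexOperator ℂ V :=
  VertexOperator.of_coeff (fun y => borcherds A B 0 (-y - 1) r) fun w => by
    obtain ⟨N, hN⟩ := exists_borcherds_eq_zero A B 0 r w
    refine ⟨-N, fun y hy => ?_⟩
    by_contra h
    exact hy (hN _ (by omega))

theorem nthProd_ncoeff (A B : VertexOperator ℂ V) (q r : ℤ) :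
    (nthProd A B r)[[q]] = borcherds A B 0 q r := by
  rw [nthProd, ncoeff_of_coeff]
  congr 1
  ring

/-- Two fields are mutually local if `(x - y)^N [A(x), B(y)] = 0` for some `N`. -/
def IsLocal (A B : VertexOperator ℂ V) : Prop :=
  ∃ N : ℕ, ∀ p q : ℤ, borcherds A B p q N = 0

theorem IsLocal.symm {A B : VertexOperator ℂ V} (h : IsLocal A B) : IsLocal B A := by
  obtain ⟨N, hN⟩ := h
  exact ⟨N, fun p q => by rw [borcherds_swap, hN, smul_zero, neg_zero]⟩

theorem borcherds_eq_zero_of_le {A B : VertexOperator ℂ V} {N : ℤ}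
    (hN : ∀ p q : ℤ, borcherds A B p q N = 0) (r : ℤ) (hr : N ≤ r) :
    ∀ p q, borcherds A B p q r = 0 := by
  induction r, hr using Int.leInduction with
  | base => exact hN
  | succ r _ ih => intro p q; rw [borcherds_succ, ih, ih, sub_zero]

/-- The left-hand side of the Borcherds identity, truncated. -/
def iterateSum (A B : VertexOperator ℂ V) (K : ℕ) (p q r : ℤ) : Module.End ℂ V :=
  ∑ i ∈ Finset.range K, ((Ring.choose p i : ℤ) : ℂ) • borcherds A B 0 (p + q - i) (r + i)

theorem iterateSum_succ (A B : VertexOperator ℂ V) (K : ℕ) (p q r : ℤ) :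
    iterateSum A B (K + 1) (p + 1) q r
      = iterateSum A B (K + 1) p (q + 1) r + iterateSum A B K p q (r + 1) := by
  rw [iterateSum, iterateSum, iterateSum, Finset.sum_range_succ' _ K, Finset.sum_range_succ' _ K,
    show ∀ a b c : Module.End ℂ V, a + b + c = (a + c) + b from fun a b c => by abel, ← Finset.sum_add_distrib]
  congr 1
  · refine Finset.sum_congr rfl fun i _ => ?_
    rw [Ring.choose_succ_succ, Int.cast_add, add_smul, add_comm]
    push_cast
    congr 3 <;> ring
  · simp only [Ring.choose_zero_right]
    congr 2
    ring

theorem iterateSum_eq {A B : VertexOperator ℂ V} {N : ℤ}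
    (hN : ∀ r, N ≤ r → ∀ p q : ℤ, borcherds A B p q r = 0) {K K' : ℕ} (p q r : ℤ)
    (hK : N ≤ r + K) (hK' : K ≤ K') :
    iterateSum A B K' p q r = iterateSum A B K p q r := by
  rw [iterateSum, iterateSum]
  symm
  refine Finset.sum_subset (by simpa using hK') fun i _ hi => ?_
  rw [hN (r + i) (by simp at hi; omega), smul_zero]

/-- The Borcherds identity for two mutually local fields. Both sides obey
`F(p+1, q, r) = F(p, q+1, r) + F(p, q, r+1)`, and they agree for `p = 0` by the definition of the
products. Going up in `p` is immediate; going down in `p`, one also descends in `r`, where both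
sides vanish for large `r`. -/
theorem borcherds_identity_aux {A B : VertexOperator ℂ V} {N : ℤ}
    (hN : ∀ r, N ≤ r → ∀ p q : ℤ, borcherds A B p q r = 0) (p : ℤ) :
    ∀ (q r : ℤ) (K : ℕ), N ≤ r + K → iterateSum A B K p q r = borcherds A B p q r := by
  induction p using Int.induction_on with
  | zero =>
    intro q r K hK
    rw [← iterateSum_eq hN 0 q r hK (Nat.le_succ K), iterateSum, Finset.sum_range_succ',
      Finset.sum_eq_zero]
    · simp
    · intro i _
      rw [Ring.choose_zero_succ, Int.cast_zero, zero_smul]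
  | succ p ih =>
    intro q r K hK
    rw [← iterateSum_eq hN _ q r hK (Nat.le_succ K), iterateSum_succ,
      ih _ _ _ (by push_cast; omega), ih _ _ _ (by omega), borcherds_succ]
    abel
  | pred p ih =>
    intro q r K hK
    -- descend from `r + K ≥ N`
    induction K generalizing q r with
    | zero =>
      rw [hN r (by simpa using hK)]
      simp [iterateSum]
    | succ K ihK =>
      have h1 := iterateSum_succ A B (K + 1) (-(p : ℤ) - 1) (q - 1) r
      have h2 := borcherds_succ A B (-(p : ℤ) - 1) (q - 1) r
      have h3 := ihK (q - 1) (r + 1) (by push_cast at hK ⊢; omega)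
      have h4 := ih (q - 1) r (K + 2) (by push_cast at hK ⊢; omega)
      rw [sub_add_cancel, sub_add_cancel] at h1 h2
      rw [← iterateSum_eq hN _ q r hK (Nat.le_succ _)]
      rw [← iterateSum_eq hN _ (q - 1) (r + 1) (by push_cast at hK ⊢; omega) (Nat.le_succ _)] at h3
      rw [eq_sub_of_add_eq h1.symm, h3, h4, h2]
      abel

theorem IsLocal.borcherds_identity {A B : VertexOperator ℂ V} (h : IsLocal A B) (p q r : ℤ)
    (w : V) :
    ∑ᶠ i : ℕ, ((Ring.choose p i : ℤ) : ℂ) • ((nthProd A B (r + i))[[p + q - i]]) w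
      = borcherds A B p q r w := by
  obtain ⟨N, hN⟩ := h
  have hN' := borcherds_eq_zero_of_le hN
  have hK : (N : ℤ) ≤ r + (N - r).toNat := by have := Int.self_le_toNat (N - r); omega
  rw [← borcherds_identity_aux hN' p q r _ hK, iterateSum, LinearMap.sum_apply]
  simp only [nthProd_ncoeff]
  refine finsum_eq_sum_of_support_subset _ fun i hi => ?_
  by_contra h
  have : ((N : ℤ) - r).toNat ≤ i := by simpa using h
  exact hi (by beta_reduce; rw [hN' (r + i) (by omega)]; simp)

/-! ### Dong's lemma -/

section Dong

variable {W : Type u} [AddCommGroup W] [Module ℂ W]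

/-- Multiplication of `∑ f(p, q, n) x^{-p-1} y^{-q-1} z^{-n-1}` by `x - z`. -/
def mulXZ (W : Type u) [AddCommGroup W] [Module ℂ W] : Module.End ℂ (ℤ → ℤ → ℤ → W) where
  toFun f p q n := f (p + 1) q n - f p q (n + 1)
  map_add' f g := by funext p q n; simp only [Pi.add_apply]; abel
  map_smul' a f := by funext p q n; simp [smul_sub]

/-- Multiplication of `∑ f(p, q, n) x^{-p-1} y^{-q-1} z^{-n-1}` by `y - z`. -/
def mulYZ (W : Type u) [AddCommGroup W] [Module ℂ W] : Module.End ℂ (ℤ → ℤ → ℤ → W) where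
  toFun f p q n := f p (q + 1) n - f p q (n + 1)
  map_add' f g := by funext p q n; simp only [Pi.add_apply]; abel
  map_smul' a f := by funext p q n; simp [smul_sub]

/-- Multiplication of `∑ f(p, q, n) x^{-p-1} y^{-q-1} z^{-n-1}` by `x - y`. -/
def mulXY (W : Type u) [AddCommGroup W] [Module ℂ W] : Module.End ℂ (ℤ → ℤ → ℤ → W) where
  toFun f p q n := f (p + 1) q n - f p (q + 1) n
  map_add' f g := by funext p q n; simp only [Pi.add_apply]; abel
  map_smul' a f := by funext p q n; simp [smul_sub]

theorem mulXZ_sub_mulXY : mulXZ W - mulXY W = mulYZ W := by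
  ext f p q n
  simp only [mulXZ, mulXY, mulYZ, LinearMap.sub_apply, LinearMap.coe_mk, AddHom.coe_mk,
    Pi.sub_apply]
  abel

theorem commute_mulXZ_mulXY : Commute (mulXZ W) (mulXY W) := by
  ext f p q n
  simp only [mulXZ, mulXY, Module.End.mul_apply, LinearMap.coe_mk, AddHom.coe_mk]
  abel

theorem commute_mulXZ_mulYZ : Commute (mulXZ W) (mulYZ W) := by
  ext f p q n
  simp only [mulXZ, mulYZ, Module.End.mul_apply, LinearMap.coe_mk, AddHom.coe_mk]
  abel

theorem commute_mulXY_mulYZ : Commute (mulXY W) (mulYZ W) := by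
  ext f p q n
  simp only [mulXY, mulYZ, Module.End.mul_apply, LinearMap.coe_mk, AddHom.coe_mk]
  abel

theorem sub_pow_apply_eq_zero {u v : Module.End ℂ W} (huv : Commute u v) (m k : ℕ) (h : W)
    (hu : (u ^ m) h = 0) (hv : (v ^ k) h = 0) : ((u - v) ^ (m + k)) h = 0 := by
  induction hs : m + k generalizing m k h with
  | zero =>
    obtain rfl : m = 0 := by omega
    simpa using hu
  | succ s ih =>
    rcases m with _ | m
    · simp only [pow_zero, Module.End.one_apply] at hu
      rw [hu, map_zero]
    rcases k with _ | k
    · simp only [pow_zero, Module.End.one_apply] at hv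
      rw [hv, map_zero]
    rw [pow_succ, Module.End.mul_apply, LinearMap.sub_apply, map_sub]
    rw [ih m (k + 1) (u h), ih (m + 1) k (v h), sub_zero]
    · rw [← Module.End.mul_apply, (huv.pow_left (m + 1)).eq, Module.End.mul_apply, hu, map_zero]
    · rw [← Module.End.mul_apply, ← pow_succ, hv]
    · omega
    · rw [← Module.End.mul_apply, ← pow_succ, hu]
    · rw [← Module.End.mul_apply, ← (huv.pow_right (k + 1)).eq, Module.End.mul_apply, hv, map_zero]
    · omega

/-- Expand the power of `y - z = (x - z) - (x - y)`: each term has `m` factors `x - z` or `k` factors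
`x - y`. -/
theorem mulYZ_pow_eq_zero {f : ℤ → ℤ → ℤ → W} (m m' k : ℕ)
    (h : (mulXZ W ^ m) ((mulYZ W ^ m') f) = 0) (h' : (mulXY W ^ k) f = 0) :
    (mulYZ W ^ (m + k + m')) f = 0 := by
  rw [pow_add, Module.End.mul_apply, ← mulXZ_sub_mulXY (W := W)]
  refine sub_pow_apply_eq_zero commute_mulXZ_mulXY m k _ (by rwa [mulXZ_sub_mulXY]) ?_
  rw [mulXZ_sub_mulXY, ← Module.End.mul_apply, (commute_mulXY_mulYZ.pow_pow k m').eq,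
    Module.End.mul_apply, h', map_zero]

/-- The functions to which `residueSum` in the first two variables applies. -/
def BoundedInY (g : ℤ → ℤ → ℤ → W) : Prop :=
  ∀ n, ∃ N : ℤ, ∀ p q, N ≤ q → g p q n = 0

/-- Multiplication by `(x - y)^r`, expanded in nonnegative powers of `y`, of a series in
`x, y, z`. -/
def residueSum₃ (r : ℤ) (g : ℤ → ℤ → ℤ → W) (p q n : ℤ) : W :=
  residueSum r (fun p q => g p q n) p q

theorem residueSum_sub (r : ℤ) {g h : ℤ → ℤ → W} {N N' : ℤ} (hg : ∀ m n, N ≤ n → g m n = 0)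
    (hh : ∀ m n, N' ≤ n → h m n = 0) (p q : ℤ) :
    residueSum r (fun p q => g p q - h p q) p q = residueSum r g p q - residueSum r h p q := by
  rw [residueSum, residueSum, residueSum, ← finsum_sub_distrib
    (residueSum_support_finite r hg p q) (residueSum_support_finite r hh p q)]
  simp [smul_sub]

theorem BoundedInY.mulYZ {g : ℤ → ℤ → ℤ → W} (hg : BoundedInY g) : BoundedInY (mulYZ W g) :=
  fun n => by
  obtain ⟨N, hN⟩ := hg n
  obtain ⟨N', hN'⟩ := hg (n + 1)
  refine ⟨max N N', fun p q hq => ?_⟩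
  simp only [VertexField.mulYZ, LinearMap.coe_mk, AddHom.coe_mk]
  rw [hN _ _ (by have := le_of_max_le_left hq; omega), hN' _ _ (le_of_max_le_right hq), sub_zero]

theorem BoundedInY.mulXZ {g : ℤ → ℤ → ℤ → W} (hg : BoundedInY g) : BoundedInY (mulXZ W g) :=
  fun n => by
  obtain ⟨N, hN⟩ := hg n
  obtain ⟨N', hN'⟩ := hg (n + 1)
  refine ⟨max N N', fun p q hq => ?_⟩
  simp only [VertexField.mulXZ, LinearMap.coe_mk, AddHom.coe_mk]
  rw [hN _ _ (le_of_max_le_left hq), hN' _ _ (le_of_max_le_right hq), sub_zero]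

theorem mulYZ_residueSum₃ (r : ℤ) {g : ℤ → ℤ → ℤ → W} (hg : BoundedInY g) :
    mulYZ W (residueSum₃ r g) = residueSum₃ r (mulYZ W g) := by
  funext p q n
  obtain ⟨N, hN⟩ := hg n
  obtain ⟨N', hN'⟩ := hg (n + 1)
  simp only [mulYZ, LinearMap.coe_mk, AddHom.coe_mk, residueSum₃]
  rw [residueSum_sub r (g := fun p q => g p (q + 1) n) (N := N) (N' := N') _ hN']
  · simp only [residueSum, add_right_comm q _ 1]
  · exact fun p q hq => hN _ _ (by omega)

theorem mulXZ_residueSum₃ (r : ℤ) {g : ℤ → ℤ → ℤ → W} (hg : BoundedInY g) :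
    mulXZ W (residueSum₃ r g) = residueSum₃ r (mulXZ W g) := by
  funext p q n
  obtain ⟨N, hN⟩ := hg n
  obtain ⟨N', hN'⟩ := hg (n + 1)
  simp only [mulXZ, LinearMap.coe_mk, AddHom.coe_mk, residueSum₃]
  rw [residueSum_sub r (g := fun p q => g (p + 1) q n) (N := N) (N' := N') _ hN']
  · simp only [residueSum, add_right_comm p 1 r, add_sub_right_comm _ (1 : ℤ)]
  · exact fun p q hq => hN _ _ hq

theorem residueSum₃_zero (r : ℤ) : residueSum₃ r (0 : ℤ → ℤ → ℤ → W) = 0 := by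
  funext p q n
  simp [residueSum₃, residueSum]

theorem mulYZ_pow_residueSum₃ (r : ℤ) (m : ℕ) {g : ℤ → ℤ → ℤ → W} (hg : BoundedInY g)
    (h : (mulYZ W ^ m) g = 0) : (mulYZ W ^ m) (residueSum₃ r g) = 0 := by
  induction m generalizing g with
  | zero =>
    obtain rfl : g = 0 := by simpa using h
    simpa using residueSum₃_zero r
  | succ m ih =>
    rw [pow_succ, Module.End.mul_apply] at h ⊢
    rw [mulYZ_residueSum₃ r hg]
    exact ih hg.mulYZ h

theorem mulXZ_pow_residueSum₃ (r : ℤ) (m : ℕ) {g : ℤ → ℤ → ℤ → W} (hg : BoundedInY g)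
    (h : (mulXZ W ^ m) g = 0) : (mulXZ W ^ m) (residueSum₃ r g) = 0 := by
  induction m generalizing g with
  | zero =>
    obtain rfl : g = 0 := by simpa using h
    simpa using residueSum₃_zero r
  | succ m ih =>
    rw [pow_succ, Module.End.mul_apply] at h ⊢
    rw [mulXZ_residueSum₃ r hg]
    exact ih hg.mulXZ h

theorem mulXZ_pow_of_succ {F : ℕ → ℤ → ℤ → ℤ → W}
    (h : ∀ j p q n, F (j + 1) p q n = F j (p + 1) q n - F j p q (n + 1)) (m j : ℕ) :
    (mulXZ W ^ m) (F j) = F (j + m) := by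
  induction m generalizing j with
  | zero => rfl
  | succ m ih =>
    have : mulXZ W (F j) = F (j + 1) := by funext p q n; exact (h j p q n).symm
    rw [pow_succ, Module.End.mul_apply, this, ih, add_assoc, add_comm 1]

theorem mulYZ_pow_of_succ {F : ℕ → ℤ → ℤ → ℤ → W}
    (h : ∀ j p q n, F (j + 1) p q n = F j p (q + 1) n - F j p q (n + 1)) (m j : ℕ) :
    (mulYZ W ^ m) (F j) = F (j + m) := by
  induction m generalizing j with
  | zero => rfl
  | succ m ih =>
    have : mulYZ W (F j) = F (j + 1) := by funext p q n; exact (h j p q n).symm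
    rw [pow_succ, Module.End.mul_apply, this, ih, add_assoc, add_comm 1]

theorem mulXY_pow_of_succ {F : ℕ → ℤ → ℤ → ℤ → W}
    (h : ∀ j p q n, F (j + 1) p q n = F j (p + 1) q n - F j p (q + 1) n) (m j : ℕ) :
    (mulXY W ^ m) (F j) = F (j + m) := by
  induction m generalizing j with
  | zero => rfl
  | succ m ih =>
    have : mulXY W (F j) = F (j + 1) := by funext p q n; exact (h j p q n).symm
    rw [pow_succ, Module.End.mul_apply, this, ih, add_assoc, add_comm 1]

/-- Exchange of the variables `x` and `y`. -/
def swapXY (f : ℤ → ℤ → ℤ → W) : ℤ → ℤ → ℤ → W := fun p q n => f q p n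

theorem mulXZ_pow_swapXY (m : ℕ) (f : ℤ → ℤ → ℤ → W) :
    (mulXZ W ^ m) (swapXY f) = swapXY ((mulYZ W ^ m) f) := by
  induction m generalizing f with
  | zero => rfl
  | succ m ih => rw [pow_succ, pow_succ, Module.End.mul_apply, Module.End.mul_apply, ← ih]; rfl

theorem mulYZ_pow_swapXY (m : ℕ) (f : ℤ → ℤ → ℤ → W) :
    (mulYZ W ^ m) (swapXY f) = swapXY ((mulXZ W ^ m) f) := by
  induction m generalizing f with
  | zero => rfl
  | succ m ih => rw [pow_succ, pow_succ, Module.End.mul_apply, Module.End.mul_apply, ← ih]; rfl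

theorem mulYZ_pow_const (m : ℕ) (f : ℤ → ℤ → ℤ → W) :
    (mulYZ W ^ m) (fun _ q n => f 0 q n) = fun _ q n => (mulYZ W ^ m) f 0 q n := by
  induction m generalizing f with
  | zero => rfl
  | succ m ih => rw [pow_succ, Module.End.mul_apply, Module.End.mul_apply, ← ih]; rfl

/-- `(x - z)^m (y - z)^m' (x - y)^r [A(x) B(y), C(z)] = 0` if `C` is local with `A` and `B`. -/
theorem commutator_orderedProd_eq_zero {A B C : VertexOperator ℂ V} {m m' : ℕ}
    (hA : ∀ p q, borcherds A C p q m = 0) (hB : ∀ p q, borcherds B C p q m' = 0) (r : ℤ) (w : V) :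
    (mulXZ V ^ m) ((mulYZ V ^ m') fun p q n =>
      orderedProd A B p q r ((C[[n]]) w) - (C[[n]]) (orderedProd A B p q r w)) = 0 := by
  -- `[A B, C] = A [B, C] + [A, C] B`
  set g₁ : ℤ → ℤ → ℤ → V := fun p q n => (A[[p]]) (borcherds B C q n 0 w) with hg₁
  set g₂ : ℤ → ℤ → ℤ → V := fun p q n => borcherds A C p n 0 ((B[[q]]) w) with hg₂
  have b₁ : BoundedInY g₁ := fun n => by
    obtain ⟨N, hN⟩ := exists_ncoeff_eq_zero B w
    obtain ⟨N', hN'⟩ := exists_ncoeff_eq_zero B ((C[[n]]) w)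
    refine ⟨max N N', fun p q hq => ?_⟩
    simp only [hg₁]
    rw [borcherds_zero_apply, hN _ (le_of_max_le_left hq), hN' _ (le_of_max_le_right hq)]
    simp
  have b₂ : BoundedInY g₂ := fun n => by
    obtain ⟨N, hN⟩ := exists_ncoeff_eq_zero B w
    exact ⟨N, fun p q hq => by simp only [hg₂]; rw [hN q hq, map_zero]⟩
  have z₁ : (mulYZ V ^ m') g₁ = 0 := by
    refine (mulYZ_pow_of_succ
      (F := fun j p q n => (A[[p]]) (borcherds B C q n j w)) (fun j p q n => ?_) m' 0).trans ?_
    · push_cast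
      rw [borcherds_succ, LinearMap.sub_apply, map_sub]
    · funext p q n
      simp [hB]
  have z₂ : (mulXZ V ^ m) g₂ = 0 := by
    refine (mulXZ_pow_of_succ
      (F := fun j p q n => borcherds A C p n j ((B[[q]]) w)) (fun j p q n => ?_) m 0).trans ?_
    · push_cast
      rw [borcherds_succ, LinearMap.sub_apply]
    · funext p q n
      simp [hA]
  have key : (fun p q n =>
      orderedProd A B p q r ((C[[n]]) w) - (C[[n]]) (orderedProd A B p q r w))
      = residueSum₃ r g₁ + residueSum₃ r g₂ := by
    funext p q n
    obtain ⟨N, hN⟩ := exists_comp_eq_zero A B ((C[[n]]) w)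
    obtain ⟨N', hN'⟩ := exists_comp_eq_zero A B w
    obtain ⟨N₁, hN₁⟩ := b₁ n
    obtain ⟨N₂, hN₂⟩ := b₂ n
    simp only [Pi.add_apply, residueSum₃]
    rw [← residueSum_add r hN₁ hN₂, orderedProd_apply, orderedProd_apply,
      ← residueSum_map r (C[[n]]) hN',
      ← residueSum_sub r (h := fun p q => (C[[n]]) ((A[[p]]) ((B[[q]]) w))) (N' := N') hN
        (fun p q hq => by rw [hN' p q hq, map_zero])]
    congr 1
    funext p q
    simp only [Pi.add_apply, hg₁, hg₂, borcherds_zero_apply, map_sub]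
    abel
  rw [key, map_add, map_add, mulYZ_pow_residueSum₃ r m' b₁ z₁, map_zero, zero_add,
    ← Module.End.mul_apply, (commute_mulXZ_mulYZ.pow_pow m m').eq, Module.End.mul_apply,
    mulXZ_pow_residueSum₃ r m b₂ z₂, map_zero]

/-- Dong's lemma: the products of two mutually local fields are local with every field with which
both of them are. -/
theorem IsLocal.nthProd {A B C : VertexOperator ℂ V} (hAB : IsLocal A B) (hAC : IsLocal A C)
    (hBC : IsLocal B C) (r : ℤ) : IsLocal (nthProd A B r) C := by
  obtain ⟨N, hN⟩ := hAB
  obtain ⟨m, hm⟩ := hAC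
  obtain ⟨m', hm'⟩ := hBC
  have hN' := borcherds_eq_zero_of_le hN
  set k := (N - r).toNat
  refine ⟨m + k + m', fun q n => LinearMap.ext fun w => ?_⟩
  set f : ℤ → ℤ → ℤ → V := fun p q n =>
    borcherds A B p q r ((C[[n]]) w) - (C[[n]]) (borcherds A B p q r w) with hf
  -- `f` is the commutator of the series defining `A_(r) B`, in `x` and `y`, with `C(z)`.
  have hXY : (mulXY V ^ k) f = 0 := by
    have := mulXY_pow_of_succ (F := fun j p q n =>
      borcherds A B p q (r + j) ((C[[n]]) w) - (C[[n]]) (borcherds A B p q (r + j) w))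
      (fun j p q n => ?_) k 0
    · simp only [Nat.cast_zero, add_zero] at this
      rw [hf, this]
      funext p q n
      rw [hN' _ (by have := Int.self_le_toNat (N - r); push_cast; omega)]
      simp
    · push_cast
      rw [← add_assoc, borcherds_succ]
      simp only [LinearMap.sub_apply, map_sub]
      abel
  have hXZ : (mulXZ V ^ m) ((mulYZ V ^ m') f) = 0 := by
    have h1 := commutator_orderedProd_eq_zero hm hm' r w
    have h2 := commutator_orderedProd_eq_zero hm' hm r w
    set f₂ : ℤ → ℤ → ℤ → V := fun p q n =>
      orderedProd B A p q r ((C[[n]]) w) - (C[[n]]) (orderedProd B A p q r w) with hf₂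
    have h3 : (mulXZ V ^ m) ((mulYZ V ^ m') (swapXY f₂)) = 0 := by
      rw [mulYZ_pow_swapXY, mulXZ_pow_swapXY, ← Module.End.mul_apply,
        ← (commute_mulXZ_mulYZ.pow_pow m' m).eq, Module.End.mul_apply, h2]
      rfl
    have h4 : f = (fun p q n =>
        orderedProd A B p q r ((C[[n]]) w) - (C[[n]]) (orderedProd A B p q r w))
        - (-1 : ℂ) ^ r • swapXY f₂ := by
      funext p q n
      simp only [hf, hf₂, swapXY, Pi.sub_apply, Pi.smul_apply, borcherds, LinearMap.sub_apply,
        LinearMap.smul_apply, map_sub, map_smul, smul_sub]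
      abel
    rw [h4, map_sub, map_sub, h1, map_smul, map_smul, h3, smul_zero, sub_zero]
  have h := mulYZ_pow_eq_zero m m' k hXZ hXY
  -- The commutator of `A_(r) B` with `C` is the coefficient of `x^{-1}` in `f`.
  have h5 := mulYZ_pow_of_succ (F := fun j _ q n =>
    borcherds (VertexField.nthProd A B r) C q n j w) (fun j p q n => by
      push_cast
      rw [borcherds_succ, LinearMap.sub_apply]) (m + k + m') 0
  have h6 : (fun (_ : ℤ) (q n : ℤ) => borcherds (VertexField.nthProd A B r) C q n (0 : ℕ) w)
      = fun _ q n => f 0 q n := by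
    funext _ q n
    simp only [Nat.cast_zero, borcherds_zero_apply, nthProd_ncoeff, hf]
  simp only [zero_add] at h5
  rw [h6, mulYZ_pow_const, h] at h5
  exact (congrFun (congrFun (congrFun h5 0) q) n).symm

end Dong

end VertexField

open VertexField

/-! ### The vacuum module and the Virasoro field -/

namespace Virasoro

section Enveloping

attribute [local instance 100] LieRing.ofAssociativeRing

theorem toEnv_mem_subalgebra (S : Subalgebra ℂ Env) (hL : ∀ n, toEnv (L n) ∈ S)
    (hc : toEnv c ∈ S) (x : Virasoro) : toEnv x ∈ S := by
  have hx : x = (x.wittPart.sum fun n a => a • L n) + x.central • c := by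
    ext1
    · have h : ∀ f : ℤ →₀ ℂ, (f.sum fun n a => a • L n).wittPart = f := by
        intro f
        induction f using Finsupp.induction_linear with
        | zero => simp
        | add f g hf hg =>
          rw [Finsupp.sum_add_index' (by simp) (by simp [add_smul]), wittPart_add, hf, hg]
        | single n a => simp [L]
      simp [h, c]
    · have h : ∀ f : ℤ →₀ ℂ, (f.sum fun n a => a • L n).central = 0 := by
        intro f
        induction f using Finsupp.induction_linear with
        | zero => simp
        | add f g hf hg =>
          rw [Finsupp.sum_add_index' (by simp) (by simp [add_smul]), central_add, hf, hg, add_zero]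
        | single n a => simp [L]
      simp [h, c]
  rw [hx, toEnv, map_add, Finsupp.sum, map_sum]
  refine S.add_mem (S.sum_mem fun n _ => ?_) ?_
  · rw [map_smul]
    exact S.smul_mem (hL n) _
  · rw [map_smul]
    exact S.smul_mem hc _

/-- `U(Vir)` is generated by the `L(n)` and `c`. -/
theorem mem_subalgebra (S : Subalgebra ℂ Env) (hL : ∀ n, toEnv (L n) ∈ S)
    (hc : toEnv c ∈ S) (x : Env) : x ∈ S := by
  let f : Virasoro →ₗ⁅ℂ⁆ S :=
    { toFun := fun y => ⟨toEnv y, toEnv_mem_subalgebra S hL hc y⟩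
      map_add' := fun y z => Subtype.ext (map_add (UniversalEnvelopingAlgebra.ι ℂ) y z)
      map_smul' := fun a y => Subtype.ext (map_smul (UniversalEnvelopingAlgebra.ι ℂ) a y)
      map_lie' := fun {y z} => Subtype.ext (LieHom.map_lie (UniversalEnvelopingAlgebra.ι ℂ) y z) }
  have h : (Subalgebra.val S).comp (UniversalEnvelopingAlgebra.lift ℂ f) = AlgHom.id ℂ Env := by
    refine UniversalEnvelopingAlgebra.hom_ext (R := ℂ) (L := Virasoro) ?_
    ext y
    simp [f]
  have := DFunLike.congr_fun h x
  simp only [AlgHom.coe_comp, Function.comp_apply, AlgHom.coe_id, id_eq] at this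
  rw [← this]
  exact (UniversalEnvelopingAlgebra.lift ℂ f x).property

theorem toEnv_mul_toEnv (x y : Virasoro) : toEnv x * toEnv y = toEnv y * toEnv x + toEnv ⁅x, y⁆ := by
  have : toEnv ⁅x, y⁆ = toEnv x * toEnv y - toEnv y * toEnv x :=
    LieHom.map_lie (UniversalEnvelopingAlgebra.ι ℂ) x y
  rw [this]
  abel

end Enveloping

namespace VacuumModule

variable (ℓ : ℂ)

theorem opL_apply (n : ℤ) (v : VacuumModule ℓ) : opL ℓ n v = toEnv (L n) • v := rfl

theorem mk_eq_smul_vac (x : Env) : (Submodule.Quotient.mk x : VacuumModule ℓ) = x • vac ℓ := by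
  rw [vac, ← Submodule.Quotient.mk_smul, smul_eq_mul, mul_one]

theorem toEnv_c_smul (v : VacuumModule ℓ) : toEnv c • v = ℓ • v := by
  obtain ⟨x, rfl⟩ := Submodule.Quotient.mk_surjective _ v
  have hx : x ∈ Subalgebra.centralizer ℂ {toEnv c} := by
    refine mem_subalgebra _ (fun n => ?_) ?_ x <;> rw [Subalgebra.mem_centralizer_iff] <;>
      rintro _ rfl
    · rw [toEnv_mul_toEnv, ← lie_skew, lie_c]
      simp
    · rfl
  have hx' : toEnv c * x = x * toEnv c := (Subalgebra.mem_centralizer_iff ℂ).1 hx _ rfl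
  have hvac : toEnv c • vac ℓ = ℓ • vac ℓ := by
    rw [← algebraMap_smul Env ℓ (vac ℓ), ← sub_eq_zero, ← sub_smul, ← mk_eq_smul_vac,
      Submodule.Quotient.mk_eq_zero]
    exact Submodule.subset_span (Or.inr rfl)
  rw [mk_eq_smul_vac, smul_smul, hx', mul_smul, hvac, smul_comm]

/-- The vacuum vector generates the vacuum module under the `L(n)`. -/
theorem mem_of_vac_mem (P : Submodule ℂ (VacuumModule ℓ)) (hvac : vac ℓ ∈ P)
    (hL : ∀ n, ∀ v ∈ P, opL ℓ n v ∈ P) (v : VacuumModule ℓ) : v ∈ P := by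
  obtain ⟨x, rfl⟩ := Submodule.Quotient.mk_surjective _ v
  rw [mk_eq_smul_vac]
  let S : Subalgebra ℂ Env :=
    { carrier := {x | ∀ v ∈ P, x • v ∈ P}
      mul_mem' := fun {a b} ha hb v hv => by rw [mul_smul]; exact ha _ (hb _ hv)
      add_mem' := fun {a b} ha hb v hv => by rw [add_smul]; exact P.add_mem (ha _ hv) (hb _ hv)
      algebraMap_mem' := fun a v hv => by rw [algebraMap_smul]; exact P.smul_mem _ hv }
  refine mem_subalgebra S hL (fun v hv => ?_) x _ hvac
  rw [toEnv_c_smul]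
  exact P.smul_mem _ hv

theorem opL_comm (m n : ℤ) (v : VacuumModule ℓ) :
    opL ℓ m (opL ℓ n v) - opL ℓ n (opL ℓ m v) = ((m : ℂ) - n) • opL ℓ (m + n) v
      + (if m + n = 0 then ((m : ℂ) ^ 3 - m) / 12 * ℓ else 0) • v := by
  rw [opL_apply, opL_apply, opL_apply, opL_apply, smul_smul, smul_smul, toEnv_mul_toEnv, lie_L_L,
    add_smul, add_sub_cancel_left, toEnv, map_add, map_smul, map_smul, add_smul, smul_assoc,
    smul_assoc, toEnv_c_smul, opL_apply, smul_smul]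
  split_ifs <;> simp

theorem opL_vac {n : ℤ} (hn : -1 ≤ n) : opL ℓ n (vac ℓ) = 0 := by
  rw [opL_apply, ← mk_eq_smul_vac, Submodule.Quotient.mk_eq_zero]
  exact Submodule.subset_span (Or.inl ⟨n, hn, rfl⟩)

theorem exists_opL_eq_zero (v : VacuumModule ℓ) : ∃ N : ℤ, ∀ n, N ≤ n → opL ℓ n v = 0 := by
  let P : Submodule ℂ (VacuumModule ℓ) :=
    { carrier := {v | ∃ N : ℤ, ∀ n, N ≤ n → opL ℓ n v = 0}
      zero_mem' := ⟨0, fun n _ => map_zero _⟩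
      add_mem' := by
        rintro v w ⟨N, hN⟩ ⟨N', hN'⟩
        refine ⟨max N N', fun n hn => ?_⟩
        rw [map_add, hN n (le_of_max_le_left hn), hN' n (le_of_max_le_right hn), add_zero]
      smul_mem' := by
        rintro a v ⟨N, hN⟩
        exact ⟨N, fun n hn => by rw [map_smul, hN n hn, smul_zero]⟩ }
  refine mem_of_vac_mem ℓ P ⟨-1, fun n hn => opL_vac ℓ hn⟩ ?_ v
  rintro m v ⟨N, hN⟩
  refine ⟨max N (max (N - m) (1 - m)), fun n hn => ?_⟩
  have h1 := le_of_max_le_left hn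
  have h2 := le_of_max_le_left (le_of_max_le_right hn)
  have h3 := le_of_max_le_right (le_of_max_le_right hn)
  have h := opL_comm ℓ n m v
  rw [hN n h1, hN (n + m) (by omega), if_neg (by omega)] at h
  simpa using h

/-- The field `∑ L(n) x^{-n-2}`. -/
def virField : VertexOperator ℂ (VacuumModule ℓ) :=
  VertexOperator.of_coeff (fun y => opL ℓ (-y - 2)) fun v => by
    obtain ⟨N, hN⟩ := exists_opL_eq_zero ℓ v
    refine ⟨-N - 2, fun y hy => ?_⟩
    by_contra h
    exact hy (hN _ (by omega))

theorem virField_ncoeff (n : ℤ) : (virField ℓ)[[n]] = opL ℓ (n - 1) := by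
  rw [virField, ncoeff_of_coeff]
  congr 1
  ring

end VacuumModule

end Virasoro

namespace Virasoro.VacuumModule

variable (ℓ : ℂ)

theorem borcherds_virField_zero (p q : ℤ) (v : VacuumModule ℓ) :
    borcherds (virField ℓ) (virField ℓ) p q 0 v = ((p : ℂ) - q) • opL ℓ (p + q - 2) v
      + (if p + q = 2 then ((p - 1 : ℂ) ^ 3 - (p - 1)) / 12 * ℓ else 0) • v := by
  rw [borcherds_zero_apply, virField_ncoeff, virField_ncoeff, opL_comm]
  push_cast
  rw [show p - 1 + (q - 1) = p + q - 2 by ring]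
  simp only [sub_eq_zero (a := p + q)]
  congr 2
  ring

theorem isLocal_virField : IsLocal (virField ℓ) (virField ℓ) := by
  refine ⟨4, fun p q => LinearMap.ext fun v => ?_⟩
  rw [show ((4 : ℕ) : ℤ) = 0 + 1 + 1 + 1 + 1 by norm_num]
  simp only [borcherds_succ, LinearMap.sub_apply, borcherds_virField_zero]
  simp only [show p + 1 + 1 + 1 + 1 + q = p + q + 4 by ring,
    show p + 1 + 1 + 1 + (q + 1) = p + q + 4 by ring,
    show p + 1 + 1 + (q + 1 + 1) = p + q + 4 by ring,
    show p + 1 + (q + 1 + 1 + 1) = p + q + 4 by ring,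
    show p + (q + 1 + 1 + 1 + 1) = p + q + 4 by ring]
  split_ifs <;> push_cast <;> simp only [LinearMap.zero_apply] <;> module

end Virasoro.VacuumModule

/-! ### The identity field and linear combinations of local fields -/

namespace VertexField

variable {V : Type u} [AddCommGroup V] [Module ℂ V]

theorem bddBelow_support_idField (v : V) :
    BddBelow (Function.support fun y : ℤ => (if y = 0 then 1 else 0 : Module.End ℂ V) v) := by
  refine ⟨0, fun y hy => ?_⟩
  by_contra h
  exact hy (by beta_reduce; rw [if_neg (by omega), LinearMap.zero_apply])

/-- The identity field. -/
def idField (V : Type u) [AddCommGroup V] [Module ℂ V] : VertexOperator ℂ V :=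
  VertexOperator.of_coeff (fun y => if y = 0 then 1 else 0) bddBelow_support_idField

theorem idField_ncoeff (n : ℤ) (v : V) :
    ((idField V)[[n]]) v = if n = -1 then v else 0 := by
  rw [idField, ncoeff_of_coeff]
  by_cases h : n = -1
  · subst h; simp
  · rw [if_neg (by omega), if_neg h, LinearMap.zero_apply]

theorem isLocal_idField (A : VertexOperator ℂ V) : IsLocal (idField V) A := by
  refine ⟨0, fun p q => LinearMap.ext fun v => ?_⟩
  rw [Nat.cast_zero, borcherds_zero_apply, idField_ncoeff, idField_ncoeff]
  split_ifs <;> simp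

theorem borcherds_add_left (A B C : VertexOperator ℂ V) (r : ℕ) (p q : ℤ) :
    borcherds (A + B) C p q r = borcherds A C p q r + borcherds B C p q r := by
  induction r generalizing p q with
  | zero =>
    rw [Nat.cast_zero, borcherds_zero, borcherds_zero, borcherds_zero, map_add, Pi.add_apply]
    noncomm_ring
  | succ r ih =>
    push_cast
    rw [borcherds_succ, borcherds_succ, borcherds_succ, ih, ih]
    abel

theorem borcherds_smul_left (a : ℂ) (A C : VertexOperator ℂ V) (r : ℕ) (p q : ℤ) :
    borcherds (a • A) C p q r = a • borcherds A C p q r := by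
  induction r generalizing p q with
  | zero =>
    rw [Nat.cast_zero, borcherds_zero, borcherds_zero, map_smul, Pi.smul_apply, smul_sub,
      smul_mul_assoc, mul_smul_comm]
  | succ r ih =>
    push_cast
    rw [borcherds_succ, borcherds_succ, ih, ih, smul_sub]

theorem IsLocal.add {A B C : VertexOperator ℂ V} (hA : IsLocal A C) (hB : IsLocal B C) :
    IsLocal (A + B) C := by
  obtain ⟨N, hN⟩ := hA
  obtain ⟨N', hN'⟩ := hB
  refine ⟨max N N', fun p q => ?_⟩
  rw [borcherds_add_left, borcherds_eq_zero_of_le hN _ (by simp),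
    borcherds_eq_zero_of_le hN' _ (by simp), add_zero]

theorem IsLocal.smul {A C : VertexOperator ℂ V} (a : ℂ) (hA : IsLocal A C) :
    IsLocal (a • A) C := by
  obtain ⟨N, hN⟩ := hA
  exact ⟨N, fun p q => by rw [borcherds_smul_left, hN, smul_zero]⟩

/-! ### Creative and translation covariant fields -/

/-- `A(x) 𝟏` has no negative powers of `x`. -/
def IsCreative (vac : V) (A : VertexOperator ℂ V) : Prop :=
  ∀ n : ℤ, 0 ≤ n → (A[[n]]) vac = 0

/-- `[D, A(x)] = d/dx A(x)`. -/
def IsCovariant (D : Module.End ℂ V) (A : VertexOperator ℂ V) : Prop :=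
  ∀ (n : ℤ) (v : V), D ((A[[n]]) v) = (A[[n]]) (D v) - (n : ℂ) • (A[[n - 1]]) v

theorem IsCreative.nthProd {vac : V} {A B : VertexOperator ℂ V} (hA : IsCreative vac A)
    (hB : IsCreative vac B) (r : ℤ) : IsCreative vac (nthProd A B r) := fun q hq => by
  rw [nthProd_ncoeff, borcherds_apply]
  refine finsum_eq_zero_of_forall_eq_zero fun i => ?_
  rw [hB _ (by omega), hA _ (by omega)]
  simp

theorem IsCreative.nthProd_vac {vac : V} {A B : VertexOperator ℂ V} (hA : IsCreative vac A)
    (hB : IsCreative vac B) (r : ℤ) :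
    ((VertexField.nthProd A B r)[[-1]]) vac = (A[[r]]) ((B[[-1]]) vac) := by
  rw [nthProd_ncoeff, borcherds_apply, finsum_eq_single _ 0]
  · rw [hA _ (by omega)]
    simp
  · intro i hi
    rw [hB _ (by omega), hA _ (by omega)]
    simp

theorem binomCoeff_succ_mul (r : ℤ) (i : ℕ) :
    binomCoeff r (i + 1) * (i + 1) = -(binomCoeff r i * (r - i)) := by
  have h := Ring.choose_smul_choose r (Nat.le_succ i)
  rw [Nat.choose_succ_self_right, Nat.succ_sub (le_refl i), Nat.sub_self, Ring.choose_one_right,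
    nsmul_eq_mul] at h
  have h' : ((i : ℂ) + 1) * ((Ring.choose r (i + 1) : ℤ) : ℂ)
      = ((Ring.choose r i : ℤ) : ℂ) * (r - i) := by exact_mod_cast h
  rw [binomCoeff, binomCoeff, pow_succ]
  linear_combination (-(-1 : ℂ) ^ i) * h'

/-- As `(∂/∂x + ∂/∂y) (x - y)^r = 0`, only the factors `A(x)` and `B(y)` are differentiated. -/
theorem IsCovariant.orderedProd {D : Module.End ℂ V} {A B : VertexOperator ℂ V}
    (hA : IsCovariant D A) (hB : IsCovariant D B) (p q r : ℤ) (v : V) :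
    D (orderedProd A B p q r v) = orderedProd A B p q r (D v)
      - (p : ℂ) • orderedProd A B (p - 1) q r v - (q : ℂ) • orderedProd A B p (q - 1) r v := by
  obtain ⟨N, hN⟩ := exists_comp_eq_zero A B v
  obtain ⟨N', hN'⟩ := exists_comp_eq_zero A B (D v)
  set K := (max N N' - q).toNat
  have hK : max N N' ≤ q + K := by have := Int.self_le_toNat (max N N' - q); omega
  have h1 := le_trans (le_max_left N N') hK
  have h2 := le_trans (le_max_right N N') hK
  simp only [orderedProd_apply]
  rw [residueSum_eq_sum r hN p q (K + 1) (by push_cast; omega),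
    residueSum_eq_sum r hN' p q (K + 1) (by push_cast; omega),
    residueSum_eq_sum r hN (p - 1) q (K + 1) (by push_cast; omega),
    residueSum_eq_sum r hN p (q - 1) (K + 1) (by push_cast; omega)]
  have e : ∀ i : ℕ, D (binomCoeff r i • (A[[p + r - i]]) ((B[[q + i]]) v))
      = binomCoeff r i • (A[[p + r - i]]) ((B[[q + i]]) (D v))
        - (p : ℂ) • binomCoeff r i • (A[[p - 1 + r - i]]) ((B[[q + i]]) v)
        - (q : ℂ) • binomCoeff r i • (A[[p + r - i]]) ((B[[q - 1 + i]]) v)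
        - ((binomCoeff r i * (r - i)) • (A[[p - 1 + r - i]]) ((B[[q + i]]) v)
          + (binomCoeff r i * i) • (A[[p + r - i]]) ((B[[q - 1 + i]]) v)) := by
    intro i
    rw [map_smul, hA, hB, map_sub, map_smul, show p + r - (i : ℤ) - 1 = p - 1 + r - i by ring,
      show q + (i : ℤ) - 1 = q - 1 + i by ring]
    push_cast
    module
  rw [map_sum, Finset.sum_congr rfl fun i _ => e i, Finset.sum_sub_distrib, Finset.sum_sub_distrib,
    Finset.sum_sub_distrib, ← Finset.smul_sum, ← Finset.smul_sum, sub_eq_self,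
    Finset.sum_add_distrib, Finset.sum_range_succ, Finset.sum_range_succ' (fun i : ℕ =>
      (binomCoeff r i * i) • (A[[p + r - i]]) ((B[[q - 1 + i]]) v)), hN _ _ h1]
  simp only [smul_zero, add_zero, Nat.cast_zero, mul_zero, zero_smul]
  rw [← Finset.sum_add_distrib]
  refine Finset.sum_eq_zero fun i _ => ?_
  rw [Nat.cast_succ, binomCoeff_succ_mul, Nat.cast_succ,
    show p + r - ((i : ℤ) + 1) = p - 1 + r - i by ring, show q - 1 + ((i : ℤ) + 1) = q + i by ring]
  module

theorem IsCovariant.nthProd {D : Module.End ℂ V} {A B : VertexOperator ℂ V}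
    (hA : IsCovariant D A) (hB : IsCovariant D B) (r : ℤ) :
    IsCovariant D (nthProd A B r) := fun q v => by
  rw [nthProd_ncoeff, nthProd_ncoeff, borcherds, borcherds]
  simp only [LinearMap.sub_apply, LinearMap.smul_apply, map_sub, map_smul, hA.orderedProd hB,
    hB.orderedProd hA]
  push_cast
  module

/-- Goddard's uniqueness theorem, in the form that a creative, covariant field `A` with
`A_{-1} 𝟏 = 0` kills `𝟏`. -/
theorem ncoeff_vac_eq_zero {D : Module.End ℂ V} {vac : V} (hD : D vac = 0)
    {A : VertexOperator ℂ V} (hA : IsCreative vac A) (hA' : IsCovariant D A)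
    (h : (A[[-1]]) vac = 0) (n : ℤ) : (A[[n]]) vac = 0 := by
  rcases le_or_gt 0 n with hn | hn
  · exact hA n hn
  · obtain ⟨k, rfl⟩ : ∃ k : ℕ, n = -1 - k := ⟨(-1 - n).toNat, by omega⟩
    clear hn
    induction k with
    | zero => simpa using h
    | succ k ih =>
      have := hA' (-1 - k) vac
      rw [ih, hD, map_zero, map_zero, zero_sub, eq_comm, neg_eq_zero] at this
      rcases smul_eq_zero.1 this with h0 | h0
      · have h0' : (-1 - k : ℤ) = 0 := by exact_mod_cast h0
        omega
      · rw [← h0, Nat.cast_succ, sub_sub]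

/-- If `A` is local with `B` and kills `v`, it kills all `B_q v`: one may cancel the factor
`(x - y)^N` of `(x - y)^N A(x) B(y) v = 0`, since `B(y) v` is a Laurent series. -/
theorem IsLocal.ncoeff_eq_zero {A B : VertexOperator ℂ V} (h : IsLocal A B) {v : V}
    (hv : ∀ n, (A[[n]]) v = 0) (p q : ℤ) : (A[[p]]) ((B[[q]]) v) = 0 := by
  obtain ⟨N, hN⟩ := h
  have h0 : ∀ p q, orderedProd A B p q N v = 0 := fun p q => by
    have := congrArg (fun f => f v) (hN p q)
    simp only [borcherds, LinearMap.sub_apply, LinearMap.smul_apply, LinearMap.zero_apply] at this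
    rw [orderedProd_apply B A, residueSum, finsum_eq_zero_of_forall_eq_zero, smul_zero,
      sub_zero] at this
    · exact this
    · intro i
      rw [hv, map_zero, smul_zero]
  clear hN
  induction N generalizing p q with
  | zero =>
    have := h0 p q
    rwa [Nat.cast_zero, orderedProd_zero] at this
  | succ N ih =>
    refine ih p q fun p q => ?_
    obtain ⟨M, hM⟩ := exists_ncoeff_eq_zero B v
    have hstep : ∀ p q, orderedProd A B p q N v = orderedProd A B (p - 1) (q + 1) N v := by
      intro p q
      have := h0 (p - 1) q
      rw [Nat.cast_succ, orderedProd_succ, LinearMap.sub_apply, sub_add_cancel, sub_eq_zero] at this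
      exact this
    have hiter : ∀ (k : ℕ) p q, orderedProd A B p q N v = orderedProd A B (p - k) (q + k) N v := by
      intro k
      induction k with
      | zero => simp
      | succ k ihk =>
        intro p q
        rw [ihk, hstep]
        rw [Nat.cast_succ, sub_sub, add_assoc]
    rw [hiter (M - q).toNat, orderedProd_apply, residueSum, finsum_eq_zero_of_forall_eq_zero]
    intro i
    rw [hM _ (by have := Int.self_le_toNat (M - q); omega), map_zero, smul_zero]

end VertexField

/-! ### The fields generated by the Virasoro field -/

namespace Virasoro.VacuumModule

variable (ℓ : ℂ)

/-- The fields obtained from the identity field by forming linear combinations and products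
`T_(r) B` with the Virasoro field `T`. -/
inductive IsGenerated : VertexOperator ℂ (VacuumModule ℓ) → Prop
  | one : IsGenerated (idField _)
  | nthProd {B} (r : ℤ) : IsGenerated B → IsGenerated (nthProd (virField ℓ) B r)
  | add {A B} : IsGenerated A → IsGenerated B → IsGenerated (A + B)
  | smul {A} (a : ℂ) : IsGenerated A → IsGenerated (a • A)

/-- The fields to which Goddard's uniqueness theorem applies. -/
structure IsVertexField (A : VertexOperator ℂ (VacuumModule ℓ)) : Prop where
  creative : IsCreative (vac ℓ) A
  covariant : IsCovariant (opL ℓ (-1)) A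
  isLocal : IsLocal A (virField ℓ)

variable {ℓ}

theorem IsVertexField.add {A B : VertexOperator ℂ (VacuumModule ℓ)} (hA : IsVertexField ℓ A)
    (hB : IsVertexField ℓ B) : IsVertexField ℓ (A + B) where
  creative n hn := by
    rw [map_add, Pi.add_apply, LinearMap.add_apply, hA.creative n hn, hB.creative n hn, add_zero]
  covariant n v := by
    simp only [map_add, Pi.add_apply, LinearMap.add_apply, hA.covariant n v, hB.covariant n v]
    module
  isLocal := hA.isLocal.add hB.isLocal

theorem IsVertexField.smul {A : VertexOperator ℂ (VacuumModule ℓ)} (a : ℂ)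
    (hA : IsVertexField ℓ A) : IsVertexField ℓ (a • A) where
  creative n hn := by
    rw [map_smul, Pi.smul_apply, LinearMap.smul_apply, hA.creative n hn, smul_zero]
  covariant n v := by
    simp only [map_smul, Pi.smul_apply, LinearMap.smul_apply, hA.covariant n v]
    module
  isLocal := hA.isLocal.smul a

theorem IsVertexField.nthProd {A B : VertexOperator ℂ (VacuumModule ℓ)} (hA : IsVertexField ℓ A)
    (hB : IsVertexField ℓ B) (hAB : IsLocal A B) (r : ℤ) :
    IsVertexField ℓ (nthProd A B r) where
  creative := hA.creative.nthProd hB.creative r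
  covariant := hA.covariant.nthProd hB.covariant r
  isLocal := hAB.nthProd hA.isLocal hB.isLocal r

theorem isVertexField_idField : IsVertexField ℓ (idField _) where
  creative n hn := by rw [idField_ncoeff, if_neg (by omega)]
  covariant n v := by
    simp only [idField_ncoeff]
    split_ifs with h1 h2 h2
    · omega
    · simp
    · obtain rfl : n = 0 := by omega
      simp
    · simp
  isLocal := isLocal_idField _

variable (ℓ) in
theorem isVertexField_virField : IsVertexField ℓ (virField ℓ) where
  creative n hn := by rw [virField_ncoeff, opL_vac ℓ (by omega)]
  covariant n v := by
    have h := opL_comm ℓ (-1) (n - 1) v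
    rw [virField_ncoeff, virField_ncoeff, sub_eq_iff_eq_add.1 h,
      show (-1 : ℤ) + (n - 1) = n - 1 - 1 by ring,
      show (((-1 : ℤ) : ℂ) ^ 3 - ((-1 : ℤ) : ℂ)) / 12 * ℓ = 0 by norm_num, ite_self]
    push_cast
    module
  isLocal := isLocal_virField ℓ

theorem IsGenerated.isVertexField {A : VertexOperator ℂ (VacuumModule ℓ)}
    (hA : IsGenerated ℓ A) : IsVertexField ℓ A := by
  induction hA with
  | one => exact isVertexField_idField
  | nthProd r _ ih => exact (isVertexField_virField ℓ).nthProd ih ih.isLocal.symm r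
  | add _ _ ih ih' => exact ih.add ih'
  | smul a _ ih => exact ih.smul a

theorem IsGenerated.isLocal {A C : VertexOperator ℂ (VacuumModule ℓ)}
    (hA : IsGenerated ℓ A) (hC : IsGenerated ℓ C) : IsLocal A C := by
  induction hA with
  | one => exact isLocal_idField _
  | nthProd r hB ih =>
    exact hB.isVertexField.isLocal.symm.nthProd hC.isVertexField.isLocal.symm ih r
  | add _ _ ih ih' => exact ih.add ih'
  | smul a _ ih => exact ih.smul a

/-- The state-field correspondence is injective. -/
theorem IsVertexField.ext {A B : VertexOperator ℂ (VacuumModule ℓ)} (hA : IsVertexField ℓ A)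
    (hB : IsVertexField ℓ B) (h : (A[[-1]]) (vac ℓ) = (B[[-1]]) (vac ℓ)) : A = B := by
  have hC := hA.add (hB.smul (-1))
  have h0 : ∀ n, ((A + (-1 : ℂ) • B)[[n]]) (vac ℓ) = 0 :=
    ncoeff_vac_eq_zero (opL_vac ℓ le_rfl) hC.creative hC.covariant (by
      rw [map_add, map_smul, Pi.add_apply, Pi.smul_apply, LinearMap.add_apply,
        LinearMap.smul_apply, h]
      module)
  let P : Submodule ℂ (VacuumModule ℓ) :=
    { carrier := {v | ∀ n, ((A + (-1 : ℂ) • B)[[n]]) v = 0}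
      zero_mem' := fun n => map_zero _
      add_mem' := fun {v w} hv hw n => by rw [map_add, hv n, hw n, add_zero]
      smul_mem' := fun a v hv n => by rw [map_smul, hv n, smul_zero] }
  have hP : ∀ v, v ∈ P := mem_of_vac_mem ℓ P h0 fun m v hv n => by
    have := hC.isLocal.ncoeff_eq_zero hv n (m + 1)
    rwa [virField_ncoeff, add_sub_cancel_right] at this
  refine ncoeff_injective fun n v => ?_
  have := hP v n
  rw [map_add, map_smul, Pi.add_apply, Pi.smul_apply, LinearMap.add_apply,
    LinearMap.smul_apply, neg_one_smul, ← sub_eq_add_neg, sub_eq_zero] at this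
  exact this

/-- The state-field correspondence is surjective. -/
theorem exists_isGenerated (v : VacuumModule ℓ) :
    ∃ A, IsGenerated ℓ A ∧ (A[[-1]]) (vac ℓ) = v := by
  let P : Submodule ℂ (VacuumModule ℓ) :=
    { carrier := {v | ∃ A, IsGenerated ℓ A ∧ (A[[-1]]) (vac ℓ) = v}
      zero_mem' := ⟨_, IsGenerated.one.smul 0, by simp⟩
      add_mem' := by
        rintro _ _ ⟨A, hA, rfl⟩ ⟨B, hB, rfl⟩
        exact ⟨_, hA.add hB, by simp⟩
      smul_mem' := by
        rintro a _ ⟨A, hA, rfl⟩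
        exact ⟨_, hA.smul a, by simp⟩ }
  refine mem_of_vac_mem ℓ P ⟨_, IsGenerated.one, by simp [idField_ncoeff]⟩ ?_ v
  rintro n _ ⟨A, hA, rfl⟩
  refine ⟨_, hA.nthProd (n + 1), ?_⟩
  rw [(isVertexField_virField ℓ).creative.nthProd_vac hA.isVertexField.creative, virField_ncoeff,
    add_sub_cancel_right]

/-- The field that corresponds to a vector. -/
def stateField (v : VacuumModule ℓ) : VertexOperator ℂ (VacuumModule ℓ) :=
  (exists_isGenerated v).choose

theorem isGenerated_stateField (v : VacuumModule ℓ) : IsGenerated ℓ (stateField v) :=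
  (exists_isGenerated v).choose_spec.1

theorem stateField_vac (v : VacuumModule ℓ) : ((stateField v)[[-1]]) (vac ℓ) = v :=
  (exists_isGenerated v).choose_spec.2

theorem stateField_eq {A : VertexOperator ℂ (VacuumModule ℓ)} (hA : IsVertexField ℓ A)
    {v : VacuumModule ℓ} (h : (A[[-1]]) (vac ℓ) = v) : stateField v = A :=
  (isGenerated_stateField v).isVertexField.ext hA ((stateField_vac v).trans h.symm)

theorem stateField_ncoeff (u v : VacuumModule ℓ) (n : ℤ) :
    stateField (((stateField u)[[n]]) v) = nthProd (stateField u) (stateField v) n := by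
  have hu := isGenerated_stateField u
  have hv := isGenerated_stateField v
  refine stateField_eq (hu.isVertexField.nthProd hv.isVertexField (hu.isLocal hv) n) ?_
  rw [hu.isVertexField.creative.nthProd_vac hv.isVertexField.creative, stateField_vac]

variable (ℓ) in
/-- The vertex algebra structure of the vacuum module. -/
def vertexAlgebra : VertexAlgebraStructure (VacuumModule ℓ) where
  Y :=
    { toFun := stateField
      map_add' := fun u v => stateField_eq
        ((isGenerated_stateField u).add (isGenerated_stateField v)).isVertexField
        (by simp [stateField_vac])
      map_smul' := fun a v => stateField_eq ((isGenerated_stateField v).smul a).isVertexField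
        (by simp [stateField_vac]) }
  vac := vac ℓ
  vacuum n v := by
    have h : stateField (vac ℓ) = idField _ :=
      stateField_eq isVertexField_idField (by simp [idField_ncoeff])
    exact (congrArg (fun A => (A[[n]]) v) h).trans (idField_ncoeff n v)
  creation v := (isGenerated_stateField v).isVertexField.creative
  creation_const := stateField_vac
  jacobi u v w p q r := by
    have h := ((isGenerated_stateField u).isLocal (isGenerated_stateField v)).borcherds_identity
      p q r w
    rw [borcherds_apply] at h
    simp only [← stateField_ncoeff] at h
    exact h

variable (ℓ) in
theorem isVacuumVertexAlgebra : IsVacuumVertexAlgebra ℓ (vertexAlgebra ℓ) where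
  vac_eq := rfl
  Y_conformal n := by
    have h : stateField (conformal ℓ) = virField ℓ :=
      stateField_eq (isVertexField_virField ℓ) (by rw [virField_ncoeff]; rfl)
    refine (congrArg (fun A => A[[n + 1]]) h).trans ?_
    simp only [virField_ncoeff, add_sub_cancel_right]

end Virasoro.VacuumModule

namespace VertexAlgebraStructure

variable {V : Type u} [AddCommGroup V] [Module ℂ V]

theorem Y_ncoeff (A : VertexAlgebraStructure V) (u v : V) (n : ℤ) :
    A.Y (((A.Y u)[[n]]) v) = nthProd (A.Y u) (A.Y v) n := by
  refine ncoeff_injective fun q w => ?_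
  have h := A.jacobi u v w 0 q n
  rw [← borcherds_apply, finsum_eq_single _ 0] at h
  · simpa [nthProd_ncoeff] using h
  · rintro (_ | i) hi
    · exact absurd rfl hi
    · rw [Ring.choose_zero_succ, Int.cast_zero, zero_smul]

theorem Y_vac (A : VertexAlgebraStructure V) : A.Y A.vac = idField V :=
  ncoeff_injective fun n v => by rw [A.vacuum, idField_ncoeff]

end VertexAlgebraStructure

/-! ### Uniqueness of the vertex algebra structure -/

namespace Virasoro

open VacuumModule

variable {ℓ : ℂ} {A : VertexAlgebraStructure (VacuumModule ℓ)}

theorem IsVacuumVertexAlgebra.Y_conformal_eq (hA : IsVacuumVertexAlgebra ℓ A) :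
    A.Y (conformal ℓ) = virField ℓ := by
  refine ncoeff_injective fun n v => ?_
  have h := hA.Y_conformal (n - 1)
  rw [sub_add_cancel] at h
  rw [h, virField_ncoeff]

theorem IsVacuumVertexAlgebra.Y_opL (hA : IsVacuumVertexAlgebra ℓ A) (n : ℤ)
    (v : VacuumModule ℓ) : A.Y (opL ℓ n v) = nthProd (virField ℓ) (A.Y v) (n + 1) := by
  rw [← hA.Y_conformal n, A.Y_ncoeff, hA.Y_conformal_eq]

theorem IsVacuumVertexAlgebra.eq {A B : VertexAlgebraStructure (VacuumModule ℓ)}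
    (hA : IsVacuumVertexAlgebra ℓ A) (hB : IsVacuumVertexAlgebra ℓ B) : A = B := by
  have hvac : A.vac = B.vac := hA.vac_eq.trans hB.vac_eq.symm
  have hY : A.Y = B.Y := by
    refine LinearMap.ext fun v => mem_of_vac_mem ℓ (LinearMap.eqLocus A.Y B.Y) ?_ ?_ v
    · change A.Y (vac ℓ) = B.Y (vac ℓ)
      rw [← hA.vac_eq, A.Y_vac, hvac, B.Y_vac]
    · intro n v hv
      change A.Y (opL ℓ n v) = B.Y (opL ℓ n v)
      rw [hA.Y_opL, hB.Y_opL, show A.Y v = B.Y v from hv]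
  cases A
  cases B
  cases hvac
  cases hY
  rfl

/-! ### Sorted monomials -/

namespace VacuumModule

variable (ℓ)

/-- The vector `L(-k₁-2) ⋯ L(-k_r-2) 𝟏`, for `s = {k₁ ≥ ⋯ ≥ k_r}`. -/
def monomial (s : Multiset ℕ) : VacuumModule ℓ :=
  (s.sort (· ≥ ·)).foldr (fun (k : ℕ) v => opL ℓ (-k - 2) v) (vac ℓ)

@[simp] theorem monomial_zero : monomial ℓ 0 = vac ℓ := by simp [monomial]

theorem monomial_cons {k : ℕ} {s : Multiset ℕ} (h : ∀ j ∈ s, j ≤ k) :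
    monomial ℓ (k ::ₘ s) = opL ℓ (-k - 2) (monomial ℓ s) := by
  rw [monomial, Multiset.sort_cons _ _ (r := (· ≥ ·)) h, List.foldr_cons, monomial]

theorem exists_eq_cons {s : Multiset ℕ} (hs : s ≠ 0) :
    ∃ k t, s = k ::ₘ t ∧ ∀ j ∈ t, j ≤ k := by
  obtain ⟨k, hk, h⟩ := s.toFinset.exists_max_image id (by simpa using hs)
  obtain ⟨t, rfl⟩ := Multiset.exists_cons_of_mem (Multiset.mem_toFinset.1 hk)
  exact ⟨k, t, rfl, fun j hj => h j (by simp [hj])⟩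

/-- Induction over multisets of natural numbers, adding a largest element at each step. -/
theorem multiset_induction_max {P : Multiset ℕ → Prop} (zero : P 0)
    (cons : ∀ k t, (∀ j ∈ t, j ≤ k) → P t → P (k ::ₘ t)) (s : Multiset ℕ) : P s := by
  induction hn : Multiset.card s generalizing s with
  | zero => rw [Multiset.card_eq_zero.1 hn]; exact zero
  | succ n ih =>
    obtain ⟨k, t, rfl, h⟩ := exists_eq_cons (s := s) (by rintro rfl; simp at hn)
    exact cons k t h (ih t (by simpa using hn))

/-- The span of the monomials with at most `m` factors. -/
def filtration (m : ℕ) : Submodule ℂ (VacuumModule ℓ) :=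
  Submodule.span ℂ (monomial ℓ '' {s | Multiset.card s ≤ m})

variable {ℓ}

theorem monomial_mem_filtration {m : ℕ} {s : Multiset ℕ} (h : Multiset.card s ≤ m) :
    monomial ℓ s ∈ filtration ℓ m :=
  Submodule.subset_span ⟨s, h, rfl⟩

theorem filtration_mono {m n : ℕ} (h : m ≤ n) : filtration ℓ m ≤ filtration ℓ n :=
  Submodule.span_mono (Set.image_mono fun _ hs => le_trans hs h)

theorem opL_opL (m n : ℤ) (v : VacuumModule ℓ) :
    opL ℓ m (opL ℓ n v) = opL ℓ n (opL ℓ m v) + (((m : ℂ) - n) • opL ℓ (m + n) v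
      + (if m + n = 0 then ((m : ℂ) ^ 3 - m) / 12 * ℓ else 0) • v) :=
  sub_eq_iff_eq_add'.1 (opL_comm ℓ m n v)

theorem exists_eq_neg_sub_two {n : ℤ} (hn : ¬ -1 ≤ n) : ∃ k : ℕ, n = -k - 2 :=
  ⟨(-n - 2).toNat, by omega⟩

/-- All operators `L(n)` raise the filtration degree by at most one, those with `n ≥ -1` do not
raise it, and `L(-k-2)` multiplies monomials up to terms of lower degree. -/
theorem opL_filtration (m : ℕ) :
    (∀ n, ∀ v ∈ filtration ℓ m, opL ℓ n v ∈ filtration ℓ (m + 1)) ∧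
    (∀ n, -1 ≤ n → ∀ v ∈ filtration ℓ m, opL ℓ n v ∈ filtration ℓ m) ∧
    ∀ (k : ℕ) (s : Multiset ℕ), Multiset.card s = m →
      opL ℓ (-k - 2) (monomial ℓ s) - monomial ℓ (k ::ₘ s) ∈ filtration ℓ m := by
  induction m using Nat.strong_induction_on with
  | _ m ih =>
  -- the commutator terms are of lower degree
  have comm : ∀ (n : ℤ) (k : ℕ) (t : Multiset ℕ), Multiset.card t < m →
      opL ℓ n (opL ℓ (-k - 2) (monomial ℓ t)) - opL ℓ (-k - 2) (opL ℓ n (monomial ℓ t))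
        ∈ filtration ℓ m := by
    intro n k t ht
    rw [opL_comm]
    refine add_mem (Submodule.smul_mem _ _ ?_)
      (Submodule.smul_mem _ _ (monomial_mem_filtration ht.le))
    exact filtration_mono ht ((ih _ ht).1 _ _ (monomial_mem_filtration le_rfl))
  have h3 : ∀ (k : ℕ) (s : Multiset ℕ), Multiset.card s = m →
      opL ℓ (-k - 2) (monomial ℓ s) - monomial ℓ (k ::ₘ s) ∈ filtration ℓ m := by
    intro k s hs
    by_cases hk : ∀ j ∈ s, j ≤ k
    · rw [monomial_cons ℓ hk, sub_self]
      exact zero_mem _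
    · obtain ⟨k', t, rfl, ht⟩ := exists_eq_cons (s := s) (by rintro rfl; simp at hk)
      have hkk' : k ≤ k' := by
        by_contra hlt
        refine hk fun j hj => ?_
        rcases Multiset.mem_cons.1 hj with rfl | hj
        · omega
        · exact (ht j hj).trans (by omega)
      have hcard : Multiset.card t < m := by
        rw [← hs, Multiset.card_cons]; exact Nat.lt_succ_self _
      have ht' : ∀ j ∈ k ::ₘ t, j ≤ k' := by
        intro j hj
        rcases Multiset.mem_cons.1 hj with rfl | hj
        · exact hkk'
        · exact ht j hj
      rw [Multiset.cons_swap, monomial_cons ℓ ht', monomial_cons ℓ ht]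
      have h := (ih _ hcard).1 (-k' - 2) _ ((ih _ hcard).2.2 k t rfl)
      rw [map_sub] at h
      have := add_mem (comm (-k - 2) k' t hcard) (filtration_mono hcard h)
      rwa [sub_add_sub_cancel] at this
  have h2 : ∀ n, -1 ≤ n → ∀ v ∈ filtration ℓ m, opL ℓ n v ∈ filtration ℓ m := by
    intro n hn v hv
    induction hv using Submodule.span_induction with
    | mem v hv =>
      obtain ⟨s, hs, rfl⟩ := hv
      rcases eq_or_ne s 0 with rfl | hs0
      · rw [monomial_zero, opL_vac ℓ hn]
        exact zero_mem _
      · obtain ⟨k, t, rfl, ht⟩ := exists_eq_cons hs0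
        have hcard : Multiset.card t < m := by
          simpa [Nat.succ_le_iff] using hs
        rw [monomial_cons ℓ ht, ← sub_add_cancel (opL ℓ n _) (opL ℓ (-k - 2) (opL ℓ n _))]
        refine add_mem (comm n k t hcard) (filtration_mono hcard ?_)
        exact (ih _ hcard).1 _ _ ((ih _ hcard).2.1 n hn _ (monomial_mem_filtration le_rfl))
    | zero => rw [map_zero]; exact zero_mem _
    | add v w _ _ hv hw => rw [map_add]; exact add_mem hv hw
    | smul a v _ hv => rw [map_smul]; exact Submodule.smul_mem _ _ hv
  refine ⟨?_, h2, h3⟩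
  intro n v hv
  by_cases hn : -1 ≤ n
  · exact filtration_mono (Nat.le_succ m) (h2 n hn v hv)
  obtain ⟨k, rfl⟩ := exists_eq_neg_sub_two hn
  induction hv using Submodule.span_induction with
  | mem v hv =>
    obtain ⟨s, hs, rfl⟩ := hv
    rcases lt_or_eq_of_le (show Multiset.card s ≤ m from hs) with hlt | heq
    · exact filtration_mono (by omega) ((ih _ hlt).1 _ _ (monomial_mem_filtration le_rfl))
    · rw [← sub_add_cancel (opL ℓ _ _) (monomial ℓ (k ::ₘ s))]
      refine add_mem (filtration_mono (Nat.le_succ m) (h3 k s heq)) (monomial_mem_filtration ?_)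
      rw [Multiset.card_cons, heq]
  | zero => rw [map_zero]; exact zero_mem _
  | add v w _ _ hv hw => rw [map_add]; exact add_mem hv hw
  | smul a v _ hv => rw [map_smul]; exact Submodule.smul_mem _ _ hv

theorem opL_mem_filtration_succ {m : ℕ} (n : ℤ) {v : VacuumModule ℓ} (hv : v ∈ filtration ℓ m) :
    opL ℓ n v ∈ filtration ℓ (m + 1) := (opL_filtration m).1 n v hv

theorem opL_mem_filtration {m : ℕ} {n : ℤ} (hn : -1 ≤ n) {v : VacuumModule ℓ}
    (hv : v ∈ filtration ℓ m) : opL ℓ n v ∈ filtration ℓ m := (opL_filtration m).2.1 n hn v hv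

variable (ℓ) in
theorem span_monomial : Submodule.span ℂ (Set.range (monomial ℓ)) = ⊤ := by
  refine eq_top_iff.2 fun v _ => mem_of_vac_mem ℓ _ ?_ ?_ v
  · exact Submodule.subset_span ⟨0, monomial_zero ℓ⟩
  · intro n v hv
    induction hv using Submodule.span_induction with
    | mem v hv =>
      obtain ⟨s, rfl⟩ := hv
      exact Submodule.span_mono (Set.image_subset_range _ _)
        (opL_mem_filtration_succ n (monomial_mem_filtration (m := Multiset.card s) le_rfl))
    | zero => rw [map_zero]; exact zero_mem _
    | add v w _ _ hv hw => rw [map_add]; exact add_mem hv hw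
    | smul a v _ hv => rw [map_smul]; exact Submodule.smul_mem _ _ hv

/-! ### The grading -/

/-- The conformal weight of a monomial. -/
def weight (s : Multiset ℕ) : ℕ := (s.map (· + 2)).sum

variable (ℓ) in
theorem opL_zero_monomial (s : Multiset ℕ) :
    opL ℓ 0 (monomial ℓ s) = (weight s : ℂ) • monomial ℓ s := by
  induction s using multiset_induction_max with
  | zero => simp [weight, opL_vac]
  | cons k t ht ih =>
    have hw : weight (k ::ₘ t) = k + 2 + weight t := by simp [weight]
    rw [monomial_cons ℓ ht, opL_opL, ih, if_neg (by omega), hw, map_smul, zero_add]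
    push_cast
    module

variable (ℓ) in
/-- The span of the monomials of weight `n`. -/
def weightSpan (n : ℤ) : Submodule ℂ (VacuumModule ℓ) :=
  Submodule.span ℂ (monomial ℓ '' {s | (weight s : ℤ) = n})

theorem weightSpan_le (n : ℤ) :
    weightSpan ℓ n ≤ Module.End.eigenspace (opL ℓ 0) (n : ℂ) := by
  refine Submodule.span_le.2 ?_
  rintro _ ⟨s, rfl, rfl⟩
  rw [SetLike.mem_coe, Module.End.mem_eigenspace_iff, opL_zero_monomial]
  simp

variable (ℓ) in
theorem iSup_weightSpan : ⨆ n, weightSpan ℓ n = ⊤ := by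
  rw [eq_top_iff, ← span_monomial, Submodule.span_le]
  rintro _ ⟨s, rfl⟩
  exact Submodule.mem_iSup_of_mem (weight s : ℤ) (Submodule.subset_span ⟨s, rfl, rfl⟩)

variable (ℓ) in
theorem iSupIndep_eigenspace :
    iSupIndep fun n : ℤ => Module.End.eigenspace (opL ℓ 0) (n : ℂ) :=
  (Module.End.eigenspaces_iSupIndep (opL ℓ 0)).comp Int.cast_injective

theorem eigenspace_eq_weightSpan (n : ℤ) :
    Module.End.eigenspace (opL ℓ 0) (n : ℂ) = weightSpan ℓ n := by
  have h := iSup_weightSpan ℓ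
  rw [iSup_split_single _ n] at h
  have h' : Disjoint (Module.End.eigenspace (opL ℓ 0) (n : ℂ)) (⨆ i, ⨆ (_ : i ≠ n), weightSpan ℓ i) :=
    (iSupIndep_eigenspace ℓ n).mono_right (iSup₂_mono fun i _ => weightSpan_le i)
  refine le_antisymm ?_ (weightSpan_le n)
  calc Module.End.eigenspace (opL ℓ 0) (n : ℂ)
      = (weightSpan ℓ n ⊔ ⨆ i, ⨆ (_ : i ≠ n), weightSpan ℓ i)
          ⊓ Module.End.eigenspace (opL ℓ 0) (n : ℂ) := by rw [h, top_inf_eq]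
    _ = weightSpan ℓ n ⊔ (⨆ i, ⨆ (_ : i ≠ n), weightSpan ℓ i)
          ⊓ Module.End.eigenspace (opL ℓ 0) (n : ℂ) := sup_inf_assoc_of_le _ (weightSpan_le n)
    _ = weightSpan ℓ n := by rw [inf_comm, h'.eq_bot, sup_bot_eq]
    _ ≤ weightSpan ℓ n := le_rfl

theorem card_le_weight (s : Multiset ℕ) : Multiset.card s ≤ weight s := by
  induction s using Multiset.induction_on with
  | empty => simp
  | cons k t ih =>
    rw [weight, Multiset.map_cons, Multiset.sum_cons, ← weight, Multiset.card_cons]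
    omega

theorem finite_weight_eq (n : ℤ) : {s : Multiset ℕ | (weight s : ℤ) = n}.Finite := by
  refine (n.toNat • Multiset.range (n.toNat + 1)).powerset.toFinset.finite_toSet.subset ?_
  rintro s rfl
  simp only [Int.toNat_natCast, Finset.mem_coe, Multiset.mem_toFinset, Multiset.mem_powerset]
  refine Multiset.le_iff_count.2 fun k => ?_
  rw [Multiset.count_nsmul]
  by_cases hk : k ∈ s
  · have h : k + 2 ≤ weight s := Multiset.single_le_sum (fun _ _ => Nat.zero_le _) _
      (Multiset.mem_map_of_mem _ hk)
    rw [Multiset.count_eq_one_of_mem (Multiset.nodup_range _) (Multiset.mem_range.2 (by omega)),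
      mul_one]
    exact (Multiset.count_le_card k s).trans (card_le_weight s)
  · rw [Multiset.count_eq_zero_of_notMem hk]
    exact Nat.zero_le _

end VacuumModule

theorem IsVacuumVertexAlgebra.isCovariant (hA : IsVacuumVertexAlgebra ℓ A) (v : VacuumModule ℓ) :
    IsCovariant (opL ℓ (-1)) (A.Y v) := by
  rw [hA.eq (isVacuumVertexAlgebra ℓ)]
  exact (isGenerated_stateField v).isVertexField.covariant

theorem IsVacuumVertexAlgebra.isVertexOperatorAlgebra (hA : IsVacuumVertexAlgebra ℓ A) :
    A.IsVertexOperatorAlgebra (conformal ℓ) ℓ := by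
  have h1 : (A.Y (conformal ℓ))[[1]] = opL ℓ 0 := hA.Y_conformal 0
  have h0 : (A.Y (conformal ℓ))[[0]] = opL ℓ (-1) := by
    simpa using hA.Y_conformal (-1)
  refine ⟨fun m n v => ?_, fun v n => ?_, ?_, ?_, 0, ?_⟩
  · rw [hA.Y_conformal, hA.Y_conformal, hA.Y_conformal]
    exact opL_comm ℓ m n v
  · refine LinearMap.ext fun w => ?_
    have h := hA.isCovariant v n w
    rw [h0, hA.Y_opL, nthProd_ncoeff, neg_add_cancel, borcherds_zero_apply, virField_ncoeff,
      zero_sub, h, LinearMap.smul_apply]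
    module
  · rw [h1]
    refine DirectSum.isInternal_submodule_of_iSupIndep_of_iSup_eq_top (iSupIndep_eigenspace ℓ) ?_
    simp only [eigenspace_eq_weightSpan]
    exact iSup_weightSpan ℓ
  · intro n
    rw [h1, eigenspace_eq_weightSpan]
    exact FiniteDimensional.span_of_finite ℂ ((finite_weight_eq n).image _)
  · intro n hn
    rw [h1, eigenspace_eq_weightSpan, weightSpan, Submodule.span_eq_bot]
    rintro _ ⟨s, hs, rfl⟩
    have : (weight s : ℤ) = n := hs
    omega

end Virasoro

/-! ### The Fock space of two free bosons -/

namespace Fock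

open MvPolynomial

/-- The Fock space of two free bosons `a_s`, `s : Bool`; the variable `(s, k)` is `a_s(-k-1)`. -/
abbrev Space : Type := MvPolynomial (Bool × ℕ) ℂ

/-- The operator `a_s(m)`, with `[a_s(m), a_t(n)] = m δ_{m+n,0}` if `t ≠ s` and `0` if `t = s`. -/
def mode (s : Bool) (m : ℤ) : Module.End ℂ Space :=
  if m < 0 then LinearMap.mulLeft ℂ (X (s, (-m - 1).toNat))
  else (m : ℂ) • (pderiv (!s, (m - 1).toNat)).toLinearMap

theorem mode_neg (s : Bool) (k : ℕ) (f : Space) : mode s (-k - 1) f = X (s, k) * f := by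
  rw [mode, if_pos (by omega), LinearMap.mulLeft_apply, show (-(-(k : ℤ) - 1) - 1).toNat = k by omega]

@[simp] theorem mode_zero (s : Bool) : mode s 0 = 0 := by
  rw [mode, if_neg (by omega), Int.cast_zero, zero_smul]

theorem mode_pos (s : Bool) (k : ℕ) (f : Space) :
    mode s (k + 1) f = ((k : ℂ) + 1) • pderiv (!s, k) f := by
  rw [mode, if_neg (by omega), show ((k : ℤ) + 1 - 1).toNat = k by omega]
  push_cast
  rfl

theorem int_trichotomy (m : ℤ) : (∃ k : ℕ, m = -k - 1) ∨ m = 0 ∨ ∃ k : ℕ, m = k + 1 := by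
  rcases lt_trichotomy m 0 with h | h | h
  · exact Or.inl ⟨(-m - 1).toNat, by omega⟩
  · exact Or.inr (Or.inl h)
  · exact Or.inr (Or.inr ⟨(m - 1).toNat, by omega⟩)

theorem pderiv_comm (i j : Bool × ℕ) (f : Space) :
    pderiv i (pderiv j f) = pderiv j (pderiv i f) := by
  have h : ⁅(pderiv i : Derivation ℂ Space Space), (pderiv j : Derivation ℂ Space Space)⁆ = 0 := by
    refine derivation_ext fun k => ?_
    rw [Derivation.commutator_apply, pderiv_X, pderiv_X]
    simp only [Pi.single_apply]
    split_ifs <;> simp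
  have := congrArg (fun D : Derivation ℂ Space Space => D f) h
  rwa [Derivation.commutator_apply, Derivation.zero_apply, sub_eq_zero] at this

theorem mode_comm (s t : Bool) (m n : ℤ) (f : Space) :
    mode s m (mode t n f) - mode t n (mode s m f)
      = (if t = !s ∧ m + n = 0 then (m : ℂ) else 0) • f := by
  rcases int_trichotomy m with ⟨k, rfl⟩ | rfl | ⟨k, rfl⟩
  · rcases int_trichotomy n with ⟨l, rfl⟩ | rfl | ⟨l, rfl⟩
    · rw [mode_neg, mode_neg, mode_neg, mode_neg, if_neg (by omega), zero_smul]
      ring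
    · simp only [mode_zero, LinearMap.zero_apply, map_zero, sub_zero]
      rw [if_neg (by omega), zero_smul]
    · rw [mode_neg, mode_neg, mode_pos, mode_pos, pderiv_mul, pderiv_X, Pi.single_apply]
      by_cases h : t = !s ∧ k = l
      · obtain ⟨rfl, rfl⟩ := h
        rw [if_pos (by simp), if_pos ⟨rfl, by ring⟩]
        push_cast
        rw [smul_add, one_mul, ← mul_smul_comm]
        module
      · rw [if_neg, if_neg (by rintro ⟨h1, h2⟩; exact h ⟨h1, by omega⟩)]
        · rw [zero_mul, zero_add, mul_smul_comm, sub_self, zero_smul]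
        · intro h'
          rw [Prod.mk.injEq] at h'
          exact h ⟨by rw [h'.1, Bool.not_not], h'.2⟩
  · simp
  · rcases int_trichotomy n with ⟨l, rfl⟩ | rfl | ⟨l, rfl⟩
    · rw [mode_neg, mode_neg, mode_pos, mode_pos, pderiv_mul, pderiv_X, Pi.single_apply]
      by_cases h : t = !s ∧ k = l
      · obtain ⟨rfl, rfl⟩ := h
        rw [if_pos rfl, if_pos ⟨rfl, by ring⟩]
        push_cast
        rw [smul_add, one_mul, ← mul_smul_comm]
        module
      · rw [if_neg, if_neg (by rintro ⟨h1, h2⟩; exact h ⟨h1, by omega⟩)]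
        · rw [zero_mul, zero_add, mul_smul_comm, sub_self, zero_smul]
        · intro h'
          rw [Prod.mk.injEq] at h'
          exact h ⟨h'.1, h'.2.symm⟩
    · simp only [mode_zero, LinearMap.zero_apply, map_zero, sub_zero]
      rw [if_neg (by omega), zero_smul]
    · rw [mode_pos, mode_pos, mode_pos, mode_pos, Derivation.map_smul, Derivation.map_smul, pderiv_comm,
        if_neg (by omega)]
      module

theorem exists_mode_eq_zero (s : Bool) (f : Space) : ∃ N : ℤ, ∀ n, N ≤ n → mode s n f = 0 := by
  obtain ⟨M, hM⟩ := (f.vars.image Prod.snd).bddAbove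
  refine ⟨M + 2, fun n hn => ?_⟩
  obtain ⟨k, rfl⟩ : ∃ k : ℕ, n = k + 1 := ⟨(n - 1).toNat, by omega⟩
  rw [mode_pos, pderiv_eq_zero_of_notMem_vars, smul_zero]
  intro h
  have := hM (Finset.mem_coe.2 (Finset.mem_image_of_mem Prod.snd h))
  simp only at this
  omega

/-- The field `∑ a_s(n) x^{-n-1}`. -/
def field (s : Bool) : VertexOperator ℂ Space :=
  VertexOperator.of_coeff (fun y => mode s (-y - 1)) fun f => by
    obtain ⟨N, hN⟩ := exists_mode_eq_zero s f
    refine ⟨-N, fun y hy => ?_⟩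
    by_contra h
    exact hy (hN _ (by omega))

theorem field_ncoeff (s : Bool) (n : ℤ) : (field s)[[n]] = mode s n := by
  rw [field, ncoeff_of_coeff]
  congr 1
  ring

theorem exists_mode_mode_eq_zero (s t : Bool) (f : Space) :
    ∃ N : ℤ, ∀ m n, N ≤ n → mode s m (mode t n f) = 0 := by
  obtain ⟨N, hN⟩ := exists_mode_eq_zero t f
  exact ⟨N, fun m n h => by rw [hN n h, map_zero]⟩

/-- The coefficient of `x^{-n-2}` in the normally ordered product of the two fields. -/
def normalOrd (n : ℤ) : Module.End ℂ Space :=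
  borcherds (field true) (field false) 0 (n + 1) (-1)

theorem normalOrd_apply (n : ℤ) (f : Space) :
    normalOrd n f = residueSum (-1) (fun i j => mode true i (mode false j f)) 0 (n + 1)
      + residueSum (-1) (fun i j => mode false i (mode true j f)) (n + 1) 0 := by
  rw [normalOrd, borcherds, LinearMap.sub_apply, LinearMap.smul_apply, orderedProd_apply,
    orderedProd_apply]
  simp only [field_ncoeff, zpow_neg_one]
  norm_num

theorem binomCoeff_neg_one (i : ℕ) : binomCoeff (-1) i = 1 := by
  induction i with
  | zero => simp
  | succ i ih =>
    have h := binomCoeff_succ_mul (-1) i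
    rw [ih] at h
    push_cast at h
    have h' : (i : ℂ) + 1 ≠ 0 := Nat.cast_add_one_ne_zero i
    refine mul_right_cancel₀ h' ?_
    rw [h]
    ring

theorem residueSum_neg_one {W : Type u} [AddCommGroup W] [Module ℂ W] (g : ℤ → ℤ → W) (p q : ℤ) :
    residueSum (-1) g p q = ∑ᶠ i : ℕ, g (p - 1 - i) (q + i) := by
  simp only [residueSum, binomCoeff_neg_one, one_smul]
  rfl

theorem map_normalOrd {W : Type} [AddCommGroup W] [Module ℂ W] (Λ : Space →ₗ[ℂ] W) (n : ℤ)
    (f : Space) :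
    Λ (normalOrd n f) = ∑ᶠ i : ℕ, Λ (mode true (0 - 1 - i) (mode false (n + 1 + i) f))
      + ∑ᶠ i : ℕ, Λ (mode false (n + 1 - 1 - i) (mode true (0 + i) f)) := by
  obtain ⟨N, hN⟩ := exists_mode_mode_eq_zero true false f
  obtain ⟨N', hN'⟩ := exists_mode_mode_eq_zero false true f
  rw [normalOrd_apply, map_add, ← residueSum_map _ Λ hN, ← residueSum_map _ Λ hN',
    residueSum_neg_one, residueSum_neg_one]

theorem normalOrd_comm_mode (n m : ℤ) (s : Bool) (f : Space) :
    normalOrd n (mode s m f) - mode s m (normalOrd n f) = (-m : ℂ) • mode s (n + m) f := by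
  obtain ⟨N₁, h₁⟩ := exists_mode_mode_eq_zero true false f
  obtain ⟨N₂, h₂⟩ := exists_mode_mode_eq_zero false true f
  obtain ⟨N₃, h₃⟩ := exists_mode_mode_eq_zero true false (mode s m f)
  obtain ⟨N₄, h₄⟩ := exists_mode_mode_eq_zero false true (mode s m f)
  rw [normalOrd_apply, normalOrd_apply, map_add, ← residueSum_map _ (mode s m) h₁,
    ← residueSum_map _ (mode s m) h₂, add_sub_add_comm,
    ← residueSum_sub (-1) (h := fun i j => mode s m (mode true i (mode false j f))) (N' := N₁) h₃
      (fun i j hj => by rw [h₁ i j hj, map_zero]),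
    ← residueSum_sub (-1) (h := fun i j => mode s m (mode false i (mode true j f))) (N' := N₂) h₄
      (fun i j hj => by rw [h₂ i j hj, map_zero]), residueSum_neg_one, residueSum_neg_one]
  have e : ∀ (a b : Bool) (i j : ℤ),
      mode a i (mode b j (mode s m f)) - mode s m (mode a i (mode b j f))
        = (if s = !b ∧ j + m = 0 then (j : ℂ) else 0) • mode a i f
          + (if s = !a ∧ i + m = 0 then (i : ℂ) else 0) • mode b j f := by
    intro a b i j
    rw [← mode_comm a s i m (mode b j f), ← map_smul, ← mode_comm b s j m f, map_sub]
    abel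
  simp only [e]
  cases s
  · simp only [Bool.not_false, Bool.not_true, true_and, false_and, if_false, zero_smul, add_zero,
      zero_add, Bool.false_eq_true]
    by_cases hm : 1 ≤ m
    · rw [finsum_eq_single _ (m - 1).toNat, finsum_eq_zero_of_forall_eq_zero, add_zero,
        if_pos (by omega)]
      · rw [show n + 1 + ((m - 1).toNat : ℤ) = n + m by omega,
          show 0 - 1 - ((m - 1).toNat : ℤ) = -m by omega]
        push_cast
        rfl
      · intro i
        rw [if_neg (by omega), zero_smul]
      · intro i hi
        rw [if_neg (by omega), zero_smul]
    · rw [finsum_eq_zero_of_forall_eq_zero, finsum_eq_single _ (-m).toNat, zero_add,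
        if_pos (by omega)]
      · rw [show n + 1 - 1 - ((-m).toNat : ℤ) = n + m by omega, show ((-m).toNat : ℤ) = -m by omega]
        push_cast
        rfl
      · intro i hi
        rw [if_neg (by omega), zero_smul]
      · intro i
        rw [if_neg (by omega), zero_smul]
  · simp only [Bool.not_false, Bool.not_true, true_and, false_and, if_false, zero_smul, add_zero,
      zero_add, Bool.true_eq_false]
    by_cases hm : n + 1 + m ≤ 0
    · rw [finsum_eq_single _ (-m - n - 1).toNat, finsum_eq_zero_of_forall_eq_zero, add_zero,
        if_pos (by omega)]
      · rw [show n + 1 + ((-m - n - 1).toNat : ℤ) = - m by omega,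
          show 0 - 1 - ((-m - n - 1).toNat : ℤ) = n + m by omega]
        push_cast
        rfl
      · intro i
        rw [if_neg (by omega), zero_smul]
      · intro i hi
        rw [if_neg (by omega), zero_smul]
    · rw [finsum_eq_zero_of_forall_eq_zero, finsum_eq_single _ (n + m).toNat, zero_add,
        if_pos (by omega)]
      · rw [show n + 1 - 1 - ((n + m).toNat : ℤ) = -m by omega,
          show ((n + m).toNat : ℤ) = n + m by omega]
        push_cast
        rfl
      · intro i hi
        rw [if_neg (by omega), zero_smul]
      · intro i
        rw [if_neg (by omega), zero_smul]

/-- The Virasoro operators on the Fock space, with background charges `lam`. -/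
def virL (lam : Bool → ℂ) (n : ℤ) : Module.End ℂ Space :=
  normalOrd n - ((n : ℂ) + 1) • ∑ s, lam s • mode s n

variable (lam : Bool → ℂ)

theorem virL_apply (n : ℤ) (f : Space) :
    virL lam n f = normalOrd n f - ((n : ℂ) + 1) • ∑ s, lam s • mode s n f := by
  simp [virL]

theorem virL_comm_mode (n m : ℤ) (s : Bool) (f : Space) :
    virL lam n (mode s m f) = mode s m (virL lam n f) + ((-m : ℂ) • mode s (n + m) f
      - (if n + m = 0 then lam (!s) * n * (n + 1) else 0) • f) := by
  rw [virL_apply, virL_apply, ← normalOrd_comm_mode, map_sub, map_smul, map_sum]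
  have e : ∑ t, lam t • mode t n (mode s m f) - ∑ t, mode s m (lam t • mode t n f)
      = (if n + m = 0 then lam (!s) * n else 0) • f := by
    rw [← Finset.sum_sub_distrib]
    simp only [map_smul, ← smul_sub, mode_comm]
    cases s <;> simp [ite_smul, smul_smul]
  rw [sub_eq_iff_eq_add.1 e]
  split_ifs <;> module

theorem virL_one {n : ℤ} (hn : -1 ≤ n) : virL lam n 1 = 0 := by
  have h : ∀ (s : Bool) (m : ℤ), 0 ≤ m → mode s m (1 : Space) = 0 := by
    intro s m hm
    rcases hm.eq_or_lt with rfl | hm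
    · simp
    · obtain ⟨k, rfl⟩ : ∃ k : ℕ, m = k + 1 := ⟨(m - 1).toNat, by omega⟩
      rw [mode_pos, pderiv_one, smul_zero]
  have h0 := map_normalOrd LinearMap.id n 1
  simp only [LinearMap.id_apply] at h0
  rw [virL_apply, h0, finsum_eq_zero_of_forall_eq_zero, finsum_eq_zero_of_forall_eq_zero, zero_add]
  · rcases hn.eq_or_lt with rfl | hn
    · simp
    · simp [h _ n (by omega)]
  · intro i
    rw [h true _ (by omega), map_zero]
  · intro i
    rw [h false _ (by omega), map_zero]

end Fock

namespace Fock

open MvPolynomial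

variable (lam : Bool → ℂ)

/-- The central charge of the Fock space with background charges `lam`. -/
def centralCharge : ℂ := 2 - 24 * (lam true * lam false)

/-- The defect of the Virasoro relation between `L(m)` and `L(n)` on the Fock space. -/
def defect (m n : ℤ) : Module.End ℂ Space :=
  virL lam m * virL lam n - virL lam n * virL lam m - ((m : ℂ) - n) • virL lam (m + n)
    - (if m + n = 0 then ((m : ℂ) ^ 3 - m) / 12 * centralCharge lam else 0) • 1

theorem defect_apply (m n : ℤ) (f : Space) :
    defect lam m n f = virL lam m (virL lam n f) - virL lam n (virL lam m f)
      - ((m : ℂ) - n) • virL lam (m + n) f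
      - (if m + n = 0 then ((m : ℂ) ^ 3 - m) / 12 * centralCharge lam else 0) • f := rfl

theorem defect_mode (m n k : ℤ) (s : Bool) (f : Space) :
    defect lam m n (mode s k f) = mode s k (defect lam m n f) := by
  simp only [defect_apply, virL_comm_mode, map_add, map_sub, map_smul]
  rw [show m + (n + k) = m + n + k by ring, show n + (m + k) = m + n + k by ring]
  generalize virL lam m (virL lam n f) = A
  generalize virL lam n (virL lam m f) = B
  generalize virL lam (m + n) f = C
  by_cases h : m + n + k = 0
  · obtain rfl : k = -(m + n) := by omega
    simp only [h, if_true]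
    push_cast
    module
  · simp only [h, if_false]
    push_cast
    module

theorem constantCoeff_mode_of_nonpos (s : Bool) {m : ℤ} (hm : m ≤ 0) (f : Space) :
    constantCoeff (mode s m f) = 0 := by
  rcases int_trichotomy m with ⟨k, rfl⟩ | rfl | ⟨k, rfl⟩
  · rw [mode_neg, map_mul, constantCoeff_X, zero_mul]
  · simp
  · omega

theorem mode_one (s : Bool) {m : ℤ} (hm : 0 ≤ m) : mode s m 1 = 0 := by
  rcases hm.eq_or_lt with rfl | hm
  · simp
  · obtain ⟨k, rfl⟩ : ∃ k : ℕ, m = k + 1 := ⟨(m - 1).toNat, by omega⟩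
    rw [mode_pos, pderiv_one, smul_zero]

theorem constantCoeff_mode_one (s : Bool) (m : ℤ) : constantCoeff (mode s m 1) = 0 := by
  rcases le_total m 0 with h | h
  · exact constantCoeff_mode_of_nonpos s h 1
  · rw [mode_one s h, map_zero]

theorem constantCoeff_mode_mode_one (i j : ℤ) :
    constantCoeff (mode true i (mode false j 1)) = if i + j = 0 ∧ 0 < i then (i : ℂ) else 0 := by
  rcases le_or_gt 0 j with hj | hj
  · rw [mode_one _ hj, map_zero, map_zero, if_neg (by omega)]
  · have h := mode_comm true false i j 1
    rw [sub_eq_iff_eq_add] at h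
    rw [h, map_add, constantCoeff_mode_of_nonpos _ hj.le, add_zero, constantCoeff_smul, map_one]
    by_cases hij : i + j = 0
    · rw [if_pos ⟨rfl, hij⟩, if_pos ⟨hij, by omega⟩, smul_eq_mul, mul_one]
    · rw [if_neg (fun h => hij h.2), if_neg (fun h => hij h.1), zero_smul]

/-- The constant coefficient, as a linear form. -/
def constLinear : Space →ₗ[ℂ] ℂ where
  toFun f := constantCoeff f
  map_add' := map_add constantCoeff
  map_smul' a f := constantCoeff_smul a f

theorem constLinear_apply (f : Space) : constLinear f = constantCoeff f := rfl

theorem constantCoeff_virL_of_nonpos {m : ℤ} (hm : m ≤ 0) (f : Space) :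
    constantCoeff (virL lam m f) = 0 := by
  rw [← constLinear_apply, virL_apply, map_sub, map_normalOrd, map_smul, map_sum, finsum_eq_zero_of_forall_eq_zero,
    finsum_eq_zero_of_forall_eq_zero, Finset.sum_eq_zero]
  · simp
  · intro s _
    rw [map_smul]
    exact (congrArg _ (constantCoeff_mode_of_nonpos s hm f)).trans (smul_zero _)
  · intro i
    exact constantCoeff_mode_of_nonpos _ (by omega) _
  · intro i
    exact constantCoeff_mode_of_nonpos _ (by omega) _

theorem sum_range_mul_sub (K : ℕ) (x : ℂ) :
    ∑ i ∈ Finset.range K, ((1 : ℂ) + i) * (x - i)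
      = K * x + (x - 1) * (K * (K - 1)) / 2 - (K - 1) * K * (2 * K - 1) / 6 := by
  induction K with
  | zero => simp
  | succ K ih =>
    rw [Finset.sum_range_succ, ih]
    push_cast
    ring

theorem constantCoeff_virL_mode_one {m n : ℤ} (hn : n ≤ -2) (s : Bool) :
    constantCoeff (virL lam m (mode s n 1))
      = -(if m + n = 0 then lam (!s) * m * (m + 1) else 0) := by
  rw [virL_comm_mode, map_add, constantCoeff_mode_of_nonpos _ (by omega), zero_add, map_sub,
    constantCoeff_smul, constantCoeff_mode_one, smul_zero, zero_sub, constantCoeff_smul, map_one,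
    smul_eq_mul, mul_one]

/-- The vacuum expectation of `L(m) L(n)`, which determines the central charge. The normally ordered
product contributes `(m^3 - m) / 6`, the background charges the rest. -/
theorem constantCoeff_virL_virL_one {m n : ℤ} (hm : 1 ≤ m) (hn : n ≤ -2) :
    constantCoeff (virL lam m (virL lam n 1))
      = if m + n = 0 then ((m : ℂ) ^ 3 - m) / 12 * centralCharge lam else 0 := by
  obtain ⟨M, rfl⟩ : ∃ M : ℕ, m = M + 1 := ⟨(m - 1).toNat, by omega⟩
  set Λ : Space →ₗ[ℂ] ℂ := constLinear ∘ₗ virL lam (M + 1)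
  have hΛ : ∀ f, Λ f = constantCoeff (virL lam (M + 1) f) := fun _ => rfl
  rw [← hΛ, virL_apply lam n, map_sub, map_normalOrd, map_smul, map_sum]
  have h1 : ∀ i : ℕ, Λ (mode true (0 - 1 - i) (mode false (n + 1 + i) 1))
      = (1 + i) * if M + 1 + n = 0 ∧ i < M then ((M : ℂ) - i) else 0 := by
    intro i
    rw [hΛ, virL_comm_mode, map_add, constantCoeff_mode_of_nonpos _ (by omega), zero_add, map_sub,
      constantCoeff_smul, constantCoeff_smul, constantCoeff_mode_one, smul_zero, sub_zero,
      constantCoeff_mode_mode_one, smul_eq_mul]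
    have e : ((M : ℤ) + 1 + (0 - 1 - i) + (n + 1 + i) = 0 ∧ 0 < (M : ℤ) + 1 + (0 - 1 - i))
        ↔ ((M : ℤ) + 1 + n = 0 ∧ i < M) := by omega
    simp only [e]
    push_cast
    congr 1
    · ring
    · congr 1
      ring
  have h2 : ∀ i : ℕ, Λ (mode false (n + 1 - 1 - i) (mode true (0 + i) 1)) = 0 := by
    intro i
    rw [mode_one _ (by omega), map_zero, map_zero]
  have h3 : ∀ s, Λ (lam s • mode s n 1)
      = lam s * -(if (M + 1 : ℤ) + n = 0 then lam (!s) * (M + 1) * (M + 1 + 1) else 0) := by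
    intro s
    rw [map_smul, smul_eq_mul]
    have := constantCoeff_virL_mode_one lam (m := M + 1) hn s
    push_cast at this
    exact congrArg _ this
  simp only [h1, h2, h3, finsum_zero, Fintype.sum_bool]
  by_cases h : (M + 1 : ℤ) + n = 0
  · have hn' : (n : ℂ) = -(M + 1) := by
      have : n = -((M : ℤ) + 1) := by omega
      rw [this]; push_cast; ring
    have h4 : ∑ᶠ i : ℕ, ((1 : ℂ) + i) * (if i < M then ((M : ℂ) - i) else 0)
        = ∑ i ∈ Finset.range M, ((1 : ℂ) + i) * (M - i) := by
      rw [finsum_eq_sum_of_support_subset (s := Finset.range M)]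
      · exact Finset.sum_congr rfl fun i hi => by rw [if_pos (Finset.mem_range.1 hi)]
      · intro i hi
        by_contra h'
        exact hi (by
          beta_reduce
          rw [if_neg (by simpa using h'), mul_zero])
    simp only [h, true_and, if_true, h4, sum_range_mul_sub, Bool.not_true, Bool.not_false,
      centralCharge, hn']
    push_cast
    simp only [smul_eq_mul]
    ring
  · simp [h]

theorem constantCoeff_defect_one (m n : ℤ) : constantCoeff (defect lam m n 1) = 0 := by
  have h0 : constantCoeff (virL lam (m + n) 1) = 0 := by
    rcases le_total (m + n) 0 with h | h
    · exact constantCoeff_virL_of_nonpos lam h 1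
    · rw [virL_one lam (by omega), map_zero]
  rw [defect_apply, map_sub, map_sub, map_sub, constantCoeff_smul, h0, smul_zero, sub_zero,
    constantCoeff_smul, map_one constantCoeff, smul_eq_mul, mul_one, sub_eq_zero]
  rcases le_or_gt (-1) n with hn | hn
  · rw [virL_one lam hn, map_zero, map_zero, zero_sub]
    rcases le_or_gt (-1) m with hm | hm
    · rw [virL_one lam hm, map_zero, map_zero, neg_zero]
      split_ifs with h
      · have hm' : m ≤ 1 := by omega
        interval_cases m <;> norm_num
      · rfl
    · rcases le_or_gt n 0 with hn' | hn'
      · rw [constantCoeff_virL_of_nonpos lam hn', if_neg (by omega), neg_zero]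
      · rw [constantCoeff_virL_virL_one lam hn' (by omega), add_comm n m]
        split_ifs with h
        · have : (n : ℂ) = -m := by
            have : n = -m := by omega
            rw [this]; push_cast; rfl
          rw [this]
          ring
        · simp
  · rw [constantCoeff_virL_of_nonpos lam (m := n) (by omega), sub_zero]
    rcases le_or_gt m 0 with hm | hm
    · rw [constantCoeff_virL_of_nonpos lam hm, if_neg (by omega)]
    · exact constantCoeff_virL_virL_one lam hm (by omega)

theorem eq_zero_of_pderiv_eq_zero {f : Space} (h : ∀ i, pderiv i f = 0)
    (h0 : constantCoeff f = 0) : f = 0 := by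
  ext m
  rcases eq_or_ne m 0 with rfl | hm
  · exact h0
  · obtain ⟨i, hi⟩ := Finsupp.ne_iff.1 hm
    have hle : Finsupp.single i 1 ≤ m := by
      rw [Finsupp.single_le_iff]
      exact Nat.one_le_iff_ne_zero.2 hi
    have := coeff_pderiv (i := i) f (m - Finsupp.single i 1)
    rw [h i, coeff_zero, tsub_add_cancel_of_le hle, eq_comm, mul_eq_zero] at this
    exact this.resolve_right (Nat.cast_add_one_ne_zero _)

/-- The Virasoro relations hold on the Fock space: the defect commutes with all modes, so that the
image of the vacuum is a constant, which vanishes, and then it is zero throughout. -/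
theorem defect_eq_zero (m n : ℤ) : defect lam m n = 0 := by
  have h1 : defect lam m n 1 = 0 := by
    refine eq_zero_of_pderiv_eq_zero ?_ (constantCoeff_defect_one lam m n)
    rintro ⟨s, k⟩
    have h := defect_mode lam m n (k + 1) (!s) 1
    rw [mode_one _ (by omega), map_zero, mode_pos, Bool.not_not, eq_comm] at h
    exact (smul_eq_zero.1 h).resolve_left (Nat.cast_add_one_ne_zero k)
  refine LinearMap.ext fun f => ?_
  rw [LinearMap.zero_apply]
  induction f using MvPolynomial.induction_on with
  | C a => rw [← mul_one (C a), ← smul_eq_C_mul, map_smul, h1, smul_zero]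
  | add f g hf hg => rw [map_add, hf, hg, add_zero]
  | mul_X f i hf =>
    obtain ⟨s, k⟩ := i
    rw [mul_comm, ← mode_neg, defect_mode, hf, map_zero]

theorem virL_comm (m n : ℤ) (f : Space) :
    virL lam m (virL lam n f) - virL lam n (virL lam m f) = ((m : ℂ) - n) • virL lam (m + n) f
      + (if m + n = 0 then ((m : ℂ) ^ 3 - m) / 12 * centralCharge lam else 0) • f := by
  have h := defect_apply lam m n f
  rw [defect_eq_zero, LinearMap.zero_apply, eq_comm, sub_eq_zero, sub_eq_iff_eq_add'] at h
  exact h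

theorem exists_centralCharge_eq (ℓ : ℂ) : ∃ lam, centralCharge lam = ℓ :=
  ⟨fun s => if s then (2 - ℓ) / 24 else 1, by simp [centralCharge]; ring⟩

end Fock

/-! ### Linear maps out of the vacuum module -/

namespace Virasoro

section

attribute [local instance 100] LieRing.ofAssociativeRing

/-- Operators that obey the Virasoro relations with `c` acting as `ℓ` form a representation of the
Virasoro algebra. -/
def representation {W : Type u} [AddCommGroup W] [Module ℂ W] (ℓ : ℂ)
    (T : ℤ → Module.End ℂ W)
    (hT : ∀ m n w, T m (T n w) - T n (T m w) = ((m : ℂ) - n) • T (m + n) w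
      + (if m + n = 0 then ((m : ℂ) ^ 3 - m) / 12 * ℓ else 0) • w) :
    Virasoro →ₗ⁅ℂ⁆ Module.End ℂ W where
  toFun x := Finsupp.linearCombination ℂ T x.wittPart + (x.central * ℓ) • 1
  map_add' x y := by
    simp only [wittPart_add, central_add, map_add]
    module
  map_smul' a x := by
    simp only [wittPart_smul, central_smul, map_smul, RingHom.id_apply, smul_eq_mul]
    module
  map_lie' := by
    rintro ⟨x, a⟩ ⟨y, b⟩
    simp only [wittPart_lie, central_lie, LieRing.of_associative_ring_bracket]
    have key : Finsupp.linearCombination ℂ T (wittBracket x y) + (cocycle x y * ℓ) • 1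
        = Finsupp.linearCombination ℂ T x * Finsupp.linearCombination ℂ T y
          - Finsupp.linearCombination ℂ T y * Finsupp.linearCombination ℂ T x := by
      induction x using Finsupp.induction_linear with
      | zero => simp
      | add x x' hx hx' =>
        simp only [map_add, LinearMap.add_apply, add_mul, mul_add, add_smul]
        rw [add_add_add_comm, hx, hx']
        abel
      | single m p =>
        induction y using Finsupp.induction_linear with
        | zero => simp
        | add y y' hy hy' =>
          simp only [map_add, add_mul, mul_add, add_smul]
          rw [add_add_add_comm, hy, hy']
          abel
        | single n q =>
          refine LinearMap.ext fun w => ?_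
          simp only [wittBracket_single, cocycle_single, Finsupp.linearCombination_single,
            LinearMap.add_apply, LinearMap.sub_apply, LinearMap.smul_apply, Module.End.mul_apply,
            Module.End.one_apply, map_smul]
          rw [smul_comm q p, ← smul_sub, ← smul_sub, hT]
          split_ifs <;> module
    rw [key]
    simp only [add_mul, mul_add, smul_mul_assoc, mul_smul_comm, one_mul, mul_one]
    module

end

/-- A vector of a representation that behaves like the vacuum receives a map from the vacuum
module. -/
theorem VacuumModule.exists_lift {W : Type u} [AddCommGroup W] [Module ℂ W] (ℓ : ℂ)
    (T : ℤ → Module.End ℂ W)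
    (hT : ∀ m n w, T m (T n w) - T n (T m w) = ((m : ℂ) - n) • T (m + n) w
      + (if m + n = 0 then ((m : ℂ) ^ 3 - m) / 12 * ℓ else 0) • w)
    (w : W) (hw : ∀ n, -1 ≤ n → T n w = 0) :
    ∃ θ : VacuumModule ℓ →ₗ[ℂ] W, θ (vac ℓ) = w ∧ ∀ n v, θ (opL ℓ n v) = T n (θ v) := by
  let ρ : Env →ₐ[ℂ] Module.End ℂ W :=
    UniversalEnvelopingAlgebra.lift ℂ (representation ℓ T hT)
  have hL : ∀ n, ρ (toEnv (L n)) = T n := fun n => by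
    simp only [ρ, toEnv, UniversalEnvelopingAlgebra.lift_ι_apply]
    simp [representation, L]
  have hc : ρ (toEnv c) = ℓ • 1 := by
    simp only [ρ, toEnv, UniversalEnvelopingAlgebra.lift_ι_apply]
    simp [representation, c]
  let _ : Module Env W := Module.compHom W ρ.toRingHom
  have hsmul : ∀ (x : Env) (w : W), x • w = ρ x w := fun _ _ => rfl
  obtain ⟨f, hf, -⟩ := existsUnique_lift ℓ w (fun n hn => by rw [hsmul, hL, hw n hn])
    (by rw [hsmul, hsmul, hc, AlgHom.commutes]; rfl)
  refine ⟨{ toFun := f, map_add' := map_add f, map_smul' := fun a v => ?_ }, hf, fun n v => ?_⟩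
  · rw [← algebraMap_smul Env a v, map_smul, hsmul, AlgHom.commutes]
    rfl
  · change f (toEnv (L n) • v) = _
    rw [map_smul, hsmul, hL]
    rfl

end Virasoro

namespace VertexField

theorem mem_of_mkQ_eq_zero {V : Type u} [AddCommGroup V] [Module ℂ V] {P : Submodule ℂ V} {v : V}
    (h : P.mkQ v = 0) : v ∈ P := by
  rwa [Submodule.mkQ_apply, Submodule.Quotient.mk_eq_zero] at h

theorem mkQ_eq_zero_of_mem {V : Type u} [AddCommGroup V] [Module ℂ V] {P : Submodule ℂ V} {v : V}
    (h : v ∈ P) : P.mkQ v = 0 := by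
  rwa [Submodule.mkQ_apply, Submodule.Quotient.mk_eq_zero]

end VertexField

namespace Fock

open MvPolynomial

/-! ### Degrees and leading terms on the Fock space -/

/-- The polynomials of total degree at most `d`. -/
abbrev degLE (d : ℕ) : Submodule ℂ Space := restrictTotalDegree (Bool × ℕ) ℂ d

theorem degLE_mono {d e : ℕ} (h : d ≤ e) : degLE d ≤ degLE e := fun f hf => by
  rw [mem_restrictTotalDegree] at hf ⊢
  exact hf.trans h

theorem totalDegree_pderiv_le (i : Bool × ℕ) (f : Space) :
    (pderiv i f).totalDegree ≤ f.totalDegree := by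
  refine Finset.sup_le fun m hm => ?_
  have h : m + Finsupp.single i 1 ∈ f.support := by
    rw [mem_support_iff, coeff_pderiv] at hm
    exact mem_support_iff.2 (left_ne_zero_of_mul hm)
  refine le_trans ?_ (le_totalDegree h)
  rw [Finsupp.sum_add_index' (by simp) (by simp)]
  exact Nat.le_add_right _ _

theorem mode_mem_of_nonneg (s : Bool) {m : ℤ} (hm : 0 ≤ m) {d : ℕ} {f : Space} (hf : f ∈ degLE d) :
    mode s m f ∈ degLE d := by
  rcases hm.eq_or_lt with rfl | hm
  · simp
  · obtain ⟨k, rfl⟩ : ∃ k : ℕ, m = k + 1 := ⟨(m - 1).toNat, by omega⟩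
    rw [mode_pos]
    refine Submodule.smul_mem _ _ ?_
    rw [mem_restrictTotalDegree] at hf ⊢
    exact (totalDegree_pderiv_le _ _).trans hf

theorem mode_mem (s : Bool) (m : ℤ) {d : ℕ} {f : Space} (hf : f ∈ degLE d) :
    mode s m f ∈ degLE (d + 1) := by
  rcases lt_or_ge m 0 with hm | hm
  · obtain ⟨k, rfl⟩ : ∃ k : ℕ, m = -k - 1 := ⟨(-m - 1).toNat, by omega⟩
    rw [mode_neg, mem_restrictTotalDegree]
    rw [mem_restrictTotalDegree] at hf
    refine (totalDegree_mul _ _).trans ?_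
    rw [totalDegree_X]
    omega
  · exact degLE_mono (Nat.le_succ d) (mode_mem_of_nonneg s hm hf)

variable (lam : Bool → ℂ)

theorem sum_mode_mem (n : ℤ) {d : ℕ} {f : Space} (hf : f ∈ degLE d) :
    ((n : ℂ) + 1) • ∑ s, lam s • mode s n f ∈ degLE (d + 1) :=
  Submodule.smul_mem _ _ (Submodule.sum_mem _ fun s _ => Submodule.smul_mem _ _ (mode_mem s n hf))

theorem virL_mem (n : ℤ) {d : ℕ} {f : Space} (hf : f ∈ degLE d) :
    virL lam n f ∈ degLE (d + 2) := by
  rw [virL_apply]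
  refine Submodule.sub_mem _ ?_ (degLE_mono (Nat.le_succ _) (sum_mode_mem lam n hf))
  refine mem_of_mkQ_eq_zero ?_
  rw [map_normalOrd, finsum_eq_zero_of_forall_eq_zero, finsum_eq_zero_of_forall_eq_zero, add_zero]
  · exact fun i => mkQ_eq_zero_of_mem (mode_mem _ _ (mode_mem _ _ hf))
  · exact fun i => mkQ_eq_zero_of_mem (mode_mem _ _ (mode_mem _ _ hf))

/-- The point at which leading terms are evaluated: one boson is `∑ p k x^k`, the other one is
`1`, so that their product is `∑ p k x^k`. -/
def point (p : ℕ → ℂ) : Bool × ℕ → ℂ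
  | (true, k) => p k
  | (false, 0) => 1
  | (false, _ + 1) => 0

/-- The value at `point p` of the homogeneous component of degree `d`. -/
def leadingValue (p : ℕ → ℂ) (d : ℕ) : Space →ₗ[ℂ] ℂ :=
  Polynomial.lcoeff ℂ d ∘ₗ
    (aeval (R := ℂ) fun i => (Polynomial.C (point p i) * Polynomial.X : Polynomial ℂ)).toLinearMap

theorem leadingValue_apply (p : ℕ → ℂ) (d : ℕ) (f : Space) :
    leadingValue p d f = (aeval (R := ℂ)
      (fun i => (Polynomial.C (point p i) * Polynomial.X : Polynomial ℂ)) f).coeff d := rfl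

theorem leadingValue_mode_neg (p : ℕ → ℂ) (d : ℕ) (s : Bool) (k : ℕ) (f : Space) :
    leadingValue p (d + 1) (mode s (-k - 1) f) = point p (s, k) * leadingValue p d f := by
  rw [mode_neg, leadingValue_apply, map_mul, aeval_X, mul_assoc, Polynomial.coeff_C_mul,
    Polynomial.coeff_X_mul, leadingValue_apply]

theorem leadingValue_eq_zero (p : ℕ → ℂ) {d e : ℕ} (h : d < e) {f : Space} (hf : f ∈ degLE d) :
    leadingValue p e f = 0 := by
  rw [mem_restrictTotalDegree] at hf
  rw [leadingValue_apply]
  refine Polynomial.coeff_eq_zero_of_natDegree_lt (lt_of_le_of_lt ?_ h)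
  rw [aeval_def, eval₂_eq]
  refine Polynomial.natDegree_sum_le_of_forall_le _ _ fun m hm => ?_
  refine le_trans ?_ ((le_totalDegree hm).trans hf)
  rw [Polynomial.algebraMap_eq]
  refine (Polynomial.natDegree_C_mul_le _ _).trans ((Polynomial.natDegree_prod_le _ _).trans ?_)
  refine Finset.sum_le_sum fun i _ => ?_
  refine Polynomial.natDegree_pow_le.trans ?_
  exact (Nat.mul_le_mul_left _ ((Polynomial.natDegree_C_mul_le _ _).trans
    Polynomial.natDegree_X_le)).trans (by simp)

/-- The leading term of `L(-k-2)` is multiplication by the coefficient of `x^k` in the product of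
the two bosons. -/
theorem leadingValue_virL (p : ℕ → ℂ) (k : ℕ) {d : ℕ} {f : Space} (hf : f ∈ degLE d) :
    leadingValue p (d + 2) (virL lam (-k - 2) f) = p k * leadingValue p d f := by
  rw [virL_apply, map_sub, leadingValue_eq_zero p (Nat.lt_succ_self _) (sum_mode_mem lam _ hf),
    sub_zero, map_normalOrd, finsum_eq_single _ k, finsum_eq_zero_of_forall_eq_zero, add_zero]
  · rw [show (0 : ℤ) - 1 - k = -k - 1 by ring,
      show (-k : ℤ) - 2 + 1 + k = -(0 : ℕ) - 1 by push_cast; ring, leadingValue_mode_neg,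
      leadingValue_mode_neg]
    simp [point]
  · intro i
    exact leadingValue_eq_zero p (Nat.lt_succ_self _)
      (mode_mem _ _ (mode_mem_of_nonneg _ (by omega) hf))
  · intro i hi
    rcases lt_or_gt_of_ne hi with hi | hi
    · obtain ⟨j, rfl⟩ : ∃ j : ℕ, k = i + j + 1 := ⟨k - i - 1, by omega⟩
      rw [show (0 : ℤ) - 1 - i = -i - 1 by ring,
        show (-(i + j + 1 : ℕ) : ℤ) - 2 + 1 + i = -(j + 1 : ℕ) - 1 by push_cast; ring,
        leadingValue_mode_neg, leadingValue_mode_neg]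
      simp [point]
    · exact leadingValue_eq_zero p (Nat.lt_succ_self _)
        (mode_mem _ _ (mode_mem_of_nonneg _ (by omega) hf))

end Fock

/-! ### Symbols on the vacuum module -/

namespace Virasoro

namespace VacuumModule

open Fock

variable {ℓ : ℂ}

/-- The linear forms `σ m` factor through the `m`-th graded piece of the filtration, where they are
evaluation at `p`, if `L(-k₁-2) ⋯ L(-k_m-2) 𝟏` is read as the polynomial `X_{k₁} ⋯ X_{k_m}`. -/
structure IsSymbol (p : ℕ → ℂ) (σ : ℕ → VacuumModule ℓ →ₗ[ℂ] ℂ) : Prop where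
  vac : σ 0 (vac ℓ) = 1
  eq_zero : ∀ {m n : ℕ} {v : VacuumModule ℓ}, v ∈ filtration ℓ m → m < n → σ n v = 0
  opL : ∀ {m : ℕ} (k : ℕ) {v : VacuumModule ℓ}, v ∈ filtration ℓ m →
    σ (m + 1) (opL ℓ (-k - 2) v) = p k * σ m v

variable (ℓ) in
/-- That such forms exist for all `p` is the part of the Poincaré-Birkhoff-Witt theorem which is
needed here. They are obtained from the map to the Fock space. -/
theorem exists_isSymbol (p : ℕ → ℂ) : ∃ σ : ℕ → VacuumModule ℓ →ₗ[ℂ] ℂ, IsSymbol p σ := by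
  obtain ⟨lam, rfl⟩ := exists_centralCharge_eq ℓ
  obtain ⟨θ, hvac, hθ⟩ := exists_lift (centralCharge lam) (virL lam) (virL_comm lam) 1
    fun n hn => virL_one lam hn
  have hmem : ∀ {m : ℕ} {v}, v ∈ filtration (centralCharge lam) m → θ v ∈ degLE (2 * m) := by
    intro m v hv
    induction hv using Submodule.span_induction with
    | mem v hv =>
      obtain ⟨s, hs, rfl⟩ := hv
      refine degLE_mono (Nat.mul_le_mul_left 2 hs) ?_
      clear hs
      induction s using multiset_induction_max with
      | zero => simp [hvac, MvPolynomial.mem_restrictTotalDegree]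
      | cons k t ht ih =>
        rw [monomial_cons _ ht, hθ, Multiset.card_cons]
        exact virL_mem lam _ ih
    | zero => rw [map_zero]; exact zero_mem _
    | add v w _ _ hv hw => rw [map_add]; exact add_mem hv hw
    | smul a v _ hv => rw [map_smul]; exact Submodule.smul_mem _ _ hv
  refine ⟨fun m => leadingValue p (2 * m) ∘ₗ θ, ?_, ?_, ?_⟩
  · rw [LinearMap.comp_apply, hvac, leadingValue_apply, map_one]
    simp
  · intro m n v hv h
    exact leadingValue_eq_zero p (by omega) (hmem hv)
  · intro m k v hv
    rw [LinearMap.comp_apply, hθ]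
    exact leadingValue_virL lam p k (hmem hv)

end VacuumModule

/-! ### Symbols of vertex operators -/

theorem map_nthProd_ncoeff {V W : Type u} [AddCommGroup V] [Module ℂ V] [AddCommGroup W]
    [Module ℂ W] (Λ : V →ₗ[ℂ] W) (A B : VertexOperator ℂ V) (q r : ℤ) (w : V) :
    Λ (((nthProd A B r)[[q]]) w)
      = residueSum r (fun m n => Λ ((A[[m]]) ((B[[n]]) w))) 0 q
        - (-1 : ℂ) ^ r • residueSum r (fun m n => Λ ((B[[m]]) ((A[[n]]) w))) q 0 := by
  obtain ⟨N, hN⟩ := exists_comp_eq_zero A B w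
  obtain ⟨N', hN'⟩ := exists_comp_eq_zero B A w
  rw [nthProd_ncoeff, residueSum_map r Λ hN, residueSum_map r Λ hN', borcherds,
    LinearMap.sub_apply, LinearMap.smul_apply, map_sub, map_smul]
  rfl

theorem residueSum_eq_zero {W : Type u} [AddCommGroup W] [Module ℂ W] (r : ℤ) {g : ℤ → ℤ → W}
    {p q : ℤ} (h : ∀ m n, q ≤ n → g m n = 0) : residueSum r g p q = 0 :=
  finsum_eq_zero_of_forall_eq_zero fun i => by rw [h _ _ (by omega), smul_zero]

theorem binomCoeff_neg (k i : ℕ) : binomCoeff (-k - 1) i = (k + i).choose i := by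
  induction i with
  | zero => simp
  | succ i ih =>
    have h := binomCoeff_succ_mul (-k - 1) i
    have h' : ((k + i + 1 : ℕ) : ℂ) * (k + i).choose i = (k + (i + 1)).choose (i + 1) * (i + 1) := by
      exact_mod_cast Nat.add_one_mul_choose_eq (k + i) i
    rw [ih] at h
    refine mul_right_cancel₀ (Nat.cast_add_one_ne_zero i) (h.trans ?_)
    rw [← h']
    push_cast
    ring

open VacuumModule

variable {ℓ : ℂ} {A : VertexAlgebraStructure (VacuumModule ℓ)}

/-- The product `∏ p^{(k)} / k!` over `k ∈ s`. -/
def jet (p : Polynomial ℂ) (s : Multiset ℕ) : Polynomial ℂ :=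
  (s.map fun k => Polynomial.hasseDeriv k p).prod

theorem jet_cons (p : Polynomial ℂ) (k : ℕ) (s : Multiset ℕ) :
    jet p (k ::ₘ s) = Polynomial.hasseDeriv k p * jet p s := by
  rw [jet, Multiset.map_cons, Multiset.prod_cons, jet]

theorem IsVacuumVertexAlgebra.Y_monomial_cons (hA : IsVacuumVertexAlgebra ℓ A) {k : ℕ}
    {t : Multiset ℕ} (ht : ∀ j ∈ t, j ≤ k) :
    A.Y (monomial ℓ (k ::ₘ t)) = nthProd (virField ℓ) (A.Y (monomial ℓ t)) (-k - 1) := by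
  rw [monomial_cons ℓ ht, hA.Y_opL]
  congr 1
  ring

theorem IsVacuumVertexAlgebra.Y_monomial_zero (hA : IsVacuumVertexAlgebra ℓ A) :
    A.Y (monomial ℓ 0) = idField _ := by
  rw [monomial_zero, ← hA.vac_eq, A.Y_vac]

theorem virField_mem_filtration (n : ℤ) {b : ℕ} {w : VacuumModule ℓ} (hw : w ∈ filtration ℓ b) :
    ((virField ℓ)[[n]]) w ∈ filtration ℓ (b + 1) := by
  rw [virField_ncoeff]
  exact opL_mem_filtration_succ _ hw

theorem virField_mem_filtration_of_nonneg {n : ℤ} (hn : 0 ≤ n) {b : ℕ} {w : VacuumModule ℓ}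
    (hw : w ∈ filtration ℓ b) : ((virField ℓ)[[n]]) w ∈ filtration ℓ b := by
  rw [virField_ncoeff]
  exact opL_mem_filtration (by omega) hw

theorem IsVacuumVertexAlgebra.ncoeff_mem_filtration (hA : IsVacuumVertexAlgebra ℓ A)
    (s : Multiset ℕ) (q : ℤ) {b : ℕ} {w : VacuumModule ℓ} (hw : w ∈ filtration ℓ b) :
    ((A.Y (monomial ℓ s))[[q]]) w ∈ filtration ℓ (b + Multiset.card s) := by
  induction s using multiset_induction_max generalizing q b w with
  | zero =>
    rw [hA.Y_monomial_zero, idField_ncoeff]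
    split_ifs
    · simpa using hw
    · exact zero_mem _
  | cons k t ht ih =>
    refine mem_of_mkQ_eq_zero ?_
    rw [hA.Y_monomial_cons ht, map_nthProd_ncoeff, residueSum_eq_zero, residueSum_eq_zero,
      smul_zero, sub_zero]
    · intro m n hn
      refine mkQ_eq_zero_of_mem (filtration_mono ?_
        (ih m (virField_mem_filtration_of_nonneg hn hw)))
      simp
    · intro m n _
      refine mkQ_eq_zero_of_mem ?_
      rw [Multiset.card_cons, ← add_assoc]
      exact virField_mem_filtration m (ih n hw)

/-- The symbol of `Y(u, x)` is multiplication by the symbol of `u`, evaluated on the derivatives of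
`p`. Indeed `Y(L(-k-2)v, x)` is the normally ordered product of the `k`-th divided derivative of
`L(x)` with `Y(v, x)`, and of `L(x)` only the nonnegative powers of `x` raise the degree. -/
theorem IsVacuumVertexAlgebra.symbol_ncoeff (hA : IsVacuumVertexAlgebra ℓ A) {p : Polynomial ℂ}
    {σ : ℕ → VacuumModule ℓ →ₗ[ℂ] ℂ} (hσ : IsSymbol p.coeff σ) (s : Multiset ℕ) (q : ℤ) {b : ℕ}
    {w : VacuumModule ℓ} (hw : w ∈ filtration ℓ b) :
    σ (b + Multiset.card s) (((A.Y (monomial ℓ s))[[q]]) w)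
      = if q < 0 then (jet p s).coeff (-q - 1).toNat * σ b w else 0 := by
  induction s using multiset_induction_max generalizing q b w with
  | zero =>
    rw [hA.Y_monomial_zero, idField_ncoeff, Multiset.card_zero, add_zero, jet, Multiset.map_zero,
      Multiset.prod_zero, Polynomial.coeff_one]
    by_cases hq : q = -1
    · subst hq
      simp
    · rw [if_neg hq, map_zero]
      split_ifs
      · omega
      · rw [zero_mul]
      · rfl
  | cons k t ht ih =>
    rw [hA.Y_monomial_cons ht, map_nthProd_ncoeff, Multiset.card_cons, ← add_assoc,
      residueSum_eq_zero (p := q) (q := 0), smul_zero, sub_zero, residueSum]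
    · have e : ∀ i : ℕ, binomCoeff (-k - 1) i •
          σ (b + Multiset.card t + 1) (((virField ℓ)[[0 + (-k - 1) - i]])
            (((A.Y (monomial ℓ t))[[q + i]]) w))
          = if q + i < 0 then (k + i).choose i * p.coeff (k + i)
              * ((jet p t).coeff (-(q + i) - 1).toNat * σ b w) else 0 := by
        intro i
        rw [virField_ncoeff, show (0 : ℤ) + (-k - 1) - i - 1 = -(k + i : ℕ) - 2 by push_cast; ring,
          hσ.opL _ (hA.ncoeff_mem_filtration t _ hw), ih _ hw, binomCoeff_neg, smul_eq_mul]
        split_ifs <;> ring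
      rw [finsum_congr e]
      split_ifs with hq
      · obtain ⟨T, rfl⟩ : ∃ T : ℕ, q = -T - 1 := ⟨(-q - 1).toNat, by omega⟩
        rw [finsum_eq_sum_of_support_subset (s := Finset.range (T + 1)), jet_cons,
          show (-(-(T : ℤ) - 1) - 1).toNat = T by omega,
          Polynomial.coeff_mul, Finset.Nat.sum_antidiagonal_eq_sum_range_succ_mk, Finset.sum_mul]
        · refine Finset.sum_congr rfl fun i hi => ?_
          have hi' := Finset.mem_range.1 hi
          rw [if_pos (by omega), Polynomial.hasseDeriv_coeff,
            show (-(-(T : ℤ) - 1 + i) - 1).toNat = T - i by omega, add_comm i k,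
            Nat.choose_symm_add]
          ring
        · intro i hi
          by_contra h
          have h' : T + 1 ≤ i := by simpa using h
          exact hi (if_neg (by omega))
      · exact finsum_eq_zero_of_forall_eq_zero fun i => if_neg (by omega)
    -- In the reversed product the operators `L(n)`, `n ≥ -1`, act first; these keep the degree.
    · intro m n hn
      exact hσ.eq_zero (hA.ncoeff_mem_filtration t m (virField_mem_filtration_of_nonneg hn hw))
        (Nat.lt_succ_self _)

end Virasoro

/-! ### Linear forms on iterated Laurent series -/

namespace IteratedLaurent

/-- The coefficientwise application of a linear form to Laurent series. -/
def coeffwise {F M : Type*} [Field F] [AddCommGroup M] [Module F M] (g : M →ₗ[F] F) :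
    HahnModule ℤ F M →ₗ[HahnSeries ℤ F] HahnSeries ℤ F where
  toFun s := ((HahnModule.of F).symm s).map g
  map_add' s t := by
    ext k
    simp
  map_smul' x s := by
    ext k
    rw [HahnSeries.map_coeff, HahnModule.coeff_smul, map_sum, RingHom.id_apply, smul_eq_mul,
      HahnSeries.coeff_mul_right' ((HahnModule.of F).symm s).isPWO_support]
    · exact Finset.sum_congr rfl fun ij _ => map_smul g _ _
    · intro i hi h
      refine hi ?_
      rw [HahnSeries.map_coeff, h, map_zero]

variable {V : Type u} [AddCommGroup V] [Module ℂ V]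

/-- The extension of a linear form on `V` to a linear form on `V((x₁))⋯((x_n))` over
`ℂ((x₁))⋯((x_n))`. -/
def iteratedForm (φ : V →ₗ[ℂ] ℂ) : (n : ℕ) → Vectors V n →ₗ[Scalars n] Scalars n
  | 0 => φ
  | n + 1 => coeffwise (iteratedForm φ n)

theorem iteratedForm_succ_coeff (φ : V →ₗ[ℂ] ℂ) {n : ℕ} (s : Vectors V (n + 1)) (k : ℤ) :
    HahnSeries.coeff (iteratedForm φ (n + 1) s : HahnSeries ℤ (Scalars n)) k
      = iteratedForm φ n ((toSeries s).coeff k) := rfl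

/-- The inclusion of `ℂ((x₁))⋯((x_n))` into `ℂ((x₁))⋯((x_{n+1}))`. -/
def const (n : ℕ) : Scalars n →ₐ[ℂ] Scalars (n + 1) :=
  { (HahnSeries.C : Scalars n →+* HahnSeries ℤ (Scalars n)) with
    commutes' := fun a =>
      ((HahnSeries.algebraMap_apply (Γ := ℤ) (R := ℂ) (A := Scalars n) (r := a)).trans rfl).symm }

/-- The element `x_{n+1}` of `ℂ((x₁))⋯((x_{n+1}))`. -/
def lastVar (n : ℕ) : Scalars (n + 1) := (HahnSeries.single 1 1 : HahnSeries ℤ (Scalars n))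

/-- The elements `x₁, …, x_n` of `ℂ((x₁))⋯((x_n))`. -/
def var : (n : ℕ) → Fin n → Scalars n
  | 0 => Fin.elim0
  | n + 1 => Fin.snoc (α := fun _ => Scalars (n + 1)) (fun i => const n (var n i)) (lastVar n)

theorem var_castSucc {n : ℕ} (i : Fin n) : var (n + 1) i.castSucc = const n (var n i) :=
  Fin.snoc_castSucc (α := fun _ => Scalars (n + 1)) _ _ _

theorem var_last (n : ℕ) : var (n + 1) (Fin.last n) = lastVar n :=
  Fin.snoc_last (α := fun _ => Scalars (n + 1)) _ _

theorem const_mul_coeff {n : ℕ} (a : Scalars n) (b : Scalars (n + 1)) (k : ℤ) :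
    HahnSeries.coeff (const n a * b : HahnSeries ℤ (Scalars n)) k
      = a * HahnSeries.coeff (b : HahnSeries ℤ (Scalars n)) k :=
  HahnSeries.coeff_single_zero_mul

theorem const_ne_lastVar {n : ℕ} (a : Scalars n) : const n a ≠ lastVar n := by
  intro h
  have h' := congrArg (fun f : HahnSeries ℤ (Scalars n) => f.coeff 1) h
  have h₁ : HahnSeries.coeff (HahnSeries.single 0 a : HahnSeries ℤ (Scalars n)) 1
      = HahnSeries.coeff (HahnSeries.single 1 1 : HahnSeries ℤ (Scalars n)) 1 := h'
  rw [HahnSeries.coeff_single_of_ne (by decide), HahnSeries.coeff_single_same] at h₁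
  exact zero_ne_one h₁

theorem var_injective (n : ℕ) : Function.Injective (var n) := by
  induction n with
  | zero => exact fun i => i.elim0
  | succ n ih =>
    intro i j h
    induction i using Fin.lastCases with
    | last =>
      induction j using Fin.lastCases with
      | last => rfl
      | cast j =>
        rw [var_last, var_castSucc] at h
        exact absurd h.symm (const_ne_lastVar _)
    | cast i =>
      induction j using Fin.lastCases with
      | last =>
        rw [var_last, var_castSucc] at h
        exact absurd h (const_ne_lastVar _)
      | cast j =>
        rw [var_castSucc, var_castSucc] at h
        rw [ih ((const n).toRingHom.injective h)]

theorem aeval_lastVar_coeff {n : ℕ} (P : Polynomial ℂ) (k : ℤ) :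
    HahnSeries.coeff (Polynomial.aeval (lastVar n) P : HahnSeries ℤ (Scalars n)) k
      = if 0 ≤ k then algebraMap ℂ (Scalars n) (P.coeff k.toNat) else 0 := by
  induction P using Polynomial.induction_on' with
  | add P Q hP hQ =>
    rw [map_add]
    refine HahnSeries.coeff_add.trans ?_
    rw [hP, hQ, Polynomial.coeff_add, map_add]
    split_ifs <;> simp
  | monomial j a =>
    rw [Polynomial.aeval_monomial, ← (const n).commutes a]
    refine (const_mul_coeff _ _ _).trans ?_
    have h : (lastVar n ^ j : HahnSeries ℤ (Scalars n)) = HahnSeries.single (j : ℤ) 1 :=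
      (HahnSeries.single_pow _ _ _).trans (by simp)
    rw [h, HahnSeries.coeff_single, Polynomial.coeff_monomial]
    by_cases hk : k = j
    · subst hk
      simp
    · rw [if_neg hk, mul_zero]
      split_ifs
      · omega
      · rw [map_zero]
      · rfl

end IteratedLaurent

/-! ### Symbols of iterated products of vertex operators -/

namespace Virasoro

open IteratedLaurent VacuumModule

variable {ℓ : ℂ} {A : VertexAlgebraStructure (VacuumModule ℓ)}

theorem iteratedForm_product_succ_coeff (φ : VacuumModule ℓ →ₗ[ℂ] ℂ) {n : ℕ}
    (u : Fin (n + 1) → VacuumModule ℓ) (w : VacuumModule ℓ) (k : ℤ) :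
    HahnSeries.coeff (iteratedForm φ (n + 1) (A.product (n + 1) u w) : HahnSeries ℤ (Scalars n)) k
      = iteratedForm φ n (A.product n (Fin.init u) (((A.Y (u (Fin.last n)))[[-k - 1]]) w)) := by
  rw [iteratedForm_succ_coeff, A.product_succ, toSeries_extend_coeff, coeff_eq_ncoeff]

theorem IsVacuumVertexAlgebra.iteratedForm_product_eq_zero (hA : IsVacuumVertexAlgebra ℓ A)
    (φ : VacuumModule ℓ →ₗ[ℂ] ℂ) {n : ℕ} (s : Fin n → Multiset ℕ) {b : ℕ} {w : VacuumModule ℓ}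
    (hw : w ∈ filtration ℓ b)
    (hφ : ∀ v ∈ filtration ℓ (b + ∑ i, Multiset.card (s i)), φ v = 0) :
    iteratedForm φ n (A.product n (fun i => monomial ℓ (s i)) w) = 0 := by
  induction n generalizing b w with
  | zero => exact hφ w (by simpa using hw)
  | succ n ih =>
    refine HahnSeries.ext (funext fun k => ?_)
    refine (iteratedForm_product_succ_coeff φ _ w k).trans ?_
    refine ih (fun i => s i.castSucc) (hA.ncoeff_mem_filtration (s (Fin.last n)) _ hw) ?_
    rw [add_assoc, add_comm (Multiset.card _), ← Fin.sum_univ_castSucc (fun i => (s i).card)]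
    exact hφ

/-- On the highest filtration degree, `Y(u₁, x₁) ⋯ Y(u_n, x_n)` is multiplication by the product of
the symbols of the `u_i`, evaluated on the derivatives of `p` at `x_i`. -/
theorem IsVacuumVertexAlgebra.iteratedForm_product (hA : IsVacuumVertexAlgebra ℓ A)
    {p : Polynomial ℂ} {σ : ℕ → VacuumModule ℓ →ₗ[ℂ] ℂ} (hσ : IsSymbol p.coeff σ) {n : ℕ}
    (s : Fin n → Multiset ℕ) {b : ℕ} {w : VacuumModule ℓ} (hw : w ∈ filtration ℓ b) :
    iteratedForm (σ (b + ∑ i, Multiset.card (s i))) n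
        (A.product n (fun i => monomial ℓ (s i)) w)
      = algebraMap ℂ (Scalars n) (σ b w) * ∏ i, Polynomial.aeval (var n i) (jet p (s i)) := by
  induction n generalizing b w with
  | zero =>
    simp only [Finset.univ_eq_empty, Finset.sum_empty, Finset.prod_empty, add_zero, mul_one]
    rfl
  | succ n ih =>
    have h := fun k : ℤ =>
      ih (fun i => s i.castSucc) (hA.ncoeff_mem_filtration (s (Fin.last n)) (-k - 1) hw)
    rw [add_assoc, add_comm (Multiset.card _), ← Fin.sum_univ_castSucc (fun i => (s i).card)] at h
    refine HahnSeries.ext (funext fun k => ?_)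
    refine (iteratedForm_product_succ_coeff _ _ w k).trans ((h k).trans ?_)
    rw [hA.symbol_ncoeff hσ _ _ hw, Fin.prod_univ_castSucc, var_last]
    simp only [var_castSucc, Polynomial.aeval_algHom_apply]
    rw [← map_prod, ← (const n).commutes, ← mul_assoc, ← map_mul]
    refine Eq.trans ?_ (const_mul_coeff _ _ _).symm
    rw [aeval_lastVar_coeff, show -(-k - 1) - 1 = k by ring]
    split_ifs
    · rw [map_mul]
      ring
    · omega
    · omega
    · rw [map_zero, zero_mul, mul_zero]

end Virasoro

/-! ### Independence of the values of a polynomial and its derivatives -/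

section Jets

open Polynomial

variable {K ι : Type*} [Field K] [Finite ι] {x : ι → K}

/-- A polynomial with prescribed Taylor coefficients, up to order `N`, at distinct points. -/
theorem exists_eval_hasseDeriv_eq (hx : Function.Injective x) (N : ℕ) (t : ι × ℕ → K) :
    ∃ P : K[X], ∀ i, ∀ k < N, (hasseDeriv k P).eval (x i) = t (i, k) := by
  have hcop : Pairwise (Function.onFun IsCoprime
      fun i => Ideal.span {((X - C (x i)) ^ N : K[X])}) := fun i j hij =>
    (Ideal.isCoprime_span_singleton_iff _ _).2 (pairwise_coprime_X_sub_C hx hij).pow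
  obtain ⟨P, hP⟩ := Ideal.exists_forall_sub_mem_ideal hcop
    fun i => taylor (-x i) (∑ k ∈ Finset.range N, C (t (i, k)) * X ^ k)
  refine ⟨P, fun i k hk => ?_⟩
  obtain ⟨Q, hQ⟩ := Ideal.mem_span_singleton'.1 (hP i)
  have h := congrArg (fun R => (taylor (x i) R).coeff k) hQ
  simp only [taylor_mul, taylor_pow, map_sub, taylor_X, taylor_C, add_sub_cancel_right,
    taylor_taylor, add_neg_cancel, taylor_zero, coeff_sub, coeff_mul_X_pow', not_le.2 hk,
    if_false] at h
  rw [← taylor_coeff, sub_eq_zero.1 h.symm]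
  simp [coeff_X_pow, hk]

theorem hasseDeriv_X_pow_eq {R : Type*} [Semiring R] (k j : ℕ) :
    hasseDeriv k (X ^ j : R[X]) = (j.choose k : R[X]) * X ^ (j - k) := by
  rw [X_pow_eq_monomial, hasseDeriv_monomial, mul_one, ← C_mul_X_pow_eq_monomial, C_eq_natCast]

theorem eval_hasseDeriv_eq_sum (P : K[X]) (y : K) (k : ℕ) :
    (hasseDeriv k P).eval y
      = ∑ j ∈ Finset.range (P.natDegree + 1), P.coeff j * (hasseDeriv k (X ^ j : K[X])).eval y := by
  conv_lhs => rw [P.as_sum_range_C_mul_X_pow]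
  rw [map_sum, eval_finsetSum]
  refine Finset.sum_congr rfl fun j _ => ?_
  rw [← smul_eq_C_mul, map_smul, eval_smul, smul_eq_mul]

/-- A polynomial relation between the values of `p` and its derivatives at distinct points of an
extension of `ℂ`, which holds for all complex polynomials `p`, is trivial. -/
theorem eq_zero_of_forall_eval_hasseDeriv [Algebra ℂ K] (hx : Function.Injective x)
    (F : MvPolynomial (ι × ℕ) K)
    (hF : ∀ p : ℂ[X], MvPolynomial.eval (fun i => aeval (x i.1) (hasseDeriv i.2 p)) F = 0) :
    F = 0 := by
  have hinj : Function.Injective (algebraMap ℂ K) := (algebraMap ℂ K).injective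
  have hK : Infinite K := Infinite.of_injective _ hinj
  -- The relation extends to polynomials over `K`, being polynomial in the coefficients of `p`.
  have hFK : ∀ P : K[X], MvPolynomial.eval (fun i => (hasseDeriv i.2 P).eval (x i.1)) F = 0 := by
    intro P
    set d := P.natDegree + 1 with hd
    let G : MvPolynomial ℕ K := MvPolynomial.bind₁ (fun i => ∑ j ∈ Finset.range d,
      MvPolynomial.X j * MvPolynomial.C ((hasseDeriv i.2 (X ^ j : K[X])).eval (x i.1))) F
    have hG : ∀ a : ℕ → K, MvPolynomial.eval a G = MvPolynomial.eval (fun i =>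
        ∑ j ∈ Finset.range d, a j * (hasseDeriv i.2 (X ^ j : K[X])).eval (x i.1)) F := by
      intro a
      refine (MvPolynomial.eval₂Hom_bind₁ _ _ _ _).trans ?_
      simp only [map_sum, map_mul, MvPolynomial.eval₂Hom_X', MvPolynomial.eval₂Hom_C,
        RingHom.id_apply]
      rfl
    have hG0 : G = 0 := by
      refine MvPolynomial.funext_set (fun _ => Set.range (algebraMap ℂ K))
        (fun _ => Set.infinite_range_of_injective hinj) fun a ha => ?_
      choose b hb using fun j => ha j (Set.mem_univ j)
      obtain rfl : (fun j => algebraMap ℂ K (b j)) = a := funext hb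
      rw [hG, map_zero, ← hF (∑ j ∈ Finset.range d, C (b j) * X ^ j)]
      congr 2
      funext i
      rw [map_sum, map_sum]
      refine Finset.sum_congr rfl fun j _ => ?_
      rw [← smul_eq_C_mul, map_smul, map_smul, Algebra.smul_def, aeval_def, ← eval_map,
        hasseDeriv_X_pow_eq, hasseDeriv_X_pow_eq]
      simp
    rw [← map_zero (MvPolynomial.eval P.coeff), ← hG0, hG]
    congr 2
    funext i
    exact eval_hasseDeriv_eq_sum P _ _
  refine MvPolynomial.funext fun t => ?_
  obtain ⟨P, hP⟩ := exists_eval_hasseDeriv_eq hx (F.vars.sup Prod.snd + 1) t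
  rw [map_zero, ← hFK P]
  refine MvPolynomial.eval₂Hom_congr' rfl (fun i hi _ => ?_) rfl
  exact (hP i.1 i.2 (Nat.lt_succ_of_le (Finset.le_sup (f := Prod.snd) hi))).symm

end Jets

/-! ### Nondegeneracy -/

namespace Virasoro

open IteratedLaurent VacuumModule

/-- The multiset of all pairs `(i, k)` with `k ∈ s i`. -/
def pairs {n : ℕ} (s : Fin n → Multiset ℕ) : Multiset (Fin n × ℕ) :=
  ∑ i, (s i).map (Prod.mk i)

theorem count_pairs {n : ℕ} (s : Fin n → Multiset ℕ) (i : Fin n) (k : ℕ) :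
    (pairs s).count (i, k) = (s i).count k := by
  rw [pairs, Multiset.count_sum', Finset.sum_eq_single i]
  · exact Multiset.count_map_eq_count' _ _ (Prod.mk_right_injective i) k
  · intro j _ hj
    refine Multiset.count_eq_zero.2 fun h => hj ?_
    obtain ⟨a, _, ha⟩ := Multiset.mem_map.1 h
    exact congrArg Prod.fst ha
  · simp

theorem pairs_injective (n : ℕ) :
    Function.Injective (pairs : (Fin n → Multiset ℕ) → Multiset (Fin n × ℕ)) := by
  intro s t h
  funext i
  ext k
  rw [← count_pairs, h, count_pairs]

theorem prod_map_X_eq_monomial {α K : Type*} [CommSemiring K] [DecidableEq α] (m : Multiset α) :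
    (m.map fun i => (MvPolynomial.X i : MvPolynomial α K)).prod
      = MvPolynomial.monomial (Multiset.toFinsupp m) 1 := by
  induction m using Multiset.induction with
  | empty => simp
  | cons a m ih =>
    rw [Multiset.map_cons, Multiset.prod_cons, ih, MvPolynomial.X, MvPolynomial.monomial_mul,
      one_mul, ← Multiset.singleton_add, map_add, Multiset.toFinsupp_singleton]

variable {ℓ : ℂ} {A : VertexAlgebraStructure (VacuumModule ℓ)}

theorem prod_aeval_jet {n : ℕ} (p : Polynomial ℂ) (s : Fin n → Multiset ℕ) :
    ∏ i, Polynomial.aeval (var n i) (jet p (s i))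
      = ((pairs s).map fun i =>
          Polynomial.aeval (var n i.1) (Polynomial.hasseDeriv i.2 p)).prod := by
  rw [pairs, ← Multiset.coe_mapAddMonoidHom, map_sum, Multiset.prod_sum]
  refine Finset.prod_congr rfl fun i _ => ?_
  rw [jet, map_multiset_prod, Multiset.map_map, Multiset.coe_mapAddMonoidHom, Multiset.map_map]
  rfl

variable (ℓ) in
/-- The map `(f_s)_s ↦ ∑_s u_{s 1} ⊗ ⋯ ⊗ u_{s n} ⊗ f_s`, where the `u_t` are the monomials in the
`L(-k-2)`. -/
def ofCoefficients (n : ℕ) : ((Fin n → Multiset ℕ) →₀ Scalars n) →ₗ[ℂ]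
    (⨂[ℂ] _ : Fin n, VacuumModule ℓ) ⊗[ℂ] Scalars n :=
  Finsupp.lsum ℂ fun s =>
    TensorProduct.mk ℂ _ _ (PiTensorProduct.tprod ℂ fun i => monomial ℓ (s i))

theorem ofCoefficients_surjective (n : ℕ) : Function.Surjective (ofCoefficients ℓ n) := by
  rw [← LinearMap.range_eq_top, eq_top_iff, ← TensorProduct.span_tmul_eq_top, Submodule.span_le]
  rintro _ ⟨x, a, rfl⟩
  have hx : x ∈ Submodule.span ℂ (Set.range fun s : Fin n → Multiset ℕ =>
      PiTensorProduct.tprod ℂ fun i => monomial ℓ (s i)) := by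
    rw [PiTensorProduct.submodule_span_eq_top fun _ => span_monomial ℓ]
    trivial
  induction hx using Submodule.span_induction with
  | mem x hx =>
    obtain ⟨s, rfl⟩ := hx
    exact ⟨Finsupp.single s a, by simp [ofCoefficients]⟩
  | zero => rw [TensorProduct.zero_tmul]; exact zero_mem _
  | add x y _ _ hx hy => rw [TensorProduct.add_tmul]; exact add_mem hx hy
  | smul c x _ hx => rw [← TensorProduct.smul_tmul']; exact Submodule.smul_mem _ c hx

theorem Z_ofCoefficients (n : ℕ) (f : (Fin n → Multiset ℕ) →₀ Scalars n) :
    A.Z n (ofCoefficients ℓ n f)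
      = ∑ s ∈ f.support, f s • A.product n (fun i => monomial ℓ (s i)) A.vac := by
  rw [ofCoefficients, Finsupp.lsum_apply, Finsupp.sum, map_sum]
  exact Finset.sum_congr rfl fun s _ => A.Z_apply n _ _

/-- In a relation between products of vertex operators, the terms of highest degree cancel. As
functions of an arbitrary polynomial `p`, they are differential monomials in the values of `p` at
the `x_i`, and these are independent. -/
theorem IsVacuumVertexAlgebra.isNondegenerate (hA : IsVacuumVertexAlgebra ℓ A) :
    A.IsNondegenerate := by
  classical
  intro n _
  suffices h : Function.Injective (A.Z n ∘ₗ ofCoefficients ℓ n) from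
    Function.Injective.of_comp_right h (ofCoefficients_surjective n)
  refine (injective_iff_map_eq_zero _).2 fun f hz => ?_
  rw [LinearMap.comp_apply, Z_ofCoefficients, hA.vac_eq] at hz
  by_contra hf
  obtain ⟨s₀, hs₀, hmax⟩ := f.support.exists_max_image (fun s => ∑ i, (s i).card)
    (Finsupp.support_nonempty_iff.2 hf)
  set d := ∑ i, (s₀ i).card with hd
  let F : MvPolynomial (Fin n × ℕ) (Scalars n) :=
    ∑ s ∈ f.support with ∑ i, (s i).card = d, MvPolynomial.monomial (pairs s).toFinsupp (f s)
  have hF : F = 0 := by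
    refine eq_zero_of_forall_eval_hasseDeriv (var_injective n) F fun p => ?_
    obtain ⟨σ, hσ⟩ := exists_isSymbol ℓ p.coeff
    have hvac : vac ℓ ∈ filtration ℓ 0 := by
      rw [← monomial_zero]
      exact monomial_mem_filtration (by simp)
    have h := congrArg (iteratedForm (σ d) n) hz
    rw [map_zero, map_sum] at h
    rw [map_sum, ← h, Finset.sum_filter]
    refine Finset.sum_congr rfl fun s hs => ?_
    rw [map_smul, smul_eq_mul]
    split_ifs with hsd
    · have h' := hA.iteratedForm_product hσ s hvac
      rw [zero_add, hsd, hσ.vac, map_one, one_mul] at h'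
      rw [h', prod_aeval_jet, ← mul_one (f s), ← smul_eq_mul (f s), ← MvPolynomial.smul_monomial,
        ← prod_map_X_eq_monomial, MvPolynomial.smul_eval, map_multiset_prod, Multiset.map_map,
        smul_eq_mul, mul_one]
      simp
    · rw [hA.iteratedForm_product_eq_zero (σ d) s hvac, mul_zero]
      intro v hv
      rw [zero_add] at hv
      exact hσ.eq_zero hv (lt_of_le_of_ne (hmax s hs) hsd)
  refine Finsupp.mem_support_iff.1 hs₀ ?_
  have h := congrArg (MvPolynomial.coeff (pairs s₀).toFinsupp) hF
  rw [MvPolynomial.coeff_sum, Finset.sum_eq_single s₀, MvPolynomial.coeff_monomial, if_pos rfl] at h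
  · exact h
  · intro s _ hs
    rw [MvPolynomial.coeff_monomial, if_neg]
    exact fun h => hs (pairs_injective n (Multiset.toFinsupp.injective h))
  · intro h
    exact (h (Finset.mem_filter.2 ⟨hs₀, rfl⟩)).elim

end Virasoro

end

theorem proposition3p19 (ℓ : ℂ) :
    (∃! A : VertexAlgebraStructure (Virasoro.VacuumModule ℓ),
        Virasoro.IsVacuumVertexAlgebra ℓ A) ∧
      ∀ A : VertexAlgebraStructure (Virasoro.VacuumModule ℓ),
        Virasoro.IsVacuumVertexAlgebra ℓ A →
          A.IsVertexOperatorAlgebra (Virasoro.VacuumModule.conformal ℓ) ℓ ∧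
            A.IsNondegenerate :=
  ⟨⟨Virasoro.VacuumModule.vertexAlgebra ℓ, Virasoro.VacuumModule.isVacuumVertexAlgebra ℓ,
      fun _ hB => hB.eq (Virasoro.VacuumModule.isVacuumVertexAlgebra ℓ)⟩,
    fun _ hA => ⟨hA.isVertexOperatorAlgebra, hA.isNondegenerate⟩⟩
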